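/- Let $N\ge 3$ and let $\Omega\subset\mathbb R^N$ be a bounded open set with $0\in\partial\Omega$ whose boundary is of class $C^{1,1}$ near $0$: there are $r_0\in(0,1)$ and $g\in C^{1,1}(\mathbb R^{N-1})$ with $B_{r_0}\cap\Omega=\{x\in B_{r_0}: x_N>g(x')\}$ and $B_{r_0}\cap\partial\Omega=\{x\in B_{r_0}: x_N=g(x')\}$, where $B_{r_0}$ is the open ball of radius $r_0$ about the origin and $x'=(x_1,\dots,x_{N-1})$. Let $\mathcal V\subset\mathbb R^N$ be a bounded open set with $0\in\mathcal V$ and $\operatorname{diam}\mathcal V<r_0$, and for $\varepsilon\in(0,1)$ put $\Sigma_\varepsilon=(\varepsilon\mathcal V)\cap\partial\Omega$. For a closed set $\Gamma\subseteq\partial\Omega$ let $H^1_{0,\Gamma}(\Omega)$ be the closure in $H^1(\Omega)$ of $C_c^\infty(\overline\Omega\setminus\Gamma)$, i.e. of the restrictions to $\Omega$ of the functions $\phi\in C_c^\infty(\mathbb R^N)$ with $\operatorname{supp}\phi\cap\Gamma=\emptyset$, and let $H^1_0(\Omega)$ be the closure in $H^1(\Omega)$ of $C_c^\infty(\Omega)$.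 For a closed subspace $W\subseteq H^1(\Omega)$, the number $\lambda\in\mathbb R$ is an eigenvalue on $W$ if there is $\varphi\in W\setminus\{0\}$ with $\int_\Omega\nabla\varphi\cdot\nabla v\,dx=\lambda\int_\Omega\varphi v\,dx$ for all $v\in W$; its multiplicity is the dimension of the space of all such $\varphi$, together with $0$. Then, for $W=H^1_0(\Omega)$ and, for every $\varepsilon\in(0,1)$, for $W=H^1_{0,\partial\Omega\setminus\Sigma_\varepsilon}(\Omega)$, the eigenvalues on $W$, repeated according to multiplicity, form a diverging nondecreasing sequence of positive numbers. Denote these sequences by $(\lambda_i)_{i\ge1}$ (the Dirichlet eigenvalues) and $(\lambda_i^\varepsilon)_{i\ge1}$ (the eigenvalues of the mixed problem with Neumann region $\Sigma_\varepsilon$), respectively. For every $i\ge1$, $$\lambda_i^\varepsilon\to\lambda_i\qquad\text{as }\varepsilon\to0^+.$$ -/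

import Mathlib

open MeasureTheory Set Filter Topology
open scoped Pointwise ContDiff

noncomputable section

namespace MixedEigenvalue

/-- `C_c^∞(U)`: smooth functions on `ℝᴺ` whose (topological) support is compact and contained
in `U`. -/
structure IsTestFunction {N : ℕ} (U : Set (EuclideanSpace ℝ (Fin N)))
    (φ : EuclideanSpace ℝ (Fin N) → ℝ) : Prop where
  contDiff : ContDiff ℝ ∞ φ
  hasCompactSupport : HasCompactSupport φ
  tsupport_subset : tsupport φ ⊆ U

theorem IsTestFunction.add {N : ℕ} {U : Set (EuclideanSpace ℝ (Fin N))}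
    {φ ψ : EuclideanSpace ℝ (Fin N) → ℝ} (hφ : IsTestFunction U φ) (hψ : IsTestFunction U ψ) :
    IsTestFunction U (φ + ψ) :=
  ⟨hφ.contDiff.add hψ.contDiff, hφ.hasCompactSupport.add hψ.hasCompactSupport,
    (tsupport_add φ ψ).trans (union_subset hφ.tsupport_subset hψ.tsupport_subset)⟩

theorem IsTestFunction.const_smul {N : ℕ} {U : Set (EuclideanSpace ℝ (Fin N))}
    {φ : EuclideanSpace ℝ (Fin N) → ℝ} (c : ℝ) (hφ : IsTestFunction U φ) :
    IsTestFunction U (c • φ) :=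
  ⟨hφ.contDiff.const_smul c, hφ.hasCompactSupport.smul_left (f := fun _ => c),
    (tsupport_smul_subset_right (fun _ => c) φ).trans hφ.tsupport_subset⟩

theorem IsTestFunction.zero {N : ℕ} (U : Set (EuclideanSpace ℝ (Fin N))) :
    IsTestFunction U (0 : EuclideanSpace ℝ (Fin N) → ℝ) :=
  ⟨contDiff_const, HasCompactSupport.zero, by simp⟩

theorem IsTestFunction.memLp {N : ℕ} {U : Set (EuclideanSpace ℝ (Fin N))}
    {φ : EuclideanSpace ℝ (Fin N) → ℝ} (hφ : IsTestFunction U φ)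
    (μ : Measure (EuclideanSpace ℝ (Fin N))) [IsFiniteMeasureOnCompacts μ] : MemLp φ 2 μ :=
  hφ.contDiff.continuous.memLp_of_hasCompactSupport hφ.hasCompactSupport

theorem IsTestFunction.memLp_gradient {N : ℕ} {U : Set (EuclideanSpace ℝ (Fin N))}
    {φ : EuclideanSpace ℝ (Fin N) → ℝ} (hφ : IsTestFunction U φ)
    (μ : Measure (EuclideanSpace ℝ (Fin N))) [IsFiniteMeasureOnCompacts μ] :
    MemLp (gradient φ) 2 μ := by
  have hc : Continuous (gradient φ) :=
    (InnerProductSpace.toDual ℝ (EuclideanSpace ℝ (Fin N))).symm.continuous.comp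
      (hφ.contDiff.continuous_fderiv (by simp))
  have hs : HasCompactSupport (gradient φ) :=
    (hφ.hasCompactSupport.fderiv (𝕜 := ℝ)).comp_left (g := (InnerProductSpace.toDual ℝ
      (EuclideanSpace ℝ (Fin N))).symm) (map_zero _)
  exact hc.memLp_of_hasCompactSupport hs

/-- `G` is the weak (distributional) gradient of `u` on `Ω`. -/
def IsWeakGradient {N : ℕ} (Ω : Set (EuclideanSpace ℝ (Fin N)))
    (u : EuclideanSpace ℝ (Fin N) → ℝ)
    (G : EuclideanSpace ℝ (Fin N) → EuclideanSpace ℝ (Fin N)) : Prop :=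
  ∀ φ : EuclideanSpace ℝ (Fin N) → ℝ, IsTestFunction Ω φ →
    ∫ x in Ω, u x • gradient φ x = - ∫ x in Ω, φ x • G x

/-- The Hilbert space `L²(Ω) × L²(Ω; ℝᴺ)` with norm `(‖u‖² + ‖G‖²)^{1/2}`. -/
abbrev L2Pair {N : ℕ} (Ω : Set (EuclideanSpace ℝ (Fin N))) : Type :=
  WithLp 2 (Lp ℝ 2 (volume.restrict Ω) ×
    Lp (EuclideanSpace ℝ (Fin N)) 2 (volume.restrict Ω))

/-- The Sobolev space `H¹(Ω)`, each element `u` being stored together with its weak gradient as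
the pair `(u, ∇u)`; the induced norm is `(‖u‖²_{L²} + ‖∇u‖²_{L²})^{1/2}`. -/
def H1 {N : ℕ} (Ω : Set (EuclideanSpace ℝ (Fin N))) : Submodule ℝ (L2Pair Ω) where
  carrier := {p | IsWeakGradient Ω p.fst p.snd}
  zero_mem' := by
    intro φ _
    have h1 : ∫ x in Ω, ((0 : L2Pair Ω).fst x) • gradient φ x = 0 := by
      refine integral_eq_zero_of_ae ?_
      filter_upwards [Lp.coeFn_zero ℝ 2 (volume.restrict Ω)] with x hx
      rw [WithLp.zero_fst, hx]
      simp
    have h2 : ∫ x in Ω, φ x • ((0 : L2Pair Ω).snd x) = 0 := by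
      refine integral_eq_zero_of_ae ?_
      filter_upwards [Lp.coeFn_zero (EuclideanSpace ℝ (Fin N)) 2 (volume.restrict Ω)] with x hx
      rw [WithLp.zero_snd, hx]
      simp
    rw [h1, h2, neg_zero]
  add_mem' := by
    intro p q hp hq φ hφ
    have i1 : ∀ f : Lp ℝ 2 (volume.restrict Ω),
        Integrable (fun x => f x • gradient φ x) (volume.restrict Ω) := fun f =>
      memLp_one_iff_integrable.1 ((hφ.memLp_gradient _).smul (Lp.memLp f))
    have i2 : ∀ f : Lp (EuclideanSpace ℝ (Fin N)) 2 (volume.restrict Ω),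
        Integrable (fun x => φ x • f x) (volume.restrict Ω) := fun f =>
      memLp_one_iff_integrable.1 ((Lp.memLp f).smul (hφ.memLp _))
    have h1 : ∫ x in Ω, (p + q).fst x • gradient φ x
        = (∫ x in Ω, p.fst x • gradient φ x) + ∫ x in Ω, q.fst x • gradient φ x := by
      rw [← integral_add (i1 _) (i1 _)]
      refine integral_congr_ae ?_
      filter_upwards [Lp.coeFn_add p.fst q.fst] with x hx
      rw [WithLp.add_fst, hx, Pi.add_apply, add_smul]
    have h2 : ∫ x in Ω, φ x • (p + q).snd x
        = (∫ x in Ω, φ x • p.snd x) + ∫ x in Ω, φ x • q.snd x := by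
      rw [← integral_add (i2 _) (i2 _)]
      refine integral_congr_ae ?_
      filter_upwards [Lp.coeFn_add p.snd q.snd] with x hx
      rw [WithLp.add_snd, hx, Pi.add_apply, smul_add]
    rw [h1, h2, hp φ hφ, hq φ hφ, neg_add]
  smul_mem' := by
    intro c p hp φ hφ
    have h1 : ∫ x in Ω, (c • p).fst x • gradient φ x
        = c • ∫ x in Ω, p.fst x • gradient φ x := by
      rw [← integral_smul]
      refine integral_congr_ae ?_
      filter_upwards [Lp.coeFn_smul c p.fst] with x hx
      rw [WithLp.smul_fst, hx, Pi.smul_apply, smul_assoc]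
    have h2 : ∫ x in Ω, φ x • (c • p).snd x = c • ∫ x in Ω, φ x • p.snd x := by
      rw [← integral_smul]
      refine integral_congr_ae ?_
      filter_upwards [Lp.coeFn_smul c p.snd] with x hx
      rw [WithLp.smul_snd, hx, Pi.smul_apply, smul_comm]
    rw [h1, h2, hp φ hφ, smul_neg]

/-- The function part of an element of `H¹(Ω)`. -/
def toL2 {N : ℕ} {Ω : Set (EuclideanSpace ℝ (Fin N))} :
    H1 Ω →ₗ[ℝ] Lp ℝ 2 (volume.restrict Ω) where
  toFun u := (u : L2Pair Ω).fst
  map_add' _ _ := rfl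
  map_smul' _ _ := rfl

/-- The weak gradient of an element of `H¹(Ω)`. -/
def grad {N : ℕ} {Ω : Set (EuclideanSpace ℝ (Fin N))} :
    H1 Ω →ₗ[ℝ] Lp (EuclideanSpace ℝ (Fin N)) 2 (volume.restrict Ω) where
  toFun u := (u : L2Pair Ω).snd
  map_add' _ _ := rfl
  map_smul' _ _ := rfl

/-- The elements of `H¹(Ω)` that are restrictions to `Ω` of functions in `C_c^∞(U)`. -/
def testSubmodule {N : ℕ} (Ω U : Set (EuclideanSpace ℝ (Fin N))) : Submodule ℝ (H1 Ω) where
  carrier := {u | ∃ φ, IsTestFunction U φ ∧ toL2 u =ᵐ[volume.restrict Ω] φ}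
  zero_mem' := ⟨0, IsTestFunction.zero U, Lp.coeFn_zero ℝ 2 (volume.restrict Ω)⟩
  add_mem' := by
    rintro u v ⟨φ, hφ, hu⟩ ⟨ψ, hψ, hv⟩
    exact ⟨φ + ψ, hφ.add hψ, (Lp.coeFn_add (toL2 u) (toL2 v)).trans (hu.add hv)⟩
  smul_mem' := by
    rintro c u ⟨φ, hφ, hu⟩
    exact ⟨c • φ, hφ.const_smul c, (Lp.coeFn_smul c (toL2 u)).trans (hu.const_smul c)⟩

/-- `H¹_{0,Γ}(Ω)`: the closure in `H¹(Ω)` of `C_c^∞(Ω̄ ∖ Γ)`, that is, of the restrictions to `Ω`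
of the smooth functions on `ℝᴺ` whose compact support does not meet `Γ`. -/
def H1ZeroOn {N : ℕ} (Ω Γ : Set (EuclideanSpace ℝ (Fin N))) : Submodule ℝ (H1 Ω) :=
  (testSubmodule Ω Γᶜ).topologicalClosure

/-- `H¹₀(Ω)`: the closure in `H¹(Ω)` of `C_c^∞(Ω)`. -/
def H1Zero {N : ℕ} (Ω : Set (EuclideanSpace ℝ (Fin N))) : Submodule ℝ (H1 Ω) :=
  (testSubmodule Ω Ω).topologicalClosure

/-- `u ∈ W` solves `∫_Ω ∇u·∇v = μ ∫_Ω u v` for all `v ∈ W`. The inner products are those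
of `L²(Ω; ℝᴺ)` and `L²(Ω)`. -/
def IsWeakSolution {N : ℕ} {Ω : Set (EuclideanSpace ℝ (Fin N))} (W : Submodule ℝ (H1 Ω)) (μ : ℝ)
    (u : H1 Ω) : Prop :=
  u ∈ W ∧ ∀ v ∈ W, inner ℝ (grad u) (grad v) = μ * inner ℝ (toL2 u) (toL2 v)

theorem IsWeakSolution.add {N : ℕ} {Ω : Set (EuclideanSpace ℝ (Fin N))} {W : Submodule ℝ (H1 Ω)}
    {μ : ℝ} {a b : H1 Ω} (ha : IsWeakSolution W μ a) (hb : IsWeakSolution W μ b) :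
    IsWeakSolution W μ (a + b) := by
  refine ⟨W.add_mem ha.1 hb.1, fun v hv => ?_⟩
  rw [map_add, map_add, inner_add_left, inner_add_left, ha.2 v hv, hb.2 v hv, mul_add]

theorem IsWeakSolution.const_smul {N : ℕ} {Ω : Set (EuclideanSpace ℝ (Fin N))}
    {W : Submodule ℝ (H1 Ω)} {μ : ℝ} (c : ℝ) {a : H1 Ω} (ha : IsWeakSolution W μ a) :
    IsWeakSolution W μ (c • a) := by
  refine ⟨W.smul_mem c ha.1, fun v hv => ?_⟩
  rw [map_smul, map_smul, real_inner_smul_left, real_inner_smul_left, ha.2 v hv, mul_left_comm]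

/-- The space of weak solutions: `0` and the eigenfunctions in `W` with eigenvalue `μ`. -/
def eigenspace {N : ℕ} {Ω : Set (EuclideanSpace ℝ (Fin N))} (W : Submodule ℝ (H1 Ω)) (μ : ℝ) :
    Submodule ℝ (H1 Ω) where
  carrier := {u | IsWeakSolution W μ u}
  zero_mem' := ⟨W.zero_mem, fun v _ => by simp⟩
  add_mem' ha hb := IsWeakSolution.add ha hb
  smul_mem' c _ ha := IsWeakSolution.const_smul c ha

/-- `lam 0 ≤ lam 1 ≤ ⋯` is the diverging sequence of the (positive) eigenvalues of the Laplacian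
with form domain `W`, each one repeated according to its multiplicity: every real `μ` occurs exactly
as many times as the dimension of its eigenspace (so not at all if `μ` is not an eigenvalue).
The `i`-th eigenvalue, `i = 1, 2, …`, is `lam (i - 1)`. -/
structure IsEigenvalueSequence {N : ℕ} {Ω : Set (EuclideanSpace ℝ (Fin N))}
    (W : Submodule ℝ (H1 Ω)) (lam : ℕ → ℝ) : Prop where
  pos : ∀ i, 0 < lam i
  monotone : Monotone lam
  tendsto_atTop : Tendsto lam atTop atTop
  multiplicity : ∀ μ : ℝ,
    {i | lam i = μ}.encard = Cardinal.toENat (Module.rank ℝ (eigenspace W μ))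

/-- `x' = (x₁, …, x_{N-1})` for `x ∈ ℝᴺ`, `N = n + 1`. -/
def horizontal {n : ℕ} (x : EuclideanSpace ℝ (Fin (n + 1))) : EuclideanSpace ℝ (Fin n) :=
  WithLp.toLp 2 fun j => x j.castSucc

/-- `g ∈ C^{1,1}`: continuously differentiable with Lipschitz derivative. -/
def IsC11 {n : ℕ} (g : EuclideanSpace ℝ (Fin n) → ℝ) : Prop :=
  ContDiff ℝ 1 g ∧ ∃ K, LipschitzWith K (fderiv ℝ g)

/-- In the ball `B_r` about the origin, `Ω` is the strict epigraph of `g` and `∂Ω` is the graph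
of `g`. -/
def IsEpigraphInBall {n : ℕ} (Ω : Set (EuclideanSpace ℝ (Fin (n + 1)))) (r : ℝ)
    (g : EuclideanSpace ℝ (Fin n) → ℝ) : Prop :=
  Metric.ball 0 r ∩ Ω = {x ∈ Metric.ball 0 r | g (horizontal x) < x (Fin.last n)} ∧
  Metric.ball 0 r ∩ frontier Ω = {x ∈ Metric.ball 0 r | x (Fin.last n) = g (horizontal x)}

/-- The Neumann region `Σ_ε = (ε V) ∩ ∂Ω`. -/
def neumannRegion {N : ℕ} (Ω V : Set (EuclideanSpace ℝ (Fin N))) (ε : ℝ) :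
    Set (EuclideanSpace ℝ (Fin N)) :=
  (ε • V) ∩ frontier Ω

end MixedEigenvalue

end

/-! By the min-max principle, the i-th eigenvalue on a form domain W (counting from 1) is at most x
≥ 0 exactly when W contains a subspace of dimension at least i on which ‖∇u‖² ≤ x‖u‖²
(`IsEigenvalueSequence.le_iff`). It comes from the compact positive operator T on W with ⟪T u, v⟫ =
(u, v)_{L²}, the inner product on the left being that of H¹: a number μ is an eigenvalue on W
exactly when 1/(1+μ) is one of T.

Since H¹₀ lies in every mixed space, λ_i^ε ≤ λ_i. For the lower bound, suppose λ_i^ε ≤ x along some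
ε_k → 0 and take the corresponding trial subspaces. All the mixed spaces lie in one space Wd that
embeds compactly in L², so L²-orthonormal families in the trial subspaces converge along a
subsequence, and their limits span a trial subspace for H¹₀ (`exists_submodule_of_seq`), provided
that limits belong to H¹₀ without increase of the gradient bound. This is
`exists_mem_H1Zero_of_tendsto`, and it holds because a point has zero H¹-capacity for N ≥ 3: there
are cut-offs η vanishing on B_ρ with ‖∇η‖ = O(√ρ). Truncating the functions smoothly at height of
order 1/τ first, with τ = ρ^{1/4}, makes the term containing ∇η vanish in the limit, while
truncation does not increase the gradient.

Compactness and the Poincaré inequality on Wd cannot rest on regularity of ∂Ω, which is known only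
near 0. They follow from a one-sided translation estimate. A function extended by zero may jump
across the Neumann part, but a segment that starts in Ω and points upwards relative to the graph
cannot meet that part; it reaches ∂Ω only where the function vanishes. Hence ‖u − u(· + w)‖_{L²(Ω)}
≤ |w| ‖∇u‖ for all short w in an open cone (`lintegral_sub_translate_le`). Iterating one such w
until Ω is left gives the Poincaré inequality; averaging over a ball of such w approximates u in L²
by finite rank operators. -/

noncomputable section

namespace MixedEigenvalue

/-! ### Sequences and their counting functions -/

section Counting

/-- The number of values at most `x`, counted with the multiplicities `m`. -/
def countLE (m : ℝ → ℕ) (hm : ∀ x, (Function.support m ∩ Iic x).Finite) (x : ℝ) : ℕ :=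
  ∑ y ∈ (hm x).toFinset, m y

variable {m : ℝ → ℕ} {hm : ∀ x, (Function.support m ∩ Iic x).Finite}

/-- The indices with `lam j ≤ x` form a finite initial segment of ℕ, whose cardinality is the sum of
the fibre sizes. Indices start at 0, hence the strict inequality. -/
theorem le_iff_lt_countLE {lam : ℕ → ℝ} (hmono : Monotone lam) (htop : Tendsto lam atTop atTop)
    (hmul : ∀ y, {i | lam i = y}.encard = m y) (i : ℕ) (x : ℝ) :
    lam i ≤ x ↔ i < countLE m hm x := by
  classical
  obtain ⟨M, hM⟩ := eventually_atTop.1 (htop.eventually_gt_atTop x)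
  have hlt : ∀ j, lam j ≤ x → j < M := fun j hj => by
    by_contra h
    exact absurd (hM j (not_lt.1 h)) (not_lt.2 hj)
  let s : Finset ℕ := {j ∈ Finset.range M | lam j ≤ x}
  have hs : ∀ j, j ∈ s ↔ lam j ≤ x := fun j => by
    simp only [s, Finset.mem_filter, Finset.mem_range, and_iff_right_iff_imp]
    exact hlt j
  have hfib : ∀ y ≤ x, {j ∈ s | lam j = y}.card = m y := fun y hy => by
    have h := hmul y
    have he : {i | lam i = y} = (({j ∈ s | lam j = y} : Finset ℕ) : Set ℕ) := by
      ext j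
      simp only [mem_ofPred_eq, Finset.coe_filter, hs]
      exact ⟨fun h => ⟨h ▸ hy, h⟩, fun h => h.2⟩
    rw [he, Set.encard_coe_eq_coe_finsetCard] at h
    exact_mod_cast h
  have hcard : s.card = countLE m hm x := by
    rw [countLE, Finset.card_eq_sum_card_fiberwise (f := lam) (t := (hm x).toFinset)]
    · refine Finset.sum_congr rfl fun y hy => hfib y ?_
      exact ((Set.Finite.mem_toFinset _).1 hy).2
    · intro j hj
      have hj' := (hs j).1 hj
      simp only [Set.Finite.coe_toFinset, mem_inter_iff, Function.mem_support, mem_Iic]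
      refine ⟨?_, hj'⟩
      rw [← hfib _ hj']
      exact Finset.card_ne_zero.2 ⟨j, by simpa using hj⟩
  have hrange : s = Finset.range s.card := by
    have hlow : ∀ j ∈ s, ∀ k ≤ j, k ∈ s := fun j hj k hk =>
      (hs k).2 ((hmono hk).trans ((hs j).1 hj))
    refine Finset.eq_of_subset_of_card_le (fun j hj => ?_) (by simp)
    have : Finset.range (j + 1) ⊆ s := fun k hk =>
      hlow j hj k (Nat.lt_succ_iff.1 (Finset.mem_range.1 hk))
    have := Finset.card_le_card this
    simp only [Finset.card_range] at this
    exact Finset.mem_range.2 this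
  rw [← hs, hrange, Finset.mem_range, hcard]

theorem countLE_mono : Monotone (countLE m hm) := fun x y hxy => by
  refine Finset.sum_le_sum_of_subset fun z hz => ?_
  simp only [Set.Finite.mem_toFinset, mem_inter_iff, mem_Iic] at hz ⊢
  exact ⟨hz.1, hz.2.trans hxy⟩

theorem exists_seq_of_countLE_unbounded (hunb : ∀ k, ∃ x, k ≤ countLE m hm x)
    (hpos : ∀ x, m x ≠ 0 → 0 < x) :
    ∃ lam : ℕ → ℝ, (∀ i, 0 < lam i) ∧ Monotone lam ∧ Tendsto lam atTop atTop ∧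
      ∀ y, {i | lam i = y}.encard = m y := by
  classical
  have hex : ∀ i : ℕ, ∃ y, m y ≠ 0 ∧ ∀ x, y ≤ x ↔ i < countLE m hm x := fun i => by
    obtain ⟨X, hX⟩ := hunb (i + 1)
    -- The i-th value is the least support point at which the count exceeds i. Since the count only
    -- changes at support points, searching among them below X is enough.
    let s : Finset ℝ := {y ∈ (hm X).toFinset | i < countLE m hm y}
    have hsum : ∀ x ≤ X, i < countLE m hm x → ∃ z ∈ s, z ≤ x := fun x hxX hx => by
      have hne : (hm x).toFinset.Nonempty := by
        by_contra h
        rw [Finset.not_nonempty_iff_eq_empty] at h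
        simp [countLE, h] at hx
      obtain ⟨z, hz, hzmax⟩ := (hm x).toFinset.exists_max_image id hne
      have hz' := (Set.Finite.mem_toFinset _).1 hz
      refine ⟨z, ?_, hz'.2⟩
      simp only [s, Finset.mem_filter, Set.Finite.mem_toFinset]
      refine ⟨⟨hz'.1, le_trans hz'.2 hxX⟩, hx.trans_le ?_⟩
      refine Finset.sum_le_sum_of_subset fun t ht => ?_
      have h1 := hzmax t ht
      simp only [Set.Finite.mem_toFinset, mem_inter_iff, mem_Iic] at ht ⊢
      exact ⟨ht.1, h1⟩
    obtain ⟨z, hz, -⟩ := hsum X le_rfl hX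
    obtain ⟨y, hy, hymin⟩ := s.exists_min_image id ⟨z, hz⟩
    simp only [s, Finset.mem_filter, Set.Finite.mem_toFinset] at hy
    refine ⟨y, hy.1.1, fun x => ⟨fun h => hy.2.trans_le (countLE_mono h), fun h => ?_⟩⟩
    rcases le_total x X with hx | hx
    · obtain ⟨t, ht, htx⟩ := hsum x hx h
      exact (hymin t ht).trans htx
    · exact hy.1.2.trans hx
  choose lam hlam0 hlam using hex
  refine ⟨lam, fun i => hpos _ (hlam0 i), fun i j hij => ?_, ?_, fun y => ?_⟩
  · exact (hlam i _).2 (hij.trans_lt ((hlam j _).1 le_rfl))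
  · refine tendsto_atTop.2 fun b => ?_
    filter_upwards [eventually_ge_atTop (countLE m hm b)] with i hi
    exact (not_le.1 fun h => absurd ((hlam i b).1 h) (not_lt.2 hi)).le
  · let t : Finset ℝ := (hm y).toFinset.erase y
    have ht : ∀ z, z ∈ t ↔ m z ≠ 0 ∧ z < y := fun z => by
      simp only [t, Finset.mem_erase, Set.Finite.mem_toFinset, mem_inter_iff,
        Function.mem_support, mem_Iic]
      constructor
      · rintro ⟨h1, h2, h3⟩
        exact ⟨h2, lt_of_le_of_ne h3 h1⟩
      · rintro ⟨h1, h2⟩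
        exact ⟨h2.ne, h1, h2.le⟩
    let p : ℕ := ∑ z ∈ t, m z
    have hp : countLE m hm y = p + m y := by
      by_cases h : m y = 0
      · have : t = (hm y).toFinset := Finset.erase_eq_of_notMem (by simp [h])
        simp only [p, this, h, add_zero]
        rfl
      · rw [add_comm]
        exact (Finset.add_sum_erase _ m (by simp [h])).symm
    have hlt : ∀ i, lam i < y ↔ i < p := fun i => by
      constructor
      · intro h
        refine ((hlam i _).1 le_rfl).trans_le (Finset.sum_le_sum_of_subset fun z hz => ?_)
        simp only [Set.Finite.mem_toFinset, mem_inter_iff, Function.mem_support, mem_Iic] at hz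
        exact (ht z).2 ⟨hz.1, hz.2.trans_lt h⟩
      · intro h
        have hne : t.Nonempty := by
          by_contra h0
          rw [Finset.not_nonempty_iff_eq_empty] at h0
          simp [p, h0] at h
        obtain ⟨z, hz, hzmax⟩ := t.exists_max_image id hne
        refine lt_of_le_of_lt ((hlam i z).2 (h.trans_le ?_)) ((ht z).1 hz).2
        refine Finset.sum_le_sum_of_subset fun a ha => ?_
        simp only [Set.Finite.mem_toFinset, mem_inter_iff, Function.mem_support, mem_Iic]
        exact ⟨((ht a).1 ha).1, hzmax a ha⟩
    -- The count jumps at y from p to p + m y, so exactly these indices take the value y.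
    have : {i | lam i = y} = ((Finset.Ico p (p + m y) : Finset ℕ) : Set ℕ) := by
      ext i
      simp only [mem_ofPred_eq, Finset.coe_Ico, mem_Ico]
      rw [← hp, ← hlam i y, ← not_lt, ← hlt i, not_lt]
      exact ⟨fun h => ⟨h.ge, h.le⟩, fun h => le_antisymm h.2 h.1⟩
    rw [this, Set.encard_coe_eq_coe_finsetCard]
    simp

end Counting

theorem finrank_biSup_of_iSupIndep {K M ι : Type*} [DivisionRing K] [AddCommGroup M] [Module K M]
    {p : ι → Submodule K M} (hp : iSupIndep p) (s : Finset ι)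
    (hfin : ∀ i ∈ s, FiniteDimensional K (p i)) :
    FiniteDimensional K (⨆ i ∈ s, p i : Submodule K M) ∧
      Module.finrank K (⨆ i ∈ s, p i : Submodule K M) = ∑ i ∈ s, Module.finrank K (p i) := by
  classical
  induction s using Finset.induction_on with
  | empty =>
    have h : (⨆ i ∈ (∅ : Finset ι), p i) = ⊥ := by simp
    rw [h]
    exact ⟨inferInstance, by simp⟩
  | insert a s ha ih =>
    obtain ⟨h1, h2⟩ := ih fun i hi => hfin i (Finset.mem_insert_of_mem hi)
    have := hfin a (Finset.mem_insert_self a s)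
    have hdis : Disjoint (p a) (⨆ i ∈ s, p i) :=
      (hp a).mono_right
        (iSup₂_mono' fun i hi => ⟨i, ne_of_mem_of_not_mem hi ha, le_rfl⟩)
    rw [Finset.iSup_insert, Finset.sum_insert ha, ← h2]
    refine ⟨inferInstance, ?_⟩
    have := Submodule.finrank_sup_add_finrank_inf_eq (p a) (⨆ i ∈ s, p i)
    rwa [hdis.eq_bot, finrank_bot, add_zero] at this

/-! ### Compact positive operators and the min-max principle -/

section Spectral

variable {E : Type*} [NormedAddCommGroup E] [InnerProductSpace ℝ E] {T : E →L[ℝ] E}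

/-- The sum of the eigenspaces of `T` with eigenvalue at least `κ`. -/
def upperSpectral (T : E →L[ℝ] E) (κ : ℝ) : Submodule ℝ E :=
  ⨆ k : Ici κ, Module.End.eigenspace (T : Module.End ℝ E) (k : ℝ)

theorem le_inner_of_mem_upperSpectral (hT : T.IsSymmetric) {κ : ℝ} {u : E}
    (hu : u ∈ upperSpectral T κ) : κ * ‖u‖ ^ 2 ≤ inner ℝ (T u) u := by
  classical
  rw [upperSpectral, Submodule.mem_iSup_iff_exists_finsupp] at hu
  obtain ⟨f, hf, rfl⟩ := hu
  have hfam := (LinearMap.IsSymmetric.orthogonalFamily_eigenspaces hT).comp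
    (Subtype.coe_injective (p := (· ∈ Ici κ)))
  let l : ∀ k : Ici κ, Module.End.eigenspace (T : Module.End ℝ E) (k : ℝ) := fun k => ⟨f k, hf k⟩
  have hfT : ∀ k, T (f k) = (k : ℝ) • f k := fun k => Module.End.mem_eigenspace_iff.1 (hf k)
  have h1 : ‖∑ k ∈ f.support, f k‖ ^ 2 = ∑ k ∈ f.support, ‖f k‖ ^ 2 := hfam.norm_sum l f.support
  have h2 : inner ℝ (∑ k ∈ f.support, (k : ℝ) • f k) (∑ k ∈ f.support, f k)
      = ∑ k ∈ f.support, (k : ℝ) * ‖f k‖ ^ 2 := by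
    refine (hfam.inner_sum (fun k => (k : ℝ) • l k) l f.support).trans
      (Finset.sum_congr rfl fun k _ => ?_)
    rw [real_inner_smul_left, real_inner_self_eq_norm_sq]
    rfl
  have e1 : (f.sum fun _ x => x) = ∑ k ∈ f.support, f k := rfl
  rw [e1, map_sum, Finset.sum_congr rfl fun k _ => hfT k, h2, h1, Finset.mul_sum]
  exact Finset.sum_le_sum fun k _ => mul_le_mul_of_nonneg_right k.2 (by positivity)

variable [CompleteSpace E]

/-- The bound gives κ‖u‖ ≤ ‖T u‖ on the closure of S, so T embeds that closure as a closed set.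
Compactness of T then makes its closed unit ball compact, and Riesz's theorem applies. -/
theorem finiteDimensional_of_le_inner (hT : IsCompactOperator T) {κ : ℝ} (hκ : 0 < κ)
    (S : Submodule ℝ E) (hS : ∀ u ∈ S, κ * ‖u‖ ^ 2 ≤ inner ℝ (T u) u) :
    FiniteDimensional ℝ S := by
  have hcl : ∀ u ∈ S.topologicalClosure, κ * ‖u‖ ^ 2 ≤ inner ℝ (T u) u := fun u hu =>
    closure_minimal (t := {u | κ * ‖u‖ ^ 2 ≤ inner ℝ (T u) u}) hS
      (isClosed_le (by fun_prop) (by fun_prop)) hu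
  have hcomp : CompleteSpace S.topologicalClosure :=
    S.isClosed_topologicalClosure.completeSpace_coe
  let A : S.topologicalClosure →L[ℝ] E := T.comp S.topologicalClosure.subtypeL
  have hA : AntilipschitzWith (Real.toNNReal κ⁻¹) A := by
    refine ContinuousLinearMap.antilipschitz_of_bound A fun u => ?_
    rw [Real.coe_toNNReal _ (by positivity)]
    rcases eq_or_ne ‖u‖ 0 with h | h
    · rw [h]; positivity
    · have h1 := (hcl u u.2).trans (real_inner_le_norm (T u) (u : E))
      have hpos : 0 < ‖u‖ := lt_of_le_of_ne (norm_nonneg _) h.symm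
      have h2 : κ * ‖u‖ ≤ ‖A u‖ := by
        refine le_of_mul_le_mul_right ?_ hpos
        calc κ * ‖u‖ * ‖u‖ = κ * ‖(u : E)‖ ^ 2 := by rw [Submodule.coe_norm]; ring
          _ ≤ _ := h1
      rw [inv_mul_eq_div, le_div_iff₀ hκ, mul_comm]
      exact h2
  have hemb := hA.isClosedEmbedding A.uniformContinuous
  obtain ⟨K, hK, hKs⟩ := hT.image_closedBall_subset_compact (f := (T : E →ₗ[ℝ] E)) 1
  have hball : IsCompact (Metric.closedBall (0 : S.topologicalClosure) 1) := by
    refine (hemb.isCompact_preimage hK).of_isClosed_subset Metric.isClosed_closedBall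
      fun u hu => hKs ⟨u, ?_, rfl⟩
    simpa using hu
  have := FiniteDimensional.of_isCompact_closedBall ℝ one_pos hball
  exact Submodule.finiteDimensional_of_le S.le_topologicalClosure

/-- For a self-adjoint operator the norm is the spectral radius, which is attained in the spectrum;
nonzero spectral values of a compact operator are eigenvalues. -/
theorem exists_eigenvector_norm_eq (hT : IsCompactOperator T) (hs : T.IsSymmetric) (hne : T ≠ 0) :
    ∃ (k : ℝ) (v : E), v ≠ 0 ∧ T v = k • v ∧ ‖k‖ = ‖T‖ := by
  have hrad := T.spectralRadius_eq_nnnorm hs.isSelfAdjoint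
  have hsn : (spectrum ℝ T).Nonempty := by
    by_contra h
    rw [Set.not_nonempty_iff_eq_empty] at h
    rw [spectralRadius, h] at hrad
    refine hne (nnnorm_eq_zero.1 (ENNReal.coe_eq_zero.1 (hrad.symm.trans ?_)))
    simp
  obtain ⟨k, hk, hkr⟩ := spectrum.exists_nnnorm_eq_spectralRadius_of_nonempty hsn
  rw [hrad, ENNReal.coe_inj] at hkr
  have hkn : ‖k‖ = ‖T‖ := congrArg NNReal.toReal hkr
  have hk0 : k ≠ 0 := fun h => by
    rw [h, norm_zero] at hkn
    exact hne (norm_eq_zero.1 hkn.symm)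
  obtain ⟨v, hv⟩ := ((hT.hasEigenvalue_iff_mem_spectrum hk0).2 hk).exists_hasEigenvector
  exact ⟨k, v, hv.2, Module.End.mem_eigenspace_iff.1 hv.1, hkn⟩

/-- The norm of the restriction to K is an eigenvalue up to sign, positivity of the form fixes the
sign, and the norm bounds the quadratic form on K. -/
theorem exists_eigenvector_of_invariant (hT : IsCompactOperator T) (hs : T.IsSymmetric)
    (hpos : ∀ u, u ≠ 0 → 0 < inner ℝ (T u) u) (K : Submodule ℝ E) [CompleteSpace K]
    (hK : ∀ v ∈ K, T v ∈ K) {u : E} (hu : u ∈ K) (hu0 : u ≠ 0) :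
    ∃ (k : ℝ) (v : E), v ∈ K ∧ v ≠ 0 ∧ T v = k • v ∧ inner ℝ (T u) u ≤ k * ‖u‖ ^ 2 := by
  let R : K →L[ℝ] K := T.restrict hK
  have hRc : IsCompactOperator R := hT.restrict' (f := (T : E →ₗ[ℝ] E)) hK
  have hRs : R.IsSymmetric := LinearMap.IsSymmetric.restrict_invariant hs hK
  have hx : inner ℝ (R ⟨u, hu⟩) ⟨u, hu⟩ = inner ℝ (T u) u := rfl
  have hne : R ≠ 0 := fun h => by
    have := hpos u hu0
    rw [← hx, h, zero_apply, inner_zero_left] at this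
    exact lt_irrefl _ this
  obtain ⟨k, v, hv0, hv, hk⟩ := exists_eigenvector_norm_eq hRc hRs hne
  have hvT : T (v : E) = k • (v : E) := congrArg Subtype.val hv
  have hv0' : (v : E) ≠ 0 := fun h => hv0 (Subtype.ext h)
  have hkpos : 0 < k := by
    have := hpos v hv0'
    rw [hvT, real_inner_smul_left, real_inner_self_eq_norm_sq] at this
    exact (pos_iff_pos_of_mul_pos this).2 (by have := norm_pos_iff.2 hv0'; positivity)
  refine ⟨k, v, v.2, hv0', hvT, ?_⟩
  rw [Real.norm_of_nonneg hkpos.le] at hk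
  calc inner ℝ (T u) u ≤ ‖R ⟨u, hu⟩‖ * ‖u‖ := real_inner_le_norm _ _
    _ ≤ (‖R‖ * ‖u‖) * ‖u‖ := by gcongr; exact R.le_opNorm ⟨u, hu⟩
    _ = k * ‖u‖ ^ 2 := by rw [← hk]; ring

/-- The complement is invariant. An eigenvector there with eigenvalue at least κ would also lie in
`upperSpectral T κ`, so the dominating eigenvalue on the complement is below κ. -/
theorem inner_lt_of_mem_orthogonal_upperSpectral (hT : IsCompactOperator T)
    (hs : T.IsSymmetric) (hpos : ∀ u, u ≠ 0 → 0 < inner ℝ (T u) u) {κ : ℝ}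
    {u : E} (hu : u ∈ (upperSpectral T κ)ᗮ) (hu0 : u ≠ 0) :
    inner ℝ (T u) u < κ * ‖u‖ ^ 2 := by
  have hinv : ∀ v ∈ (upperSpectral T κ)ᗮ, T v ∈ (upperSpectral T κ)ᗮ := by
    intro v hv
    rw [upperSpectral, ← Submodule.iInf_orthogonal] at hv ⊢
    exact (T : E →ₗ[ℝ] E).iInf_invariant
      (p := fun k : Ici κ => (Module.End.eigenspace (T : Module.End ℝ E) (k : ℝ))ᗮ)
      (fun k => LinearMap.IsSymmetric.invariant_orthogonalComplement_eigenspace hs (k : ℝ)) v hv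
  obtain ⟨k, v, hvK, hv0, hvT, hle⟩ := exists_eigenvector_of_invariant hT hs hpos _ hinv hu hu0
  have hkκ : k < κ := by
    by_contra h
    have hmem : v ∈ upperSpectral T κ :=
      Submodule.mem_iSup_of_mem (⟨k, not_lt.1 h⟩ : Ici κ) (Module.End.mem_eigenspace_iff.2 hvT)
    exact hv0 (inner_self_eq_zero.1 (Submodule.inner_right_of_mem_orthogonal hmem hvK))
  have hun : 0 < ‖u‖ := norm_pos_iff.2 hu0
  exact hle.trans_lt (by gcongr)

/-- The orthogonal projection of F to the spectral subspace is injective: a nonzero vector in its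
kernel would violate the bound defining F. This is the maximality half of min-max. -/
theorem finrank_le_finrank_upperSpectral (hT : IsCompactOperator T)
    (hs : T.IsSymmetric) (hpos : ∀ u, u ≠ 0 → 0 < inner ℝ (T u) u) {κ : ℝ} (hκ : 0 < κ)
    (F : Submodule ℝ E) (hF : ∀ u ∈ F, κ * ‖u‖ ^ 2 ≤ inner ℝ (T u) u) :
    Module.finrank ℝ F ≤ Module.finrank ℝ (upperSpectral T κ) := by
  have := finiteDimensional_of_le_inner hT hκ F hF
  have := finiteDimensional_of_le_inner hT hκ (upperSpectral T κ)
    fun u hu => le_inner_of_mem_upperSpectral hs hu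
  by_contra h
  let P : F →ₗ[ℝ] upperSpectral T κ :=
    ((upperSpectral T κ).orthogonalProjectionOnto : E →ₗ[ℝ] upperSpectral T κ).comp F.subtype
  have hker := LinearMap.ker_ne_bot_of_finrank_lt (f := P) (not_le.1 h)
  obtain ⟨x, hx, hx0⟩ := Submodule.exists_mem_ne_zero_of_ne_bot hker
  have hx1 : (x : E) ∈ (upperSpectral T κ)ᗮ := by
    rw [← Submodule.orthogonalProjectionOnto_eq_zero_iff]
    exact hx
  exact absurd (hF x x.2) (not_le.2 (inner_lt_of_mem_orthogonal_upperSpectral hT hs hpos hx1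
    fun h => hx0 (Subtype.ext h)))

theorem finiteDimensional_upperSpectral (hT : IsCompactOperator T) (hs : T.IsSymmetric) {κ : ℝ}
    (hκ : 0 < κ) : FiniteDimensional ℝ (upperSpectral T κ) :=
  finiteDimensional_of_le_inner hT hκ _ fun _ hu => le_inner_of_mem_upperSpectral hs hu

/-- The multiplicity of `x` as an eigenvalue of the form whose resolvent at `-1` is `T`. -/
def resolventMultiplicity (T : E →L[ℝ] E) (x : ℝ) : ℕ :=
  Module.finrank ℝ (Module.End.eigenspace (T : Module.End ℝ E) (1 + x)⁻¹)

/-- The two bounds on the form put (1 + x)⁻¹ strictly between 0 and 1. -/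
theorem pos_of_hasEigenvector (hpos : ∀ u, u ≠ 0 → 0 < inner ℝ (T u) u)
    (hlt : ∀ u, u ≠ 0 → inner ℝ (T u) u < ‖u‖ ^ 2) {x : ℝ} {u : E} (hu0 : u ≠ 0)
    (hu : T u = (1 + x)⁻¹ • u) : 0 < x := by
  have h1 := hpos u hu0
  have h2 := hlt u hu0
  have hn : 0 < ‖u‖ ^ 2 := by have := norm_pos_iff.2 hu0; positivity
  rw [hu, real_inner_smul_left, real_inner_self_eq_norm_sq] at h1 h2
  have h3 : 0 < 1 + x := inv_pos.1 ((pos_iff_pos_of_mul_pos h1).2 hn)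
  have h4 : (1 + x)⁻¹ < 1 := by
    by_contra h
    nlinarith [not_lt.1 h]
  have := (inv_lt_one₀ h3).1 h4
  linarith

theorem pos_of_resolventMultiplicity_ne_zero (hpos : ∀ u, u ≠ 0 → 0 < inner ℝ (T u) u)
    (hlt : ∀ u, u ≠ 0 → inner ℝ (T u) u < ‖u‖ ^ 2) {x : ℝ}
    (hx : resolventMultiplicity T x ≠ 0) : 0 < x := by
  have : Module.End.eigenspace (T : Module.End ℝ E) (1 + x)⁻¹ ≠ ⊥ := fun h => hx (by
    rw [resolventMultiplicity, h, finrank_bot])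
  obtain ⟨u, hu, hu0⟩ := Submodule.exists_mem_ne_zero_of_ne_bot this
  exact pos_of_hasEigenvector hpos hlt hu0 (Module.End.mem_eigenspace_iff.1 hu)

theorem iSupIndep_eigenspace_resolvent (hs : T.IsSymmetric) :
    iSupIndep fun x : ℝ => Module.End.eigenspace (T : Module.End ℝ E) (1 + x)⁻¹ :=
  (LinearMap.IsSymmetric.orthogonalFamily_eigenspaces hs).independent.comp
    fun x y h => by simpa using h

theorem finite_support_resolventMultiplicity (hT : IsCompactOperator T) (hs : T.IsSymmetric)
    (hpos : ∀ u, u ≠ 0 → 0 < inner ℝ (T u) u)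
    (hlt : ∀ u, u ≠ 0 → inner ℝ (T u) u < ‖u‖ ^ 2) (x : ℝ) :
    (Function.support (resolventMultiplicity T) ∩ Iic x).Finite := by
  rcases le_or_gt x 0 with hx | hx
  · convert Set.finite_empty (α := ℝ)
    refine Set.eq_empty_of_forall_notMem fun y hy => ?_
    exact absurd (pos_of_resolventMultiplicity_ne_zero hpos hlt hy.1) (not_lt.2 (hy.2.trans hx))
  have hκ : 0 < (1 + x)⁻¹ := by positivity
  have hfd := finiteDimensional_upperSpectral hT hs hκ
  by_contra hinf
  obtain ⟨t, hts, htc⟩ := Set.Infinite.exists_subset_card_eq hinf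
    (Module.finrank ℝ (upperSpectral T (1 + x)⁻¹) + 1)
  have hle : (⨆ y ∈ t, Module.End.eigenspace (T : Module.End ℝ E) (1 + y)⁻¹)
      ≤ upperSpectral T (1 + x)⁻¹ := iSup₂_le fun y hy => by
    have hy' := hts hy
    have hy0 := pos_of_resolventMultiplicity_ne_zero hpos hlt hy'.1
    have hyx : y ≤ x := hy'.2
    exact le_iSup (fun k : Ici (1 + x)⁻¹ => Module.End.eigenspace (T : Module.End ℝ E) (k : ℝ))
      ⟨(1 + y)⁻¹, by rw [mem_Ici]; gcongr⟩
  obtain ⟨-, h2⟩ := finrank_biSup_of_iSupIndep (iSupIndep_eigenspace_resolvent hs) t fun y hy =>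
    Module.finite_of_finrank_pos (Nat.pos_of_ne_zero (hts hy).1)
  have h3 := Submodule.finrank_mono hle
  rw [h2] at h3
  have h4 : t.card • 1 ≤ ∑ y ∈ t, resolventMultiplicity T y :=
    Finset.card_nsmul_le_sum _ _ _ fun y hy => Nat.pos_of_ne_zero (hts hy).1
  have h5 : ∑ y ∈ t, resolventMultiplicity T y ≤ _ := h3
  rw [smul_eq_mul, mul_one, htc] at h4
  omega

/-- The map y ↦ 1/(1+y) reverses order on the positive axis, so eigenvalues y ≤ x of the form
correspond to eigenvalues of T that are at least 1/(1+x). Dimensions add because the eigenspaces are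
independent. -/
theorem countLE_resolventMultiplicity (hT : IsCompactOperator T) (hs : T.IsSymmetric)
    (hpos : ∀ u, u ≠ 0 → 0 < inner ℝ (T u) u)
    (hlt : ∀ u, u ≠ 0 → inner ℝ (T u) u < ‖u‖ ^ 2) {x : ℝ} (hx : 0 ≤ x) :
    countLE (resolventMultiplicity T) (finite_support_resolventMultiplicity hT hs hpos hlt) x
      = Module.finrank ℝ (upperSpectral T (1 + x)⁻¹) := by
  have hκ : 0 < (1 + x)⁻¹ := by positivity
  have heq : upperSpectral T (1 + x)⁻¹ =
      ⨆ y ∈ (finite_support_resolventMultiplicity hT hs hpos hlt x).toFinset,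
        Module.End.eigenspace (T : Module.End ℝ E) (1 + y)⁻¹ := by
    have hfd := finiteDimensional_upperSpectral hT hs hκ
    apply le_antisymm
    · refine iSup_le fun k => ?_
      have hk : (1 + x)⁻¹ ≤ (k : ℝ) := k.2
      have hk0 : 0 < (k : ℝ) := hκ.trans_le hk
      have hkk : (1 + ((k : ℝ)⁻¹ - 1))⁻¹ = k := by simp
      have hfk : FiniteDimensional ℝ (Module.End.eigenspace (T : Module.End ℝ E) (k : ℝ)) :=
        Submodule.finiteDimensional_of_le (S₂ := upperSpectral T (1 + x)⁻¹) (le_iSup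
          (fun k : Ici (1 + x)⁻¹ => Module.End.eigenspace (T : Module.End ℝ E) (k : ℝ)) k)
      by_cases h : resolventMultiplicity T ((k : ℝ)⁻¹ - 1) = 0
      · rw [resolventMultiplicity, hkk, Submodule.finrank_eq_zero] at h
        rw [h]
        exact bot_le
      · refine le_trans (le_of_eq ?_) (le_iSup₂ ((k : ℝ)⁻¹ - 1) ?_)
        · rw [hkk]
        · rw [Set.Finite.mem_toFinset]
          refine ⟨h, ?_⟩
          rw [mem_Iic, sub_le_iff_le_add', inv_le_comm₀ hk0 (by positivity)]
          exact hk
    · refine iSup₂_le fun y hy => ?_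
      have hy' := (Set.Finite.mem_toFinset _).1 hy
      have hy0 := pos_of_resolventMultiplicity_ne_zero hpos hlt hy'.1
      have hyx : y ≤ x := hy'.2
      exact le_iSup (fun k : Ici (1 + x)⁻¹ => Module.End.eigenspace (T : Module.End ℝ E) (k : ℝ))
        ⟨(1 + y)⁻¹, by rw [mem_Ici]; gcongr⟩
  rw [heq, (finrank_biSup_of_iSupIndep (iSupIndep_eigenspace_resolvent hs) _ fun y hy =>
    Module.finite_of_finrank_pos
      (Nat.pos_of_ne_zero ((Set.Finite.mem_toFinset _).1 hy).1)).2]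
  rfl

/-- The count is unbounded because E contains subspaces of every finite dimension k, and on each of
them the form has a positive lower bound, which forces a spectral subspace of dimension at least k.
-/
theorem exists_eigenvalue_seq (hT : IsCompactOperator T) (hs : T.IsSymmetric)
    (hpos : ∀ u, u ≠ 0 → 0 < inner ℝ (T u) u)
    (hlt : ∀ u, u ≠ 0 → inner ℝ (T u) u < ‖u‖ ^ 2) (hinf : ¬ FiniteDimensional ℝ E) :
    ∃ lam : ℕ → ℝ, (∀ i, 0 < lam i) ∧ Monotone lam ∧ Tendsto lam atTop atTop ∧
      ∀ y, {i | lam i = y}.encard = resolventMultiplicity T y := by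
  refine exists_seq_of_countLE_unbounded
    (hm := finite_support_resolventMultiplicity hT hs hpos hlt) (fun k => ?_)
    fun x hx => pos_of_resolventMultiplicity_ne_zero hpos hlt hx
  by_contra! hk
  have hle : ∀ x : ℝ, 0 ≤ x → Module.finrank ℝ (upperSpectral T (1 + x)⁻¹) < k := fun x hx => by
    rw [← countLE_resolventMultiplicity hT hs hpos hlt hx]
    exact hk x
  refine hinf ?_
  have : Nontrivial E := by
    by_contra h
    rw [not_nontrivial_iff_subsingleton] at h
    exact hinf inferInstance
  obtain ⟨F, hFfin, hF⟩ : ∃ F : Submodule ℝ E, FiniteDimensional ℝ F ∧ Module.finrank ℝ F = k := by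
    have hrank : Cardinal.aleph0 ≤ Module.rank ℝ E := by
      rw [← not_lt, Module.rank_lt_aleph0_iff]
      exact hinf
    obtain ⟨f, hf⟩ := exists_linearIndependent_of_le_rank (n := k)
      ((Cardinal.natCast_le_aleph0).trans hrank)
    refine ⟨Submodule.span ℝ (range f), FiniteDimensional.span_of_finite ℝ (finite_range f), ?_⟩
    rw [finrank_span_eq_card hf, Fintype.card_fin]
  -- The form attains a positive minimum on the compact unit sphere of F.
  obtain ⟨c, hc, hcF⟩ : ∃ c : ℝ, 0 < c ∧ ∀ u ∈ F, c * ‖u‖ ^ 2 ≤ inner ℝ (T u) u := by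
    rcases subsingleton_or_nontrivial F with hsub | hnt
    · refine ⟨1, one_pos, fun u hu => ?_⟩
      have : u = 0 := congrArg Subtype.val (Subsingleton.elim (⟨u, hu⟩ : F) 0)
      simp [this]
    · obtain ⟨u₀, hu₀, hmin⟩ := (isCompact_sphere (0 : F) 1).exists_isMinOn
        (NormedSpace.sphere_nonempty.2 zero_le_one)
        (f := fun u : F => inner ℝ (T u) (u : E)) (by fun_prop)
      have hu₀n : ‖u₀‖ = 1 := by simpa using hu₀
      have hu₀' : (u₀ : E) ≠ 0 := fun h => by
        have : u₀ = 0 := Subtype.ext h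
        rw [this, norm_zero] at hu₀n
        exact zero_ne_one hu₀n
      refine ⟨_, hpos u₀ hu₀', fun u hu => ?_⟩
      rcases eq_or_ne u 0 with rfl | hu0
      · simp
      have hun : 0 < ‖u‖ := norm_pos_iff.2 hu0
      have h1 := hmin (a := ‖u‖⁻¹ • (⟨u, hu⟩ : F)) (by
        rw [mem_sphere_zero_iff_norm, norm_smul, norm_inv, norm_norm]
        exact inv_mul_cancel₀ hun.ne')
      simp only [mem_ofPred_eq, Submodule.coe_smul, map_smul, real_inner_smul_left,
        real_inner_smul_right] at h1
      calc _ ≤ (‖u‖⁻¹ * (‖u‖⁻¹ * inner ℝ (T u) u)) * ‖u‖ ^ 2 := by gcongr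
        _ = _ := by field_simp
  -- Capping at 1 makes x = κ⁻¹ − 1 nonnegative, as the bound on the count requires.
  let κ := min c 1
  have hκ : 0 < κ := lt_min hc one_pos
  have hκ1 : κ ≤ 1 := min_le_right _ _
  have h1 := finrank_le_finrank_upperSpectral hT hs hpos hκ F fun u hu =>
    le_trans (by gcongr; exact min_le_left _ _) (hcF u hu)
  have h2 := hle (κ⁻¹ - 1) (sub_nonneg.2 ((one_le_inv₀ hκ).2 hκ1))
  rw [add_sub_cancel, inv_inv] at h2
  omega

theorem le_iff_exists_submodule (hT : IsCompactOperator T) (hs : T.IsSymmetric)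
    (hpos : ∀ u, u ≠ 0 → 0 < inner ℝ (T u) u)
    (hlt : ∀ u, u ≠ 0 → inner ℝ (T u) u < ‖u‖ ^ 2) {lam : ℕ → ℝ} (hmono : Monotone lam)
    (htop : Tendsto lam atTop atTop)
    (hmul : ∀ y, {i | lam i = y}.encard = resolventMultiplicity T y) (i : ℕ) {x : ℝ}
    (hx : 0 ≤ x) :
    lam i ≤ x ↔ ∃ F : Submodule ℝ E, i < Module.finrank ℝ F ∧
      ∀ u ∈ F, ‖u‖ ^ 2 ≤ (1 + x) * inner ℝ (T u) u := by
  have hκ : 0 < (1 + x)⁻¹ := by positivity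
  have hiff : ∀ u : E, ‖u‖ ^ 2 ≤ (1 + x) * inner ℝ (T u) u ↔
      (1 + x)⁻¹ * ‖u‖ ^ 2 ≤ inner ℝ (T u) u := fun u => (inv_mul_le_iff₀ (by positivity)).symm
  rw [le_iff_lt_countLE (hm := finite_support_resolventMultiplicity hT hs hpos hlt) hmono htop hmul,
    countLE_resolventMultiplicity hT hs hpos hlt hx]
  constructor
  · intro h
    exact ⟨_, h, fun u hu => (hiff u).2 (le_inner_of_mem_upperSpectral hs hu)⟩
  · rintro ⟨F, hF, hFu⟩
    exact hF.trans_le (finrank_le_finrank_upperSpectral hT hs hpos hκ F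
      fun u hu => (hiff u).1 (hFu u hu))

end Spectral

/-! ### The Hilbert space H¹(Ω) and test functions -/

section Sobolev

variable {N : ℕ} {Ω U : Set (EuclideanSpace ℝ (Fin N))}

theorem IsTestFunction.mono {U' : Set (EuclideanSpace ℝ (Fin N))}
    {φ : EuclideanSpace ℝ (Fin N) → ℝ} (hφ : IsTestFunction U φ) (h : U ⊆ U') :
    IsTestFunction U' φ :=
  ⟨hφ.contDiff, hφ.hasCompactSupport, hφ.tsupport_subset.trans h⟩

theorem inner_gradient {φ : EuclideanSpace ℝ (Fin N) → ℝ} (x e : EuclideanSpace ℝ (Fin N)) :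
    inner ℝ (gradient φ x) e = fderiv ℝ φ x e := by
  rw [gradient, InnerProductSpace.toDual_symm_apply]

theorem norm_gradient {φ : EuclideanSpace ℝ (Fin N) → ℝ} (x : EuclideanSpace ℝ (Fin N)) :
    ‖gradient φ x‖ = ‖fderiv ℝ φ x‖ := by
  rw [gradient, LinearIsometryEquiv.norm_map]

theorem IsTestFunction.continuous_gradient {φ : EuclideanSpace ℝ (Fin N) → ℝ}
    (hφ : IsTestFunction U φ) : Continuous (gradient φ) :=
  (InnerProductSpace.toDual ℝ (EuclideanSpace ℝ (Fin N))).symm.continuous.comp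
    (hφ.contDiff.continuous_fderiv (by simp))

theorem IsTestFunction.memLp_smul_const {φ : EuclideanSpace ℝ (Fin N) → ℝ}
    (hφ : IsTestFunction U φ) (e : EuclideanSpace ℝ (Fin N))
    (μ : Measure (EuclideanSpace ℝ (Fin N))) [IsFiniteMeasureOnCompacts μ] :
    MemLp (fun x => φ x • e) 2 μ := by
  have hc : Continuous fun x => φ x • e := hφ.contDiff.continuous.smul continuous_const
  exact hc.memLp_of_hasCompactSupport (hφ.hasCompactSupport.smul_right (f' := fun _ => e))

/-- Pairing the vector identity with every e turns it into scalar equations continuous in p, from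
which closedness of H¹ in the product space follows. -/
theorem isWeakGradient_iff_inner {p : L2Pair Ω} :
    p ∈ H1 Ω ↔ ∀ (φ : EuclideanSpace ℝ (Fin N) → ℝ) (hφ : IsTestFunction Ω φ)
      (e : EuclideanSpace ℝ (Fin N)),
      inner ℝ (((hφ.memLp_gradient (volume.restrict Ω)).inner_const e).toLp _) p.fst
        + inner ℝ ((hφ.memLp_smul_const e (volume.restrict Ω)).toLp _) p.snd = 0 := by
  refine forall₂_congr fun φ hφ => ?_
  have i1 : Integrable (fun x => p.fst x • gradient φ x) (volume.restrict Ω) :=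
    memLp_one_iff_integrable.1 ((hφ.memLp_gradient _).smul (Lp.memLp p.fst))
  have i2 : Integrable (fun x => φ x • p.snd x) (volume.restrict Ω) :=
    memLp_one_iff_integrable.1 ((Lp.memLp p.snd).smul (hφ.memLp _))
  have h1 : ∀ e, inner ℝ (((hφ.memLp_gradient (volume.restrict Ω)).inner_const e).toLp _) p.fst
      = inner ℝ e (∫ x in Ω, p.fst x • gradient φ x) := fun e => by
    rw [← integral_inner i1, L2.inner_def]
    refine integral_congr_ae ?_
    filter_upwards [MemLp.coeFn_toLp (E := ℝ)
      ((hφ.memLp_gradient (volume.restrict Ω)).inner_const e)] with x hx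
    rw [hx, inner_smul_right, real_inner_comm e]
    rfl
  have h2 : ∀ e, inner ℝ ((hφ.memLp_smul_const e (volume.restrict Ω)).toLp _) p.snd
      = inner ℝ e (∫ x in Ω, φ x • p.snd x) := fun e => by
    rw [← integral_inner i2, L2.inner_def]
    refine integral_congr_ae ?_
    filter_upwards [(hφ.memLp_smul_const e (volume.restrict Ω)).coeFn_toLp] with x hx
    rw [hx, inner_smul_right, real_inner_smul_left]
  simp only [h1, h2, ← inner_add_right]
  rw [eq_neg_iff_add_eq_zero]
  constructor
  · intro h e
    rw [h, inner_zero_right]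
  · intro h
    exact inner_self_eq_zero.1 (h _)

theorem isClosed_H1 : IsClosed (H1 Ω : Set (L2Pair Ω)) := by
  have : (H1 Ω : Set (L2Pair Ω)) = ⋂ (φ : EuclideanSpace ℝ (Fin N) → ℝ)
      (hφ : IsTestFunction Ω φ) (e : EuclideanSpace ℝ (Fin N)), {p : L2Pair Ω |
      inner ℝ (((hφ.memLp_gradient (volume.restrict Ω)).inner_const e).toLp _) p.fst
        + inner ℝ ((hφ.memLp_smul_const e (volume.restrict Ω)).toLp _) p.snd = 0} := by
    ext p
    simp only [mem_iInter]
    exact isWeakGradient_iff_inner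
  rw [this]
  refine isClosed_iInter fun φ => isClosed_iInter fun hφ => isClosed_iInter fun e =>
    isClosed_eq ?_ continuous_const
  have c1 : Continuous fun p : L2Pair Ω => p.fst := (WithLp.fstL 2 ℝ _ _).continuous
  have c2 : Continuous fun p : L2Pair Ω => p.snd := (WithLp.sndL 2 ℝ _ _).continuous
  fun_prop

instance : CompleteSpace (H1 Ω) := isClosed_H1.completeSpace_coe

theorem inner_H1 (u v : H1 Ω) :
    inner ℝ u v = inner ℝ (toL2 u) (toL2 v) + inner ℝ (grad u) (grad v) :=
  WithLp.prod_inner_apply (u : L2Pair Ω) v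

theorem norm_sq_H1 (u : H1 Ω) : ‖u‖ ^ 2 = ‖toL2 u‖ ^ 2 + ‖grad u‖ ^ 2 := by
  simp only [← real_inner_self_eq_norm_sq, inner_H1]

theorem norm_toL2_le (u : H1 Ω) : ‖toL2 u‖ ≤ ‖u‖ :=
  le_of_sq_le_sq (by rw [norm_sq_H1 u]; nlinarith [sq_nonneg ‖grad u‖]) (norm_nonneg _)

theorem norm_grad_le (u : H1 Ω) : ‖grad u‖ ≤ ‖u‖ :=
  le_of_sq_le_sq (by rw [norm_sq_H1 u]; nlinarith [sq_nonneg ‖toL2 u‖]) (norm_nonneg _)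

/-- `toL2` as a continuous linear map. -/
def toL2L (Ω : Set (EuclideanSpace ℝ (Fin N))) : H1 Ω →L[ℝ] Lp ℝ 2 (volume.restrict Ω) :=
  toL2.mkContinuous 1 fun u => by rw [one_mul]; exact norm_toL2_le u

/-- `grad` as a continuous linear map. -/
def gradL (Ω : Set (EuclideanSpace ℝ (Fin N))) :
    H1 Ω →L[ℝ] Lp (EuclideanSpace ℝ (Fin N)) 2 (volume.restrict Ω) :=
  grad.mkContinuous 1 fun u => by rw [one_mul]; exact norm_grad_le u

theorem toL2L_apply (u : H1 Ω) : toL2L Ω u = toL2 u := rfl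

theorem gradL_apply (u : H1 Ω) : gradL Ω u = grad u := rfl

/-- The weak gradient of 0 integrates to zero against every test function, so it vanishes a.e. An
element of H¹ is thus determined by its function part. -/
theorem toL2_injective (hΩ : IsOpen Ω) : Function.Injective (toL2 : H1 Ω →ₗ[ℝ] _) := by
  refine (injective_iff_map_eq_zero _).2 fun u hu => ?_
  have hg : grad u = 0 := by
    have hloc : LocallyIntegrableOn (grad u) Ω volume :=
      (locallyIntegrableOn_of_locallyIntegrable_restrict
        ((Lp.memLp (grad u)).locallyIntegrable (by norm_num)))
    have h := hΩ.ae_eq_zero_of_integral_contDiff_smul_eq_zero hloc fun φ h1 h2 h3 => by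
      have hw := u.2 φ ⟨h1, h2, h3⟩
      have hz : ∫ x in Ω, (u : L2Pair Ω).fst x • gradient φ x = 0 := by
        refine integral_eq_zero_of_ae ?_
        have hu' : (u : L2Pair Ω).fst = 0 := hu
        rw [hu']
        filter_upwards [Lp.coeFn_zero ℝ 2 (volume.restrict Ω)] with x hx
        rw [hx]
        simp
      rw [hz, zero_eq_neg] at hw
      rw [← setIntegral_eq_integral_of_forall_compl_eq_zero (s := Ω)]
      · exact hw
      · intro x hx
        rw [image_eq_zero_of_notMem_tsupport fun h => hx (h3 h), zero_smul]
    refine Lp.ext ?_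
    filter_upwards [(ae_restrict_iff' hΩ.measurableSet).2 h, Lp.coeFn_zero
      (EuclideanSpace ℝ (Fin N)) 2 (volume.restrict Ω)] with x hx h0
    rw [hx, h0]
    rfl
  have := norm_sq_H1 u
  rw [hu, hg, norm_zero, norm_zero] at this
  exact norm_eq_zero.1 (pow_eq_zero_iff two_ne_zero |>.1 (by simpa using this))

/-- Since ψ is supported in Ω, both integrals extend to the whole space, where integration by parts
has no boundary term. -/
theorem integral_smul_gradient_eq {φ ψ : EuclideanSpace ℝ (Fin N) → ℝ}
    (hφ : IsTestFunction U φ) (hψ : IsTestFunction Ω ψ) :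
    ∫ x in Ω, φ x • gradient ψ x = - ∫ x in Ω, ψ x • gradient φ x := by
  have hz : ∀ x, x ∉ Ω → x ∉ tsupport ψ := fun x hx h => hx (hψ.tsupport_subset h)
  have hzg : ∀ x, x ∉ Ω → gradient ψ x = 0 := fun x hx => by
    rw [← norm_eq_zero, norm_gradient, norm_eq_zero]
    exact image_eq_zero_of_notMem_tsupport fun h => hz x hx (tsupport_fderiv_subset ℝ h)
  rw [setIntegral_eq_integral_of_forall_compl_eq_zero (fun x hx => by rw [hzg x hx, smul_zero]),
    setIntegral_eq_integral_of_forall_compl_eq_zero (fun x hx => by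
      rw [image_eq_zero_of_notMem_tsupport (hz x hx), zero_smul])]
  have i1 : Integrable (fun x => φ x • gradient ψ x) :=
    memLp_one_iff_integrable.1 ((hψ.memLp_gradient _).smul (hφ.memLp _))
  have i2 : Integrable (fun x => ψ x • gradient φ x) :=
    memLp_one_iff_integrable.1 ((hφ.memLp_gradient _).smul (hψ.memLp _))
  have i3 : Integrable (fun x => φ x * ψ x) :=
    memLp_one_iff_integrable.1 ((hψ.memLp _).smul (hφ.memLp _))
  refine ext_inner_left ℝ fun e => ?_
  rw [inner_neg_right, ← integral_inner i1, ← integral_inner i2]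
  have e1 : ∀ x, inner ℝ e (φ x • gradient ψ x) = φ x * fderiv ℝ ψ x e := fun x => by
    rw [inner_smul_right, real_inner_comm, inner_gradient]
  have e2 : ∀ x, inner ℝ e (ψ x • gradient φ x) = fderiv ℝ φ x e * ψ x := fun x => by
    rw [inner_smul_right, real_inner_comm, inner_gradient, mul_comm]
  simp only [e1, e2]
  refine integral_mul_fderiv_eq_neg_fderiv_mul_of_integrable ?_ ?_ i3
    (fun x _ => hφ.contDiff.differentiable (by simp) x)
    (fun x _ => hψ.contDiff.differentiable (by simp) x)
  · simpa only [e2] using i2.const_inner (𝕜 := ℝ) e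
  · simpa only [e1] using i1.const_inner (𝕜 := ℝ) e

/-- The restriction to `Ω` of a test function, as an element of `H¹(Ω)`. -/
def ofTest (Ω : Set (EuclideanSpace ℝ (Fin N))) {φ : EuclideanSpace ℝ (Fin N) → ℝ}
    (hφ : IsTestFunction U φ) : H1 Ω :=
  ⟨WithLp.toLp 2 ((hφ.memLp (volume.restrict Ω)).toLp φ,
    (hφ.memLp_gradient (volume.restrict Ω)).toLp (gradient φ)), fun ψ hψ => by
    have h1 : ∫ x in Ω, (hφ.memLp (volume.restrict Ω)).toLp φ x • gradient ψ x
        = ∫ x in Ω, φ x • gradient ψ x := by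
      refine integral_congr_ae ?_
      filter_upwards [(hφ.memLp (volume.restrict Ω)).coeFn_toLp] with x hx
      rw [hx]
    have h2 : ∫ x in Ω, ψ x • (hφ.memLp_gradient (volume.restrict Ω)).toLp (gradient φ) x
        = ∫ x in Ω, ψ x • gradient φ x := by
      refine integral_congr_ae ?_
      filter_upwards [(hφ.memLp_gradient (volume.restrict Ω)).coeFn_toLp] with x hx
      rw [hx]
    exact h1.trans ((integral_smul_gradient_eq hφ hψ).trans (congrArg Neg.neg h2.symm))⟩

theorem toL2_ofTest {φ : EuclideanSpace ℝ (Fin N) → ℝ} (hφ : IsTestFunction U φ) :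
    toL2 (ofTest Ω hφ) = (hφ.memLp (volume.restrict Ω)).toLp φ := rfl

theorem grad_ofTest {φ : EuclideanSpace ℝ (Fin N) → ℝ} (hφ : IsTestFunction U φ) :
    grad (ofTest Ω hφ) = (hφ.memLp_gradient (volume.restrict Ω)).toLp (gradient φ) := rfl

theorem ofTest_mem {φ : EuclideanSpace ℝ (Fin N) → ℝ} (hφ : IsTestFunction U φ) :
    ofTest Ω hφ ∈ testSubmodule Ω U :=
  ⟨φ, hφ, (hφ.memLp (volume.restrict Ω)).coeFn_toLp⟩

theorem exists_eq_ofTest (hΩ : IsOpen Ω) {u : H1 Ω} (hu : u ∈ testSubmodule Ω U) :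
    ∃ (φ : EuclideanSpace ℝ (Fin N) → ℝ) (hφ : IsTestFunction U φ), u = ofTest Ω hφ := by
  obtain ⟨φ, hφ, h⟩ := hu
  refine ⟨φ, hφ, toL2_injective hΩ (Lp.ext (h.trans ?_))⟩
  exact (hφ.memLp (volume.restrict Ω)).coeFn_toLp.symm

theorem H1ZeroOn_mono {Γ Γ' : Set (EuclideanSpace ℝ (Fin N))} (h : Γ' ⊆ Γ) :
    H1ZeroOn Ω Γ ≤ H1ZeroOn Ω Γ' := by
  refine Submodule.topologicalClosure_mono ?_
  rintro u ⟨φ, hφ, hu⟩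
  exact ⟨φ, hφ.mono (compl_subset_compl.2 h), hu⟩

theorem H1Zero_le_H1ZeroOn (hΩ : IsOpen Ω) {Γ : Set (EuclideanSpace ℝ (Fin N))}
    (h : Γ ⊆ frontier Ω) : H1Zero Ω ≤ H1ZeroOn Ω Γ := by
  refine Submodule.topologicalClosure_mono ?_
  rintro u ⟨φ, hφ, hu⟩
  refine ⟨φ, hφ.mono fun x hx hxΓ => ?_, hu⟩
  exact (hΩ.inter_frontier_eq ▸ ⟨hx, h hxΓ⟩ : x ∈ (∅ : Set _))

end Sobolev

/-! ### From a form to its resolvent, abstractly -/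

section Forms

variable {X H G : Type*} [NormedAddCommGroup X] [InnerProductSpace ℝ X]
  [NormedAddCommGroup H] [InnerProductSpace ℝ H] [CompleteSpace H]
  [NormedAddCommGroup G] [InnerProductSpace ℝ G]

/-- The operator `T` on `W` with `⟪T u, v⟫_X = ⟪ι u, ι v⟫_H`. -/
def resolvent (ι : X →L[ℝ] H) (W : Submodule ℝ X) [CompleteSpace W] : W →L[ℝ] W :=
  (ContinuousLinearMap.adjoint (ι.comp W.subtypeL)).comp (ι.comp W.subtypeL)

variable {ι : X →L[ℝ] H} {γ : X →L[ℝ] G} {W : Submodule ℝ X} [CompleteSpace W]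

theorem inner_resolvent (u v : W) : inner ℝ (resolvent ι W u) v = inner ℝ (ι u) (ι v) := by
  rw [resolvent, ContinuousLinearMap.comp_apply, ContinuousLinearMap.adjoint_inner_left]
  rfl

theorem isSymmetric_resolvent : (resolvent ι W).IsSymmetric := fun u v => by
  change inner ℝ (resolvent ι W u) v = inner ℝ u (resolvent ι W v)
  rw [inner_resolvent, real_inner_comm, real_inner_comm (resolvent ι W v), inner_resolvent]

theorem isCompactOperator_resolvent (hc : IsCompactOperator (ι.comp W.subtypeL)) :
    IsCompactOperator (resolvent ι W) :=
  hc.clm_comp (ContinuousLinearMap.adjoint (ι.comp W.subtypeL))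

theorem inner_resolvent_pos (hι : Function.Injective ι) (u : W) (hu : u ≠ 0) :
    0 < inner ℝ (resolvent ι W u) u := by
  rw [inner_resolvent, real_inner_self_eq_norm_sq]
  have : ι (u : X) ≠ 0 := fun h => hu (Subtype.ext (hι (by simpa using h)))
  have := norm_pos_iff.2 this
  positivity

theorem norm_sq_of_inner (hX : ∀ u v : X, inner ℝ u v = inner ℝ (ι u) (ι v) + inner ℝ (γ u) (γ v))
    (u : X) : ‖u‖ ^ 2 = ‖ι u‖ ^ 2 + ‖γ u‖ ^ 2 := by
  simp only [← real_inner_self_eq_norm_sq, hX]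

theorem inner_resolvent_lt
    (hX : ∀ u v : X, inner ℝ u v = inner ℝ (ι u) (ι v) + inner ℝ (γ u) (γ v))
    (hP : ∀ u ∈ W, γ u = 0 → u = 0) (u : W) (hu : u ≠ 0) :
    inner ℝ (resolvent ι W u) u < ‖u‖ ^ 2 := by
  have hg : γ (u : X) ≠ 0 := fun h => hu (Subtype.ext (hP u u.2 h))
  have := norm_pos_iff.2 hg
  rw [inner_resolvent, real_inner_self_eq_norm_sq, Submodule.coe_norm, norm_sq_of_inner hX]
  have : 0 < ‖γ (u : X)‖ ^ 2 := by positivity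
  linarith

/-- Adding ⟪ι u, ι v⟫ to both sides turns the eigenvalue equation into ⟪u, v⟫ = (1 + μ)⟪T u, v⟫ on
W. -/
theorem forall_inner_eq_iff_resolvent_eq
    (hX : ∀ u v : X, inner ℝ u v = inner ℝ (ι u) (ι v) + inner ℝ (γ u) (γ v))
    (hι : Function.Injective ι) (μ : ℝ) (u : W) :
    (∀ v ∈ W, inner ℝ (γ u) (γ v) = μ * inner ℝ (ι u) (ι v)) ↔
      resolvent ι W u = (1 + μ)⁻¹ • u := by
  have key : (∀ v ∈ W, inner ℝ (γ u) (γ v) = μ * inner ℝ (ι u) (ι v)) ↔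
      u = (1 + μ) • resolvent ι W u := by
    constructor
    · intro h
      refine ext_inner_right ℝ fun v => ?_
      rw [real_inner_smul_left, inner_resolvent, Submodule.coe_inner, hX, h v v.2]
      ring
    · intro h v hv
      have h1 : inner ℝ u (⟨v, hv⟩ : W) = inner ℝ ((1 + μ) • resolvent ι W u) (⟨v, hv⟩ : W) := by
        rw [← h]
      rw [real_inner_smul_left, inner_resolvent, Submodule.coe_inner, hX] at h1
      linarith
  rw [key]
  -- For μ = −1 the inverse takes its default value 0, and by injectivity of T both sides still say
  -- u = 0.
  rcases eq_or_ne (1 + μ) 0 with h | h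
  · rw [h, zero_smul, inv_zero, zero_smul]
    constructor
    · rintro rfl
      exact map_zero _
    · intro h0
      by_contra hu
      have := inner_resolvent_pos hι u hu
      rw [h0, inner_zero_left] at this
      exact lt_irrefl _ this
  · rw [eq_inv_smul_iff₀ h, eq_comm]

theorem toENat_rank_eq_resolventMultiplicity
    (hX : ∀ u v : X, inner ℝ u v = inner ℝ (ι u) (ι v) + inner ℝ (γ u) (γ v))
    (hι : Function.Injective ι) (hc : IsCompactOperator (ι.comp W.subtypeL)) (μ : ℝ)
    (S : Submodule ℝ X) (hS : ∀ u, u ∈ S ↔ u ∈ W ∧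
      ∀ v ∈ W, inner ℝ (γ u) (γ v) = μ * inner ℝ (ι u) (ι v)) :
    Cardinal.toENat (Module.rank ℝ S) = resolventMultiplicity (resolvent ι W) μ := by
  have heq : S =
      (Module.End.eigenspace (resolvent ι W : Module.End ℝ W) (1 + μ)⁻¹).map W.subtype := by
    ext u
    constructor
    · intro hu
      have hu' := (hS u).1 hu
      exact ⟨⟨u, hu'.1⟩, Module.End.mem_eigenspace_iff.2
        ((forall_inner_eq_iff_resolvent_eq hX hι μ ⟨u, hu'.1⟩).1 hu'.2), rfl⟩
    · rintro ⟨v, hv, rfl⟩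
      exact (hS v).2 ⟨v.2, (forall_inner_eq_iff_resolvent_eq hX hι μ v).2
        (Module.End.mem_eigenspace_iff.1 hv)⟩
  have hfin : FiniteDimensional ℝ
      (Module.End.eigenspace (resolvent ι W : Module.End ℝ W) (1 + μ)⁻¹) := by
    rcases eq_or_ne (1 + μ)⁻¹ 0 with h | h
    · have : Module.End.eigenspace (resolvent ι W : Module.End ℝ W) (1 + μ)⁻¹ = ⊥ := by
        rw [h, Submodule.eq_bot_iff]
        intro u hu
        by_contra hu0
        have h1 := inner_resolvent_pos hι u hu0
        have h2 : resolvent ι W u = (0 : ℝ) • u := Module.End.mem_eigenspace_iff.1 hu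
        rw [h2, zero_smul, inner_zero_left] at h1
        exact lt_irrefl _ h1
      rw [this]
      infer_instance
    · exact ContinuousLinearMap.finite_dimensional_eigenspace (isCompactOperator_resolvent hc) _ h
  rw [heq, resolventMultiplicity,
    (Submodule.equivMapOfInjective W.subtype W.injective_subtype _).symm.rank_eq,
    ← Module.finrank_eq_rank, Cardinal.toENat_nat]

theorem exists_form_eigenvalue_seq
    (hX : ∀ u v : X, inner ℝ u v = inner ℝ (ι u) (ι v) + inner ℝ (γ u) (γ v))
    (hι : Function.Injective ι) (hc : IsCompactOperator (ι.comp W.subtypeL))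
    (hP : ∀ u ∈ W, γ u = 0 → u = 0) (hinf : ¬ FiniteDimensional ℝ W) (S : ℝ → Submodule ℝ X)
    (hS : ∀ μ u, u ∈ S μ ↔ u ∈ W ∧ ∀ v ∈ W, inner ℝ (γ u) (γ v) = μ * inner ℝ (ι u) (ι v)) :
    ∃ lam : ℕ → ℝ, (∀ i, 0 < lam i) ∧ Monotone lam ∧ Tendsto lam atTop atTop ∧
      ∀ μ, {i | lam i = μ}.encard = Cardinal.toENat (Module.rank ℝ (S μ)) := by
  obtain ⟨lam, h1, h2, h3, h4⟩ := exists_eigenvalue_seq (isCompactOperator_resolvent hc)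
    isSymmetric_resolvent (inner_resolvent_pos hι) (inner_resolvent_lt hX hP) hinf
  exact ⟨lam, h1, h2, h3, fun μ => by
    rw [h4, toENat_rank_eq_resolventMultiplicity hX hι hc μ (S μ) (hS μ)]⟩

/-- Substituting ‖u‖² = ‖ι u‖² + ‖γ u‖² and ⟪T u, u⟫ = ‖ι u‖² into min-max for T leaves the Rayleigh
quotient bound. -/
theorem form_eigenvalue_le_iff
    (hX : ∀ u v : X, inner ℝ u v = inner ℝ (ι u) (ι v) + inner ℝ (γ u) (γ v))
    (hι : Function.Injective ι) (hc : IsCompactOperator (ι.comp W.subtypeL))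
    (hP : ∀ u ∈ W, γ u = 0 → u = 0) (S : ℝ → Submodule ℝ X)
    (hS : ∀ μ u, u ∈ S μ ↔ u ∈ W ∧ ∀ v ∈ W, inner ℝ (γ u) (γ v) = μ * inner ℝ (ι u) (ι v))
    {lam : ℕ → ℝ} (hmono : Monotone lam) (htop : Tendsto lam atTop atTop)
    (hmul : ∀ μ, {i | lam i = μ}.encard = Cardinal.toENat (Module.rank ℝ (S μ)))
    (i : ℕ) {x : ℝ} (hx : 0 ≤ x) :
    lam i ≤ x ↔ ∃ F : Submodule ℝ X, F ≤ W ∧ i < Module.finrank ℝ F ∧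
      ∀ u ∈ F, ‖γ u‖ ^ 2 ≤ x * ‖ι u‖ ^ 2 := by
  rw [le_iff_exists_submodule (isCompactOperator_resolvent hc)
    isSymmetric_resolvent (inner_resolvent_pos hι) (inner_resolvent_lt hX hP) hmono htop
    (fun μ => by
      rw [hmul, toENat_rank_eq_resolventMultiplicity hX hι hc μ (S μ) (hS μ)]) i hx]
  have hiff : ∀ u : W, ‖u‖ ^ 2 ≤ (1 + x) * inner ℝ (resolvent ι W u) u ↔
      ‖γ (u : X)‖ ^ 2 ≤ x * ‖ι (u : X)‖ ^ 2 := fun u => by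
    rw [inner_resolvent, real_inner_self_eq_norm_sq, Submodule.coe_norm, norm_sq_of_inner hX]
    constructor <;> intro h <;> linarith
  constructor
  · rintro ⟨F, hF, hFu⟩
    refine ⟨F.map W.subtype, Submodule.map_subtype_le W F, ?_, ?_⟩
    · rwa [(Submodule.equivMapOfInjective W.subtype W.injective_subtype F).symm.finrank_eq]
    · rintro _ ⟨v, hv, rfl⟩
      exact (hiff v).1 (hFu v hv)
  · rintro ⟨F, hFW, hF, hFu⟩
    refine ⟨F.comap W.subtype, ?_, fun u hu => (hiff u).2 (hFu u hu)⟩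
    rwa [(Submodule.comapSubtypeEquivOfLe hFW).finrank_eq]

end Forms

/-! ### Min-max for closed subspaces of H¹(Ω) -/

section Eigenvalues

variable {N : ℕ} {Ω : Set (EuclideanSpace ℝ (Fin N))} {W : Submodule ℝ (H1 Ω)}

theorem exists_isEigenvalueSequence (hΩ : IsOpen Ω) (hW : IsClosed (W : Set (H1 Ω)))
    (hc : IsCompactOperator ((toL2L Ω).comp W.subtypeL))
    (hP : ∀ u ∈ W, grad u = 0 → u = 0) (hinf : ¬ FiniteDimensional ℝ W) :
    ∃ lam, IsEigenvalueSequence W lam := by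
  have : CompleteSpace W := hW.completeSpace_coe
  obtain ⟨lam, h1, h2, h3, h4⟩ := exists_form_eigenvalue_seq (ι := toL2L Ω) (γ := gradL Ω) (W := W)
    inner_H1 (toL2_injective hΩ) hc hP hinf (eigenspace W) (fun _ _ => Iff.rfl)
  exact ⟨lam, h1, h2, h3, h4⟩

theorem IsEigenvalueSequence.le_iff (hΩ : IsOpen Ω) (hW : IsClosed (W : Set (H1 Ω)))
    (hc : IsCompactOperator ((toL2L Ω).comp W.subtypeL))
    (hP : ∀ u ∈ W, grad u = 0 → u = 0) {lam : ℕ → ℝ} (hlam : IsEigenvalueSequence W lam)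
    (i : ℕ) {x : ℝ} (hx : 0 ≤ x) :
    lam i ≤ x ↔ ∃ F : Submodule ℝ (H1 Ω), F ≤ W ∧ i < Module.finrank ℝ F ∧
      ∀ u ∈ F, ‖grad u‖ ^ 2 ≤ x * ‖toL2 u‖ ^ 2 := by
  have : CompleteSpace W := hW.completeSpace_coe
  exact form_eigenvalue_le_iff (ι := toL2L Ω) (γ := gradL Ω) (W := W)
    inner_H1 (toL2_injective hΩ) hc hP (eigenspace W) (fun _ _ => Iff.rfl) hlam.monotone
    hlam.tendsto_atTop hlam.multiplicity i hx

end Eigenvalues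

/-! ### One-sided translation estimates -/

section Rays

variable {N : ℕ} {Ω Γ : Set (EuclideanSpace ℝ (Fin N))}

/-- A segment `[x, x + w]` starting in `Ω` meets the boundary of `Ω` only in `Γ`. -/
def RaysExitThrough (Ω Γ : Set (EuclideanSpace ℝ (Fin N))) (w : EuclideanSpace ℝ (Fin N)) : Prop :=
  ∀ x ∈ Ω, ∀ s ∈ Icc (0 : ℝ) 1, x + s • w ∈ frontier Ω → x + s • w ∈ Γ

theorem sq_lintegral_le {α : Type*} [MeasurableSpace α] (μ : Measure α) {f : α → ENNReal}
    (hf : AEMeasurable f μ) : (∫⁻ x, f x ∂μ) ^ 2 ≤ μ univ * ∫⁻ x, f x ^ 2 ∂μ := by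
  have h := ENNReal.lintegral_mul_le_Lp_mul_Lq μ Real.HolderConjugate.two_two
    (aemeasurable_const (b := (1 : ENNReal))) hf
  simp only [Pi.mul_apply, one_mul, ENNReal.one_rpow, lintegral_const] at h
  have h2 := pow_le_pow_left' h 2
  rw [mul_pow, ← ENNReal.rpow_natCast, ← ENNReal.rpow_natCast (_ ^ _),
    ← ENNReal.rpow_natCast (_ ^ _),
    ← ENNReal.rpow_mul, ← ENNReal.rpow_mul] at h2
  simpa using h2

/-- Extension by zero can fail to be differentiable only on the frontier, and there φ vanishes near
y by assumption. -/
theorem hasFDerivAt_indicator (hΩ : IsOpen Ω) {φ : EuclideanSpace ℝ (Fin N) → ℝ}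
    (hφ : Differentiable ℝ φ) {y : EuclideanSpace ℝ (Fin N)}
    (hy : y ∈ frontier Ω → y ∉ tsupport φ) :
    HasFDerivAt (Ω.indicator φ) (Ω.indicator (fderiv ℝ φ) y) y := by
  by_cases hyΩ : y ∈ Ω
  · rw [indicator_of_mem hyΩ]
    refine (hφ y).hasFDerivAt.congr_of_eventuallyEq ?_
    filter_upwards [hΩ.mem_nhds hyΩ] with z hz
    rw [indicator_of_mem hz]
  · rw [indicator_of_notMem hyΩ]
    have h0 : Ω.indicator φ =ᶠ[𝓝 y] fun _ => 0 := by
      by_cases hc : y ∈ closure Ω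
      · have hf : y ∈ frontier Ω := by
          rw [hΩ.frontier_eq]
          exact ⟨hc, hyΩ⟩
        filter_upwards [notMem_tsupport_iff_eventuallyEq.1 (hy hf)] with z hz
        by_cases hzΩ : z ∈ Ω
        · rw [indicator_of_mem hzΩ, hz]
          rfl
        · rw [indicator_of_notMem hzΩ]
      · filter_upwards [isClosed_closure.isOpen_compl.mem_nhds hc] with z hz
        rw [indicator_of_notMem fun h => hz (subset_closure h)]
    exact (hasFDerivAt_const (0 : ℝ) y).congr_of_eventuallyEq h0

/-- Wherever the segment meets the frontier it meets Γ, near which φ vanishes. The extension by zero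
is therefore differentiable along the whole segment, and the fundamental theorem of calculus with
Cauchy–Schwarz applies. -/
theorem enorm_sq_sub_le_lintegral_ray (hΩ : IsOpen Ω) {φ : EuclideanSpace ℝ (Fin N) → ℝ}
    (hφ : IsTestFunction Γᶜ φ) {w : EuclideanSpace ℝ (Fin N)} (hw : RaysExitThrough Ω Γ w)
    {x : EuclideanSpace ℝ (Fin N)} (hx : x ∈ Ω) :
    ‖Ω.indicator φ x - Ω.indicator φ (x + w)‖ₑ ^ 2 ≤
      ∫⁻ s in Ioc (0 : ℝ) 1, ‖w‖ₑ ^ 2 * ‖Ω.indicator (gradient φ) (x + s • w)‖ₑ ^ 2 := by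
  let f : ℝ → ℝ := fun s => Ω.indicator φ (x + s • w)
  let f' : ℝ → ℝ := fun s => Ω.indicator (fderiv ℝ φ) (x + s • w) w
  have hd : ∀ s ∈ uIcc (0 : ℝ) 1, HasDerivAt f (f' s) s := fun s hs => by
    rw [uIcc_of_le zero_le_one] at hs
    have h1 : HasDerivAt (fun s : ℝ => x + s • w) w s := by
      simpa using ((hasDerivAt_id s).smul_const w).const_add x
    exact (hasFDerivAt_indicator hΩ (hφ.contDiff.differentiable (by simp))
      fun hy hy' => hφ.tsupport_subset hy' (hw x hx s hs hy)).comp_hasDerivAt s h1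
  have hcont : Continuous (fderiv ℝ φ) := hφ.contDiff.continuous_fderiv (by simp)
  have hmeasg : Measurable (Ω.indicator (fderiv ℝ φ)) :=
    hcont.measurable.indicator hΩ.measurableSet
  have hmeas : Measurable f' := by
    have h1 : Measurable fun s : ℝ => Ω.indicator (fderiv ℝ φ) (x + s • w) :=
      hmeasg.comp (by fun_prop)
    exact (ContinuousLinearMap.apply ℝ ℝ w).continuous.measurable.comp h1
  have hnorm : ∀ s, ‖f' s‖ ≤ ‖w‖ * ‖Ω.indicator (gradient φ) (x + s • w)‖ := fun s => by
    have h1 := (Ω.indicator (fderiv ℝ φ) (x + s • w)).le_opNorm w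
    have h2 : ‖Ω.indicator (fderiv ℝ φ) (x + s • w)‖ = ‖Ω.indicator (gradient φ) (x + s • w)‖ := by
      rw [norm_indicator_eq_indicator_norm, norm_indicator_eq_indicator_norm]
      simp only [norm_gradient]
    rw [← h2, mul_comm]
    exact h1
  obtain ⟨C, hC⟩ := (hφ.hasCompactSupport.fderiv (𝕜 := ℝ)).exists_bound_of_continuous hcont
  have hint : IntervalIntegrable f' volume 0 1 := by
    rw [intervalIntegrable_iff]
    refine Measure.integrableOn_of_bounded (M := C * ‖w‖) (by simp) hmeas.aestronglyMeasurable
      (ae_of_all _ fun s => ?_)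
    refine (ContinuousLinearMap.le_opNorm _ _).trans ?_
    gcongr
    rw [norm_indicator_eq_indicator_norm]
    exact indicator_le' (fun y _ => hC y) (fun y _ => (norm_nonneg _).trans (hC y)) _
  have hftc := intervalIntegral.integral_eq_sub_of_hasDerivAt hd hint
  have hf0 : f 0 = Ω.indicator φ x := by simp [f]
  have hf1 : f 1 = Ω.indicator φ (x + w) := by simp [f]
  rw [intervalIntegral.integral_of_le zero_le_one, hf0, hf1] at hftc
  rw [← enorm_neg, neg_sub, ← hftc]
  calc ‖∫ s in Ioc (0 : ℝ) 1, f' s‖ₑ ^ 2 ≤ (∫⁻ s in Ioc (0 : ℝ) 1, ‖f' s‖ₑ) ^ 2 := by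
        gcongr
        exact enorm_integral_le_lintegral_enorm _
    _ ≤ (volume.restrict (Ioc (0 : ℝ) 1)) univ * ∫⁻ s in Ioc (0 : ℝ) 1, ‖f' s‖ₑ ^ 2 :=
        sq_lintegral_le _ hmeas.enorm.aemeasurable
    _ = ∫⁻ s in Ioc (0 : ℝ) 1, ‖f' s‖ₑ ^ 2 := by simp
    _ ≤ _ := by
        refine lintegral_mono fun s => ?_
        rw [← mul_pow]
        gcongr
        have := hnorm s
        rw [← ofReal_norm, ← ofReal_norm, ← ofReal_norm, ← ENNReal.ofReal_mul (norm_nonneg _)]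
        exact ENNReal.ofReal_le_ofReal this

theorem lintegral_sub_translate_le (hΩ : IsOpen Ω) {φ : EuclideanSpace ℝ (Fin N) → ℝ}
    (hφ : IsTestFunction Γᶜ φ) {w : EuclideanSpace ℝ (Fin N)} (hw : RaysExitThrough Ω Γ w) :
    ∫⁻ x in Ω, ‖Ω.indicator φ x - Ω.indicator φ (x + w)‖ₑ ^ 2 ≤
      ‖w‖ₑ ^ 2 * ∫⁻ x in Ω, ‖gradient φ x‖ₑ ^ 2 := by
  have hmeasg : Measurable (Ω.indicator (gradient φ)) :=
    hφ.continuous_gradient.measurable.indicator hΩ.measurableSet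
  calc _ ≤ ∫⁻ x in Ω, ∫⁻ s in Ioc (0 : ℝ) 1,
        ‖w‖ₑ ^ 2 * ‖Ω.indicator (gradient φ) (x + s • w)‖ₑ ^ 2 :=
        setLIntegral_mono' hΩ.measurableSet fun x hx => enorm_sq_sub_le_lintegral_ray hΩ hφ hw hx
    _ ≤ ∫⁻ x, ∫⁻ s in Ioc (0 : ℝ) 1,
        ‖w‖ₑ ^ 2 * ‖Ω.indicator (gradient φ) (x + s • w)‖ₑ ^ 2 := setLIntegral_le_lintegral _ _
    _ = ∫⁻ s in Ioc (0 : ℝ) 1, ∫⁻ x,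
        ‖w‖ₑ ^ 2 * ‖Ω.indicator (gradient φ) (x + s • w)‖ₑ ^ 2 := by
        refine lintegral_lintegral_swap (Measurable.aemeasurable ?_)
        have : Measurable fun p : EuclideanSpace ℝ (Fin N) × ℝ =>
            Ω.indicator (gradient φ) (p.1 + p.2 • w) := hmeasg.comp (by fun_prop)
        exact (this.enorm.pow_const 2).const_mul _
    _ = ∫⁻ s in Ioc (0 : ℝ) 1, ∫⁻ x, ‖w‖ₑ ^ 2 * ‖Ω.indicator (gradient φ) x‖ₑ ^ 2 := by
        refine lintegral_congr fun s => ?_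
        exact lintegral_add_right_eq_self
          (fun x => ‖w‖ₑ ^ 2 * ‖Ω.indicator (gradient φ) x‖ₑ ^ 2) (s • w)
    _ = ∫⁻ x, ‖w‖ₑ ^ 2 * ‖Ω.indicator (gradient φ) x‖ₑ ^ 2 := by simp
    _ = ‖w‖ₑ ^ 2 * ∫⁻ x, ‖Ω.indicator (gradient φ) x‖ₑ ^ 2 :=
        lintegral_const_mul _ (hmeasg.enorm.pow_const 2)
    _ = _ := by
        rw [← lintegral_indicator hΩ.measurableSet]
        congr 1
        refine lintegral_congr fun x => ?_
        by_cases hx : x ∈ Ω <;> simp [hx]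

/-- Telescoping along x, x + w, …, x + m w ends outside Ω, where the extension is zero; each of the
m increments obeys the translation estimate. -/
theorem lintegral_le_of_raysExitThrough (hΩ : IsOpen Ω) {w : EuclideanSpace ℝ (Fin N)}
    (hw : RaysExitThrough Ω Γ w) {m : ℕ} (hm : ∀ x ∈ Ω, x + m • w ∉ Ω)
    {φ : EuclideanSpace ℝ (Fin N) → ℝ} (hφ : IsTestFunction Γᶜ φ) :
    ∫⁻ x in Ω, ‖φ x‖ₑ ^ 2 ≤ (m : ENNReal) ^ 2 * (‖w‖ₑ ^ 2 * ∫⁻ x in Ω, ‖gradient φ x‖ₑ ^ 2) := by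
  let v : EuclideanSpace ℝ (Fin N) → ℝ := Ω.indicator φ
  -- The increment may be set to zero when x ∉ Ω, since v x = 0 there. This matters because the
  -- translation estimate only controls starting points in Ω.
  let d : EuclideanSpace ℝ (Fin N) → ENNReal := Ω.indicator fun x => ‖v x - v (x + w)‖ₑ
  have hv : Measurable v := hφ.contDiff.continuous.measurable.indicator hΩ.measurableSet
  have hdm : Measurable d :=
    ((hv.sub (hv.comp (measurable_add_const w))).enorm).indicator hΩ.measurableSet
  have h1 : ∀ x, ‖v x‖ₑ ≤ d x + ‖v (x + w)‖ₑ := fun x => by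
    by_cases hx : x ∈ Ω
    · simp only [d, indicator_of_mem hx]
      calc ‖v x‖ₑ = ‖(v x - v (x + w)) + v (x + w)‖ₑ := by rw [sub_add_cancel]
        _ ≤ _ := enorm_add_le _ _
    · simp [v, hx]
  have h2 : ∀ k : ℕ, ∀ x, ‖v x‖ₑ ≤ ∑ j ∈ Finset.range k, d (x + j • w) + ‖v (x + k • w)‖ₑ := by
    intro k
    induction k with
    | zero => intro x; simp
    | succ k ih =>
      intro x
      refine (ih x).trans ?_
      rw [Finset.sum_range_succ, add_assoc, succ_nsmul, ← add_assoc x]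
      gcongr
      exact h1 _
  have h3 : ∫⁻ x in Ω, ‖v x‖ₑ ^ 2 ≤ ∫⁻ x, (∑ j ∈ Finset.range m, d (x + j • w)) ^ 2 := by
    refine le_trans (setLIntegral_mono' hΩ.measurableSet fun x hx => ?_)
      (setLIntegral_le_lintegral Ω _)
    gcongr
    have := h2 m x
    rwa [show v (x + m • w) = 0 from indicator_of_notMem (hm x hx) _, enorm_zero, add_zero] at this
  have h4 : ∫⁻ x in Ω, ‖φ x‖ₑ ^ 2 = ∫⁻ x in Ω, ‖v x‖ₑ ^ 2 :=
    setLIntegral_congr_fun hΩ.measurableSet fun x hx => by simp only [v, indicator_of_mem hx]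
  have h5 : ∫⁻ x, d x ^ 2 ≤ ‖w‖ₑ ^ 2 * ∫⁻ x in Ω, ‖gradient φ x‖ₑ ^ 2 := by
    refine le_trans (le_of_eq ?_) (lintegral_sub_translate_le hΩ hφ hw)
    rw [← lintegral_indicator hΩ.measurableSet]
    refine lintegral_congr fun x => ?_
    by_cases hx : x ∈ Ω <;> simp [d, v, hx]
  rw [h4]
  refine h3.trans ?_
  have h6 : ∀ x, (∑ j ∈ Finset.range m, d (x + j • w)) ^ 2
      ≤ m * ∑ j ∈ Finset.range m, d (x + j • w) ^ 2 := fun x => by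
    have := ENNReal.rpow_sum_le_const_mul_sum_rpow (Finset.range m) (fun j => d (x + j • w))
      (p := 2) (by norm_num)
    norm_num at this
    simpa using this
  calc _ ≤ ∫⁻ x, m * ∑ j ∈ Finset.range m, d (x + j • w) ^ 2 := lintegral_mono h6
    _ = m * ∑ j ∈ Finset.range m, ∫⁻ x, d (x + j • w) ^ 2 := by
        rw [lintegral_const_mul, lintegral_finsetSum]
        · exact fun j _ => (hdm.comp (measurable_add_const _)).pow_const 2
        · exact Finset.measurable_sum _ fun j _ => (hdm.comp (measurable_add_const _)).pow_const 2
    _ = m * ∑ j ∈ Finset.range m, ∫⁻ x, d x ^ 2 := by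
        congr 1
        exact Finset.sum_congr rfl fun j _ =>
          lintegral_add_right_eq_self (fun x => d x ^ 2) (j • w)
    _ = (m : ENNReal) ^ 2 * ∫⁻ x, d x ^ 2 := by
        rw [Finset.sum_const, Finset.card_range, nsmul_eq_mul, sq, mul_assoc]
    _ ≤ _ := by gcongr

end Rays

/-! ### The cone of upward directions -/

section Epigraph

variable {n : ℕ}

theorem horizontal_add_smul (x w : EuclideanSpace ℝ (Fin (n + 1))) (s : ℝ) :
    horizontal (x + s • w) = horizontal x + s • horizontal w := by
  ext j
  simp [horizontal]

theorem norm_horizontal_le (x : EuclideanSpace ℝ (Fin (n + 1))) : ‖horizontal x‖ ≤ ‖x‖ := by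
  refine le_of_sq_le_sq ?_ (norm_nonneg _)
  rw [EuclideanSpace.norm_sq_eq, EuclideanSpace.norm_sq_eq, Fin.sum_univ_castSucc]
  simp only [horizontal]
  nlinarith [sq_nonneg ‖x (Fin.last n)‖]

theorem exists_lipschitz_on_ball {g : EuclideanSpace ℝ (Fin n) → ℝ} (hg : ContDiff ℝ 1 g) (r : ℝ) :
    ∃ L, 0 ≤ L ∧ ∀ x ∈ Metric.ball (0 : EuclideanSpace ℝ (Fin n)) r,
      ∀ y ∈ Metric.ball (0 : EuclideanSpace ℝ (Fin n)) r, |g y - g x| ≤ L * ‖y - x‖ := by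
  obtain ⟨C, hC⟩ :=
    (isCompact_closedBall (0 : EuclideanSpace ℝ (Fin n)) r).exists_bound_of_continuousOn
    (hg.continuous_fderiv (by simp)).continuousOn
  refine ⟨max C 0, le_max_right _ _, fun x hx y hy => ?_⟩
  exact (convex_ball (0 : EuclideanSpace ℝ (Fin n)) r).norm_image_sub_le_of_norm_fderiv_le
    (𝕜 := ℝ) (fun z _ => hg.differentiable (by simp) z)
    (fun z hz => (hC z (Metric.ball_subset_closedBall hz)).trans (le_max_left _ _)) hx hy

/-- If the segment reached a frontier point y in B_δ, its start would lie in B_r, strictly above the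
graph. Moving within the cone keeps a point strictly above an L-Lipschitz graph, so y would lie in
the open set Ω. -/
theorem raysExitThrough_of_cone {Ω : Set (EuclideanSpace ℝ (Fin (n + 1)))} (hΩ : IsOpen Ω)
    {r δ : ℝ} {g : EuclideanSpace ℝ (Fin n) → ℝ}
    (hΩg : IsEpigraphInBall Ω r g) (hδ : δ < r) {L : ℝ}
    (hL : ∀ x ∈ Metric.ball (0 : EuclideanSpace ℝ (Fin n)) r,
      ∀ y ∈ Metric.ball (0 : EuclideanSpace ℝ (Fin n)) r, |g y - g x| ≤ L * ‖y - x‖)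
    {w : EuclideanSpace ℝ (Fin (n + 1))} (hw : ‖w‖ ≤ r - δ)
    (hcone : L * ‖horizontal w‖ ≤ w (Fin.last n)) :
    RaysExitThrough Ω (frontier Ω \ Metric.ball 0 δ) w := by
  intro x hx s hs hy
  refine ⟨hy, fun hyδ => ?_⟩
  rw [mem_ball_zero_iff] at hyδ
  have hsw : ‖s • w‖ ≤ r - δ := by
    rw [norm_smul, Real.norm_of_nonneg hs.1]
    nlinarith [norm_nonneg w, hs.1, hs.2]
  have hxr : x ∈ Metric.ball (0 : EuclideanSpace ℝ (Fin (n + 1))) r := by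
    rw [mem_ball_zero_iff]
    calc ‖x‖ = ‖(x + s • w) - s • w‖ := by rw [add_sub_cancel_right]
      _ ≤ ‖x + s • w‖ + ‖s • w‖ := norm_sub_le _ _
      _ < r := by linarith
  have hyr : x + s • w ∈ Metric.ball (0 : EuclideanSpace ℝ (Fin (n + 1))) r := by
    rw [mem_ball_zero_iff]
    exact hyδ.trans hδ
  have hxg : g (horizontal x) < x (Fin.last n) := (hΩg.1.subset ⟨hxr, hx⟩).2
  have hmem : ∀ z ∈ Metric.ball (0 : EuclideanSpace ℝ (Fin (n + 1))) r,
      horizontal z ∈ Metric.ball (0 : EuclideanSpace ℝ (Fin n)) r := fun z hz => by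
    rw [mem_ball_zero_iff] at hz ⊢
    exact (norm_horizontal_le z).trans_lt hz
  have hLip := hL _ (hmem x hxr) _ (hmem _ hyr)
  have hdiff : horizontal (x + s • w) - horizontal x = s • horizontal w := by
    rw [horizontal_add_smul, add_sub_cancel_left]
  rw [hdiff, norm_smul, Real.norm_of_nonneg hs.1] at hLip
  have hyΩ : x + s • w ∈ Ω := by
    refine (hΩg.1.superset ⟨hyr, ?_⟩).2
    have h1 := le_of_abs_le hLip
    have h2 : (x + s • w) (Fin.last n) = x (Fin.last n) + s * w (Fin.last n) := by simp
    rw [h2]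
    nlinarith [mul_le_mul_of_nonneg_left hcone hs.1]
  exact (hΩ.inter_frontier_eq ▸ ⟨hyΩ, hy⟩ : x + s • w ∈ (∅ : Set _))

theorem exists_cone {Ω : Set (EuclideanSpace ℝ (Fin (n + 1)))} (hΩ : IsOpen Ω)
    {r δ : ℝ} {g : EuclideanSpace ℝ (Fin n) → ℝ} (hg : ContDiff ℝ 1 g)
    (hΩg : IsEpigraphInBall Ω r g) (hδ : δ < r) :
    ∃ v : EuclideanSpace ℝ (Fin (n + 1)), v ≠ 0 ∧ ∃ t₀ > 0, ∀ t ∈ Ioc (0 : ℝ) t₀,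
      ∀ w ∈ Metric.ball (t • v) (2 * t),
        RaysExitThrough Ω (frontier Ω \ Metric.ball 0 δ) w := by
  obtain ⟨L, hL0, hL⟩ := exists_lipschitz_on_ball hg r
  -- For w in B(t v, 2t) with v = K e_N, the horizontal part is at most 2t and w_N ≥ t(K − 2) = 2tL,
  -- which is the cone condition. Also ‖w‖ ≤ t(K + 2), hence the choice of t₀.
  let K : ℝ := 2 * L + 2
  let v : EuclideanSpace ℝ (Fin (n + 1)) := EuclideanSpace.single (Fin.last n) K
  have hv : ‖v‖ = K := by
    rw [EuclideanSpace.norm_single, Real.norm_of_nonneg (by positivity)]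
  have hvh : horizontal v = 0 := by
    ext j
    simp [horizontal, v]
  have hvl : v (Fin.last n) = K := by simp [v]
  refine ⟨v, ?_, (r - δ) / (K + 2), by have := sub_pos.2 hδ; positivity, fun t ht w hw => ?_⟩
  · rw [← norm_pos_iff, hv]
    positivity
  obtain ⟨ht0, ht1⟩ := ht
  rw [mem_ball_iff_norm] at hw
  set z := w - t • v with hz
  have hwz : w = z + t • v := by rw [hz, sub_add_cancel]
  refine raysExitThrough_of_cone hΩ hΩg hδ hL ?_ ?_
  · rw [le_div_iff₀ (by positivity)] at ht1
    calc ‖w‖ ≤ ‖z‖ + ‖t • v‖ := by rw [hwz]; exact norm_add_le _ _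
      _ ≤ 2 * t + t * K := by
          rw [norm_smul, hv, Real.norm_of_nonneg ht0.le]
          linarith
      _ ≤ r - δ := by linarith
  · have h1 : ‖horizontal w‖ ≤ 2 * t := by
      rw [hwz, horizontal_add_smul, hvh, smul_zero, add_zero]
      exact (norm_horizontal_le z).trans hw.le
    have h2 : |z (Fin.last n)| ≤ 2 * t := (PiLp.norm_apply_le z (Fin.last n)).trans hw.le
    have h3 : w (Fin.last n) = z (Fin.last n) + t * K := by
      rw [hwz]
      simp [hvl]
    rw [h3]
    have h4 := neg_le_of_abs_le h2
    calc L * ‖horizontal w‖ ≤ L * (2 * t) := by gcongr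
      _ ≤ _ := by simp only [K]; linarith

end Epigraph

/-! ### Poincaré inequality -/

section Poincare

variable {N : ℕ} {Ω Γ U : Set (EuclideanSpace ℝ (Fin N))}

theorem enorm_toLp_sq {α F : Type*} [MeasurableSpace α] {μ : Measure α} [NormedAddCommGroup F]
    {f : α → F} (hf : MemLp f 2 μ) : ‖hf.toLp f‖ₑ ^ 2 = ∫⁻ x, ‖f x‖ₑ ^ 2 ∂μ := by
  rw [Lp.enorm_toLp]
  have := eLpNorm_nnreal_pow_eq_lintegral (f := f) (μ := μ) (p := 2) two_ne_zero
  simpa using this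

theorem enorm_Lp_sq {α F : Type*} [MeasurableSpace α] {μ : Measure α} [NormedAddCommGroup F]
    (f : Lp F 2 μ) : ‖f‖ₑ ^ 2 = ∫⁻ x, ‖f x‖ₑ ^ 2 ∂μ := by
  conv_lhs => rw [← Lp.toLp_coeFn f (Lp.memLp f)]
  exact enorm_toLp_sq _

theorem norm_le_mul_norm_of_enorm_sq_le {E F : Type*} [SeminormedAddCommGroup E]
    [SeminormedAddCommGroup F] {x : E} {y : F} {c : ℝ} (hc : 0 ≤ c)
    (h : ‖x‖ₑ ^ 2 ≤ ENNReal.ofReal c ^ 2 * ‖y‖ₑ ^ 2) : ‖x‖ ≤ c * ‖y‖ := by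
  rw [← mul_pow, ← ofReal_norm, ← ofReal_norm, ← ENNReal.ofReal_mul hc,
    ← ENNReal.ofReal_pow (norm_nonneg _), ← ENNReal.ofReal_pow (by positivity),
    ENNReal.ofReal_le_ofReal_iff (by positivity)] at h
  exact le_of_sq_le_sq h (by positivity)

theorem exists_norm_toL2_le (hΩ : IsOpen Ω) (hΩb : Bornology.IsBounded Ω)
    {w : EuclideanSpace ℝ (Fin N)} (hw0 : w ≠ 0) (hw : RaysExitThrough Ω Γ w) :
    ∃ C, ∀ u ∈ H1ZeroOn Ω Γ, ‖toL2 u‖ ≤ C * ‖grad u‖ := by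
  obtain ⟨R, hR⟩ := hΩb.exists_norm_le
  have hwn : 0 < ‖w‖ := norm_pos_iff.2 hw0
  -- Two points of Ω are at distance at most 2R, so m steps of length ‖w‖ > 2R/m leave Ω.
  obtain ⟨m, hm⟩ := exists_nat_gt (2 * R / ‖w‖)
  rw [div_lt_iff₀ hwn] at hm
  have hexit : ∀ x ∈ Ω, x + m • w ∉ Ω := fun x hx hx' => by
    have h1 : ‖m • w‖ ≤ 2 * R := by
      calc ‖m • w‖ = ‖(x + m • w) - x‖ := by rw [add_sub_cancel_left]
        _ ≤ ‖x + m • w‖ + ‖x‖ := norm_sub_le _ _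
        _ ≤ 2 * R := by linarith [hR _ hx, hR _ hx']
    rw [← Nat.cast_smul_eq_nsmul ℝ, norm_smul, Real.norm_natCast] at h1
    linarith
  refine ⟨m * ‖w‖, fun u hu => ?_⟩
  have hcl : IsClosed {u : H1 Ω | ‖toL2 u‖ ≤ m * ‖w‖ * ‖grad u‖} :=
    isClosed_le (toL2L Ω).continuous.norm (continuous_const.mul (gradL Ω).continuous.norm)
  refine closure_minimal (fun u hu => ?_) hcl hu
  obtain ⟨φ, hφ, rfl⟩ := exists_eq_ofTest hΩ hu
  refine norm_le_mul_norm_of_enorm_sq_le (by positivity) ?_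
  rw [toL2_ofTest, grad_ofTest, enorm_toLp_sq, enorm_toLp_sq]
  refine (lintegral_le_of_raysExitThrough hΩ hw hexit hφ).trans (le_of_eq ?_)
  rw [ENNReal.ofReal_mul (Nat.cast_nonneg m), ENNReal.ofReal_natCast, ofReal_norm, mul_pow,
    mul_assoc]

end Poincare

/-! ### Compact embedding in L² by averaging -/

section Compactness

/-- The operators A ∘ ι are compact and converge to ι in norm. -/
theorem isCompactOperator_of_approx {Y H : Type*} [NormedAddCommGroup Y] [NormedSpace ℝ Y]
    [NormedAddCommGroup H] [NormedSpace ℝ H] [CompleteSpace H] (ι : Y →L[ℝ] H)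
    (h : ∀ ε > 0, ∃ A : H →L[ℝ] H, IsCompactOperator A ∧ ∀ u, ‖ι u - A (ι u)‖ ≤ ε * ‖u‖) :
    IsCompactOperator ι := by
  have hcl : IsClosed {f : Y →L[ℝ] H | IsCompactOperator f} := isClosed_setOfPred_isCompactOperator
  have : ι ∈ closure {f : Y →L[ℝ] H | IsCompactOperator f} := by
    rw [Metric.mem_closure_iff]
    intro ε hε
    obtain ⟨A, hA, hAu⟩ := h (ε / 2) (by positivity)
    refine ⟨A.comp ι, hA.comp_clm ι, ?_⟩
    rw [dist_eq_norm]
    exact lt_of_le_of_lt (ContinuousLinearMap.opNorm_le_bound _ (by positivity) hAu)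
      (half_lt_self hε)
  rw [hcl.closure_eq] at this
  exact this

theorem isCompactOperator_comp_subtypeL {X H : Type*} [NormedAddCommGroup X] [NormedSpace ℝ X]
    [NormedAddCommGroup H] [NormedSpace ℝ H] [CompleteSpace H] (ι : X →L[ℝ] H)
    (W : Submodule ℝ X)
    (h : ∀ ε > 0, ∃ A : H →L[ℝ] H, IsCompactOperator A ∧ ∀ u ∈ W, ‖ι u - A (ι u)‖ ≤ ε * ‖u‖) :
    IsCompactOperator (ι.comp W.subtypeL) :=
  isCompactOperator_of_approx (ι.comp W.subtypeL) fun ε hε =>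
    (h ε hε).imp fun _ hA => ⟨hA.1, fun u => hA.2 u u.2⟩

theorem isCompactOperator_finsetSum_smulRight {H β : Type*} [NormedAddCommGroup H]
    [NormedSpace ℝ H] (s : Finset β) (f : β → H →L[ℝ] ℝ) (e : β → H) :
    IsCompactOperator (∑ z ∈ s, (f z).smulRight (e z) : H →L[ℝ] H) := by
  classical
  induction s using Finset.induction_on with
  | empty => exact isCompactOperator_zero
  | insert a s ha ih =>
    rw [Finset.sum_insert ha]
    refine IsCompactOperator.add ?_ ih
    have h1 : IsCompactOperator (f a) :=
      isCompactOperator_of_locallyCompactSpace_dom (f a)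
    exact h1.clm_comp (ContinuousLinearMap.toSpanSingleton ℝ (e a))

/-- Jensen's inequality for the square, obtained from Cauchy–Schwarz on B. -/
theorem enorm_sub_average_sq_le {α : Type*} [MeasurableSpace α] {μ : Measure α} {B : Set α}
    (hB0 : μ B ≠ 0) (hBt : μ B ≠ ⊤) {f : α → ℝ} (hf : IntegrableOn f B μ) (a : ℝ) :
    ‖a - (μ.real B)⁻¹ * ∫ y in B, f y ∂μ‖ₑ ^ 2 ≤ (μ B)⁻¹ * ∫⁻ y in B, ‖a - f y‖ₑ ^ 2 ∂μ := by
  have hpos : 0 < μ.real B := ENNReal.toReal_pos hB0 hBt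
  have hc : IntegrableOn (fun _ => a) B μ := integrableOn_const hBt
  have h1 : a - (μ.real B)⁻¹ * ∫ y in B, f y ∂μ = (μ.real B)⁻¹ * ∫ y in B, (a - f y) ∂μ := by
    rw [integral_sub hc hf, setIntegral_const, smul_eq_mul, mul_sub, inv_mul_cancel_left₀ hpos.ne']
  have h2 : ‖(μ.real B)⁻¹‖ₑ = (μ B)⁻¹ := by
    rw [← ofReal_norm, Real.norm_of_nonneg (by positivity), ENNReal.ofReal_inv_of_pos hpos,
      Measure.real, ENNReal.ofReal_toReal hBt]
  rw [h1, enorm_mul, h2, mul_pow]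
  calc (μ B)⁻¹ ^ 2 * ‖∫ y in B, (a - f y) ∂μ‖ₑ ^ 2
      ≤ (μ B)⁻¹ ^ 2 * (∫⁻ y in B, ‖a - f y‖ₑ ∂μ) ^ 2 := by
        gcongr
        exact enorm_integral_le_lintegral_enorm _
    _ ≤ (μ B)⁻¹ ^ 2 * (μ.restrict B univ * ∫⁻ y in B, ‖a - f y‖ₑ ^ 2 ∂μ) := by
        gcongr
        exact sq_lintegral_le _ (hc.sub hf).aestronglyMeasurable.enorm
    _ = _ := by
        rw [Measure.restrict_apply_univ, sq, ← mul_assoc, mul_assoc (μ B)⁻¹,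
          ENNReal.inv_mul_cancel hB0 hBt, mul_one]

variable {N : ℕ} {Ω Γ : Set (EuclideanSpace ℝ (Fin N))}

/-- P sends a point of Ω to a nearest point of a finite t-net. Averaging around P x instead of x has
finite rank, because P takes finitely many values. -/
theorem exists_simpleFunc_dist_lt (hΩb : Bornology.IsBounded Ω) {t : ℝ} (ht : 0 < t) :
    ∃ P : SimpleFunc (EuclideanSpace ℝ (Fin N)) (EuclideanSpace ℝ (Fin N)),
      ∀ x ∈ Ω, dist (P x) x < t := by
  have htb : TotallyBounded Ω := (Bornology.IsBounded.isCompact_closure hΩb).totallyBounded.subset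
    subset_closure
  obtain ⟨s, hs, hΩs⟩ := Metric.totallyBounded_iff.1 htb t ht
  rcases s.eq_empty_or_nonempty with rfl | hne
  · refine ⟨SimpleFunc.const _ 0, fun x hx => ?_⟩
    simpa using hΩs hx
  obtain ⟨k, e, he⟩ : ∃ (k : ℕ) (e : ℕ → EuclideanSpace ℝ (Fin N)), ∀ z ∈ s, ∃ j ≤ k, e j = z := by
    have hc := hs.countable
    obtain ⟨e, he⟩ := hc.exists_eq_range hne
    choose! idx hidx using fun z (hz : z ∈ s) => (he ▸ hz : z ∈ range e)
    refine ⟨hs.toFinset.sup idx, e, fun z hz => ⟨idx z, ?_, hidx z hz⟩⟩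
    exact Finset.le_sup (f := idx) (hs.mem_toFinset.2 hz)
  refine ⟨SimpleFunc.nearestPt e k, fun x hx => ?_⟩
  obtain ⟨z, hz, hxz⟩ := mem_iUnion₂.1 (hΩs hx)
  obtain ⟨j, hj, rfl⟩ := he z hz
  have h1 := SimpleFunc.edist_nearestPt_le e x hj
  rw [edist_dist, edist_dist, ENNReal.ofReal_le_ofReal_iff dist_nonneg] at h1
  exact h1.trans_lt (by rw [dist_comm]; exact hxz)

/-- Jensen bounds the error by an average of squared translation differences with w in B(t v, 2t),
all of length at most t(‖v‖ + 2). The factor 2^N is the ratio of the volumes of the balls of radii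
2t and t. -/
theorem lintegral_sub_average_le (hΩ : IsOpen Ω) {v : EuclideanSpace ℝ (Fin N)} {t : ℝ}
    (ht : 0 < t) (hw : ∀ w ∈ Metric.ball (t • v) (2 * t), RaysExitThrough Ω Γ w)
    {P : EuclideanSpace ℝ (Fin N) → EuclideanSpace ℝ (Fin N)} (hP : ∀ x ∈ Ω, dist (P x) x < t)
    {φ : EuclideanSpace ℝ (Fin N) → ℝ} (hφ : IsTestFunction Γᶜ φ) :
    ∫⁻ x in Ω, ‖φ x - (volume.real (Metric.ball (0 : EuclideanSpace ℝ (Fin N)) t))⁻¹ *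
        ∫ y in Metric.ball (P x + t • v) t, Ω.indicator φ y‖ₑ ^ 2 ≤
      2 ^ N * (ENNReal.ofReal (t * (‖v‖ + 2)) ^ 2 * ∫⁻ x in Ω, ‖gradient φ x‖ₑ ^ 2) := by
  let u : EuclideanSpace ℝ (Fin N) → ℝ := Ω.indicator φ
  let β := volume (Metric.ball (0 : EuclideanSpace ℝ (Fin N)) t)
  have hβ : ∀ z : EuclideanSpace ℝ (Fin N), volume (Metric.ball z t) = β :=
    fun z => Measure.addHaar_ball_center volume z t
  have hβ0 : β ≠ 0 := (Metric.measure_ball_pos volume 0 ht).ne'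
  have hβt : β ≠ ⊤ := measure_ball_lt_top.ne
  have hum : Measurable u := hφ.contDiff.continuous.measurable.indicator hΩ.measurableSet
  have hint : Integrable u :=
    (hφ.contDiff.continuous.integrable_of_hasCompactSupport hφ.hasCompactSupport).indicator
      hΩ.measurableSet
  have hpt : ∀ x ∈ Ω, ‖φ x - (volume.real (Metric.ball (0 : EuclideanSpace ℝ (Fin N)) t))⁻¹ *
        ∫ y in Metric.ball (P x + t • v) t, u y‖ₑ ^ 2 ≤
      β⁻¹ * ∫⁻ w in Metric.ball (t • v) (2 * t), ‖u x - u (x + w)‖ₑ ^ 2 := fun x hx => by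
    have hr : volume.real (Metric.ball (0 : EuclideanSpace ℝ (Fin N)) t)
        = volume.real (Metric.ball (P x + t • v) t) := by
      rw [Measure.real, Measure.real, hβ (P x + t • v)]
    have hux : φ x = u x := (indicator_of_mem hx φ).symm
    rw [hr, hux]
    refine (enorm_sub_average_sq_le (by rw [hβ]; exact hβ0) (by rw [hβ]; exact hβt)
      hint.integrableOn (u x)).trans ?_
    rw [hβ]
    refine mul_le_mul' le_rfl ?_
    rw [← lintegral_indicator measurableSet_ball, ← lintegral_indicator measurableSet_ball,
      ← lintegral_add_left_eq_self _ x]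
    refine lintegral_mono fun w => ?_
    -- The averaging ball lies in x + B(t v, 2t), as P x is within t of x.
    by_cases hwB : x + w ∈ Metric.ball (P x + t • v) t
    · have hw' : w ∈ Metric.ball (t • v) (2 * t) := by
        rw [mem_ball_iff_norm] at hwB ⊢
        have h1 := hP x hx
        rw [dist_eq_norm] at h1
        calc ‖w - t • v‖ = ‖(x + w - (P x + t • v)) + (P x - x)‖ := by congr 1; abel
          _ ≤ _ := norm_add_le _ _
          _ < 2 * t := by linarith
      rw [indicator_of_mem hwB, indicator_of_mem hw']
    · rw [indicator_of_notMem hwB]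
      exact zero_le
  calc _ ≤ ∫⁻ x in Ω, β⁻¹ * ∫⁻ w in Metric.ball (t • v) (2 * t), ‖u x - u (x + w)‖ₑ ^ 2 :=
        setLIntegral_mono' hΩ.measurableSet hpt
    _ = β⁻¹ * ∫⁻ x in Ω, ∫⁻ w in Metric.ball (t • v) (2 * t), ‖u x - u (x + w)‖ₑ ^ 2 :=
        lintegral_const_mul' _ _ (ENNReal.inv_ne_top.2 hβ0)
    _ = β⁻¹ * ∫⁻ w in Metric.ball (t • v) (2 * t), ∫⁻ x in Ω, ‖u x - u (x + w)‖ₑ ^ 2 := by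
        congr 1
        refine lintegral_lintegral_swap (Measurable.aemeasurable ?_)
        exact ((hum.comp measurable_fst).sub
          (hum.comp (measurable_fst.add measurable_snd))).enorm.pow_const 2
    _ ≤ β⁻¹ * ∫⁻ w in Metric.ball (t • v) (2 * t),
          ENNReal.ofReal (t * (‖v‖ + 2)) ^ 2 * ∫⁻ x in Ω, ‖gradient φ x‖ₑ ^ 2 := by
        refine mul_le_mul' le_rfl ?_
        refine setLIntegral_mono' measurableSet_ball fun w hwB => ?_
        refine (lintegral_sub_translate_le hΩ hφ (hw w hwB)).trans ?_
        gcongr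
        rw [← ofReal_norm]
        refine ENNReal.ofReal_le_ofReal ?_
        rw [mem_ball_iff_norm] at hwB
        calc ‖w‖ = ‖(w - t • v) + t • v‖ := by rw [sub_add_cancel]
          _ ≤ ‖w - t • v‖ + ‖t • v‖ := norm_add_le _ _
          _ ≤ _ := by rw [norm_smul, Real.norm_of_nonneg ht.le]; linarith
    _ = β⁻¹ * (ENNReal.ofReal (t * (‖v‖ + 2)) ^ 2 * (∫⁻ x in Ω, ‖gradient φ x‖ₑ ^ 2)
          * (2 ^ N * β)) := by
        rw [setLIntegral_const, Measure.addHaar_ball_mul_of_pos volume _ zero_lt_two]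
        congr 3
        simp
    _ = _ := by
        rw [mul_comm (2 ^ N) β, ← mul_assoc _ β, mul_comm _ β, mul_assoc, ← mul_assoc β⁻¹,
          ENNReal.inv_mul_cancel hβ0 hβt, one_mul, mul_comm]

/-- The finite rank operator averaging over `ball (P x + t v) t` functions extended by `0`. -/
def averageOperator (Ω : Set (EuclideanSpace ℝ (Fin N))) (v : EuclideanSpace ℝ (Fin N)) (t : ℝ)
    (P : SimpleFunc (EuclideanSpace ℝ (Fin N)) (EuclideanSpace ℝ (Fin N)))
    [IsFiniteMeasure (volume.restrict Ω)] :
    Lp ℝ 2 (volume.restrict Ω) →L[ℝ] Lp ℝ 2 (volume.restrict Ω) :=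
  ∑ z ∈ P.range, ((volume.real (Metric.ball (0 : EuclideanSpace ℝ (Fin N)) t))⁻¹ •
    innerSL ℝ (indicatorConstLp 2 (μ := volume.restrict Ω) (s := Metric.ball (z + t • v) t)
      measurableSet_ball (measure_ne_top _ _) (1 : ℝ))).smulRight
    (indicatorConstLp 2 (μ := volume.restrict Ω) (P.measurableSet_fiber z)
      (measure_ne_top _ _) (1 : ℝ))

theorem coeFn_averageOperator (hΩ : IsOpen Ω) (v : EuclideanSpace ℝ (Fin N)) (t : ℝ)
    (P : SimpleFunc (EuclideanSpace ℝ (Fin N)) (EuclideanSpace ℝ (Fin N)))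
    [IsFiniteMeasure (volume.restrict Ω)] {φ : EuclideanSpace ℝ (Fin N) → ℝ}
    (hφ : MemLp φ 2 (volume.restrict Ω)) :
    averageOperator Ω v t P (hφ.toLp φ) =ᵐ[volume.restrict Ω]
      fun x => (volume.real (Metric.ball (0 : EuclideanSpace ℝ (Fin N)) t))⁻¹ *
        ∫ y in Metric.ball (P x + t • v) t, Ω.indicator φ y := by
  classical
  have hint : ∀ z : EuclideanSpace ℝ (Fin N),
      ∫ y in Metric.ball (z + t • v) t, hφ.toLp φ y ∂(volume.restrict Ω)
        = ∫ y in Metric.ball (z + t • v) t, Ω.indicator φ y := fun z => by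
    rw [setIntegral_congr_ae₀ (g := φ) measurableSet_ball.nullMeasurableSet
        (hφ.coeFn_toLp.mono fun x hx _ => hx),
      Measure.restrict_restrict measurableSet_ball, setIntegral_indicator hΩ.measurableSet]
  rw [averageOperator, sum_apply]
  refine (Lp.coeFn_finsetSum _ _).trans ?_
  have hall : ∀ᵐ x ∂(volume.restrict Ω), ∀ z ∈ P.range,
      (indicatorConstLp 2 (μ := volume.restrict Ω) (P.measurableSet_fiber z)
      (measure_ne_top _ _) (1 : ℝ)) x
        = (P ⁻¹' {z}).indicator (fun _ => (1 : ℝ)) x :=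
    (ae_ball_iff P.range.countable_toSet).2 fun z _ => indicatorConstLp_coeFn
  have hsm : ∀ᵐ x ∂(volume.restrict Ω), ∀ z ∈ P.range,
      (((volume.real (Metric.ball (0 : EuclideanSpace ℝ (Fin N)) t))⁻¹ *
        ∫ y in Metric.ball (z + t • v) t, Ω.indicator φ y) •
        indicatorConstLp 2 (μ := volume.restrict Ω) (P.measurableSet_fiber z)
          (measure_ne_top _ _) (1 : ℝ)) x
        = ((volume.real (Metric.ball (0 : EuclideanSpace ℝ (Fin N)) t))⁻¹ *
        ∫ y in Metric.ball (z + t • v) t, Ω.indicator φ y) *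
        (indicatorConstLp 2 (μ := volume.restrict Ω) (P.measurableSet_fiber z)
          (measure_ne_top _ _) (1 : ℝ)) x :=
    (ae_ball_iff P.range.countable_toSet).2 fun z _ => Lp.coeFn_smul _ _
  filter_upwards [hall, hsm] with x h1 h2
  rw [Finset.sum_apply, Finset.sum_eq_single_of_mem (P x) (P.mem_range_self x)]
  · rw [ContinuousLinearMap.smulRight_apply, smul_apply, innerSL_apply_apply,
      L2.inner_indicatorConstLp_one, hint, smul_eq_mul, h2 _ (P.mem_range_self x),
      h1 _ (P.mem_range_self x)]
    simp
  · intro z hz hne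
    rw [ContinuousLinearMap.smulRight_apply, smul_apply, innerSL_apply_apply,
      L2.inner_indicatorConstLp_one, hint, smul_eq_mul, h2 z hz, h1 z hz,
      indicator_of_notMem (s := P ⁻¹' {z}) (fun h => hne (Eq.symm h)), mul_zero]

/-- The averages at scale t approximate u in L² within t C ‖∇u‖, first for test functions and then
on their closure; C collects the square root of 2^N and ‖v‖ + 2. -/
theorem isCompactOperator_toL2L (hΩ : IsOpen Ω) (hΩb : Bornology.IsBounded Ω)
    {v : EuclideanSpace ℝ (Fin N)} {t₀ : ℝ} (ht₀ : 0 < t₀)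
    (hv : ∀ t ∈ Ioc (0 : ℝ) t₀, ∀ w ∈ Metric.ball (t • v) (2 * t), RaysExitThrough Ω Γ w)
    (W : Submodule ℝ (H1 Ω)) (hW : W ≤ H1ZeroOn Ω Γ) :
    IsCompactOperator ((toL2L Ω).comp W.subtypeL) := by
  have : IsFiniteMeasure (volume.restrict Ω) := ⟨by simpa using hΩb.measure_lt_top⟩
  refine isCompactOperator_comp_subtypeL _ _ fun ε hε => ?_
  let C : ℝ := Real.sqrt (2 ^ N) * (‖v‖ + 2)
  have hC : 0 < C := by positivity
  let t := min t₀ (ε / C)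
  have ht : 0 < t := lt_min ht₀ (by positivity)
  obtain ⟨P, hP⟩ := exists_simpleFunc_dist_lt hΩb ht
  refine ⟨averageOperator Ω v t P, isCompactOperator_finsetSum_smulRight _ _ _, fun u hu => ?_⟩
  have hcl : IsClosed {u : H1 Ω | ‖toL2L Ω u - averageOperator Ω v t P (toL2L Ω u)‖
      ≤ t * C * ‖gradL Ω u‖} := by
    refine isClosed_le ?_ ?_ <;> fun_prop
  have htC : t * C ≤ ε := by
    rw [← le_div_iff₀ hC]
    exact min_le_right _ _
  have key : ‖toL2L Ω u - averageOperator Ω v t P (toL2L Ω u)‖ ≤ t * C * ‖gradL Ω u‖ := by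
    refine closure_minimal (fun u hu => ?_) hcl (hW hu)
    obtain ⟨φ, hφ, rfl⟩ := exists_eq_ofTest hΩ hu
    refine norm_le_mul_norm_of_enorm_sq_le (by positivity) ?_
    rw [gradL_apply, grad_ofTest, toL2L_apply, toL2_ofTest, enorm_toLp_sq, enorm_Lp_sq]
    have h1 := lintegral_sub_average_le hΩ ht (hv t ⟨ht, min_le_left _ _⟩) hP hφ
    refine le_trans (le_of_eq (lintegral_congr_ae ?_)) (h1.trans (le_of_eq ?_))
    · filter_upwards [Lp.coeFn_sub ((hφ.memLp (volume.restrict Ω)).toLp φ)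
        (averageOperator Ω v t P ((hφ.memLp (volume.restrict Ω)).toLp φ)),
        (hφ.memLp (volume.restrict Ω)).coeFn_toLp,
        coeFn_averageOperator hΩ v t P (hφ.memLp (volume.restrict Ω))] with x h2 h3 h4
      rw [h2, Pi.sub_apply, h3, h4]
    · rw [← mul_assoc]
      congr 1
      have h2 : t * C = Real.sqrt (2 ^ N) * (t * (‖v‖ + 2)) := by simp only [C]; ring
      rw [h2, ENNReal.ofReal_mul (Real.sqrt_nonneg _), mul_pow,
        ← ENNReal.ofReal_pow (Real.sqrt_nonneg _), Real.sq_sqrt (by positivity),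
        ENNReal.ofReal_pow (by positivity)]
      simp
  refine key.trans ?_
  gcongr
  exact norm_grad_le u

end Compactness

/-! ### Weak limits in Hilbert space -/

section WeakLimits

variable {X H G : Type*} [NormedAddCommGroup X] [InnerProductSpace ℝ X] [CompleteSpace X]
  [NormedAddCommGroup H] [InnerProductSpace ℝ H] [CompleteSpace H]
  [NormedAddCommGroup G] [InnerProductSpace ℝ G] [CompleteSpace G]

/-- Banach–Alaoglu, with convergence along a nonprincipal ultrafilter in place of a subsequence. -/
theorem exists_weak_limit {x : ℕ → X} {R : ℝ} (hb : ∀ k, ‖x k‖ ≤ R) :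
    ∃ p : X, ∀ v, Tendsto (fun k => inner ℝ (x k) v) (hyperfilter ℕ) (𝓝 (inner ℝ p v)) := by
  let f : ℕ → WeakDual ℝ X := fun k => StrongDual.toWeakDual (InnerProductSpace.toDual ℝ X (x k))
  have hK := WeakDual.isCompact_closedBall (𝕜 := ℝ) (E := X) 0 R
  have hmem : ∀ k, f k ∈ WeakDual.toStrongDual ⁻¹' Metric.closedBall (0 : StrongDual ℝ X) R :=
    fun k => by
      simp only [mem_preimage, mem_closedBall_zero_iff]
      exact ((InnerProductSpace.toDual ℝ X).norm_map (x k)).trans_le (hb k)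
  obtain ⟨g, -, hg⟩ := hK.ultrafilter_le_nhds ((hyperfilter ℕ).map f)
    (by
      rw [le_principal_iff]
      exact Filter.mem_map.2 (Filter.univ_mem' hmem))
  refine ⟨(InnerProductSpace.toDual ℝ X).symm (WeakDual.toStrongDual g), fun v => ?_⟩
  rw [InnerProductSpace.toDual_symm_apply]
  have hg' : Tendsto f (hyperfilter ℕ) (𝓝 g) := hg
  exact ((WeakBilin.eval_continuous _ v).tendsto g).comp hg'

/-- The sequence is bounded in X. Its weak limit stays in W = Wᗮᗮ, is mapped by ι to the strong
limit u, and inherits the bound because the norm is weakly lower semicontinuous. -/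
theorem exists_mem_of_tendsto_of_bounded (ι : X →L[ℝ] H) (γ : X →L[ℝ] G)
    (hX : ∀ u : X, ‖u‖ ^ 2 = ‖ι u‖ ^ 2 + ‖γ u‖ ^ 2)
    (W : Submodule ℝ X) (hW : IsClosed (W : Set X)) {x : ℕ → X} (hx : ∀ k, x k ∈ W) {u : H}
    (hu : Tendsto (fun k => ι (x k)) atTop (𝓝 u)) {a : ℕ → ℝ} {A : ℝ}
    (ha : Tendsto a atTop (𝓝 A)) (hxa : ∀ k, ‖γ (x k)‖ ≤ a k) :
    ∃ w ∈ W, ι w = u ∧ ‖γ w‖ ≤ A := by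
  obtain ⟨R₁, hR₁⟩ := hu.norm.bddAbove_range
  obtain ⟨R₂, hR₂⟩ := ha.bddAbove_range
  have hb : ∀ k, ‖x k‖ ≤ |R₁| + |R₂| := fun k => by
    have h1 : ‖ι (x k)‖ ≤ |R₁| := (hR₁ ⟨k, rfl⟩).trans (le_abs_self _)
    have h2 : ‖γ (x k)‖ ≤ |R₂| := (hxa k).trans ((hR₂ ⟨k, rfl⟩).trans (le_abs_self _))
    refine le_of_sq_le_sq ?_ (by positivity)
    rw [hX]
    nlinarith [norm_nonneg (ι (x k)), norm_nonneg (γ (x k)), abs_nonneg R₁, abs_nonneg R₂]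
  obtain ⟨p, hp⟩ := exists_weak_limit hb
  have hle : (hyperfilter ℕ : Filter ℕ) ≤ atTop := Nat.hyperfilter_le_atTop
  have hcomp : CompleteSpace W := hW.completeSpace_coe
  refine ⟨p, ?_, ?_, ?_⟩
  · rw [← Submodule.orthogonal_orthogonal W, Submodule.mem_orthogonal']
    intro v hv
    refine tendsto_nhds_unique (hp v) ?_
    simp only [fun k => Submodule.inner_right_of_mem_orthogonal (hx k) hv]
    exact tendsto_const_nhds
  · refine ext_inner_right ℝ fun h => ?_
    rw [← ContinuousLinearMap.adjoint_inner_right]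
    refine tendsto_nhds_unique (hp _) ?_
    simp only [ContinuousLinearMap.adjoint_inner_right]
    exact (hu.mono_left hle).inner tendsto_const_nhds
  · have h1 : Tendsto (fun k => inner ℝ (γ (x k)) (γ p)) (hyperfilter ℕ)
        (𝓝 (inner ℝ (γ p) (γ p))) := by
      have := hp (ContinuousLinearMap.adjoint γ (γ p))
      simpa only [ContinuousLinearMap.adjoint_inner_right] using this
    have h2 : inner ℝ (γ p) (γ p) ≤ A * ‖γ p‖ := by
      refine le_of_tendsto_of_tendsto h1 ((ha.mono_left hle).mul_const _)
        (Eventually.of_forall fun k => ?_)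
      exact (real_inner_le_norm _ _).trans
        (mul_le_mul_of_nonneg_right (hxa k) (norm_nonneg _))
    rw [real_inner_self_eq_norm_sq] at h2
    rcases eq_or_lt_of_le (norm_nonneg (γ p)) with h | h
    · rw [← h]
      exact ge_of_tendsto' ha fun k => (norm_nonneg _).trans (hxa k)
    · refine le_of_mul_le_mul_right ?_ h
      linarith

end WeakLimits

/-! ### Smooth truncation -/

section Truncation

/-- A smooth bounded truncation of the identity. -/
def smoothTrunc (τ s : ℝ) : ℝ := τ⁻¹ * Real.arctan (τ * s)

theorem smoothTrunc_zero (τ : ℝ) : smoothTrunc τ 0 = 0 := by simp [smoothTrunc]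

theorem contDiff_smoothTrunc (τ : ℝ) : ContDiff ℝ ∞ (smoothTrunc τ) :=
  contDiff_const.mul (Real.contDiff_arctan.comp (contDiff_const.mul contDiff_id))

theorem hasDerivAt_smoothTrunc {τ : ℝ} (hτ : τ ≠ 0) (s : ℝ) :
    HasDerivAt (smoothTrunc τ) (1 / (1 + (τ * s) ^ 2)) s := by
  have h1 : HasDerivAt (fun s : ℝ => τ * s) τ s := by
    simpa using (hasDerivAt_id s).const_mul τ
  have h2 := ((Real.hasDerivAt_arctan (τ * s)).comp s h1).const_mul τ⁻¹
  refine h2.congr_deriv ?_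
  field_simp

theorem abs_deriv_smoothTrunc_le {τ : ℝ} (hτ : τ ≠ 0) (s : ℝ) : |deriv (smoothTrunc τ) s| ≤ 1 := by
  rw [(hasDerivAt_smoothTrunc hτ s).deriv, abs_of_nonneg (by positivity),
    div_le_one (by positivity)]
  nlinarith [sq_nonneg (τ * s)]

theorem abs_smoothTrunc_sub_le {τ : ℝ} (hτ : τ ≠ 0) (s r : ℝ) :
    |smoothTrunc τ s - smoothTrunc τ r| ≤ |s - r| := by
  have := (convex_univ (𝕜 := ℝ) (E := ℝ)).norm_image_sub_le_of_norm_deriv_le (f := smoothTrunc τ)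
    (C := 1) (fun x _ => (hasDerivAt_smoothTrunc hτ x).differentiableAt)
    (fun x _ => abs_deriv_smoothTrunc_le hτ x) (mem_univ r) (mem_univ s)
  simpa using this

theorem abs_smoothTrunc_le {τ : ℝ} (hτ : τ ≠ 0) (s : ℝ) : |smoothTrunc τ s| ≤ |s| := by
  simpa [smoothTrunc_zero] using abs_smoothTrunc_sub_le hτ s 0

theorem abs_smoothTrunc_le_const {τ : ℝ} (hτ : 0 < τ) (s : ℝ) : |smoothTrunc τ s| ≤ 2 * τ⁻¹ := by
  rw [smoothTrunc, abs_mul, abs_of_pos (inv_pos.2 hτ), mul_comm]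
  gcongr
  have h1 := Real.arctan_lt_pi_div_two (τ * s)
  have h2 := Real.neg_pi_div_two_lt_arctan (τ * s)
  have h3 := Real.pi_lt_four
  rw [abs_le]
  constructor <;> linarith

/-- `smoothTrunc τ s` is the difference quotient at 0 of τ ↦ arctan(τ s), whose derivative there is
s. -/
theorem tendsto_smoothTrunc (s : ℝ) :
    Tendsto (fun τ => smoothTrunc τ s) (𝓝[≠] 0) (𝓝 s) := by
  have h1 : HasDerivAt (fun τ : ℝ => Real.arctan (τ * s)) s 0 := by
    have h2 : HasDerivAt (fun τ : ℝ => τ * s) s 0 := by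
      simpa using (hasDerivAt_id (0 : ℝ)).mul_const s
    have h3 := (Real.hasDerivAt_arctan ((0 : ℝ) * s)).comp (0 : ℝ) h2
    exact h3.congr_deriv (by simp)
  have := h1.tendsto_slope_zero
  simpa [smoothTrunc] using this

end Truncation

/-! ### Zero capacity of a point -/

section Cutoff

variable {N : ℕ}

/-- Rescale one bump: η(x) = 1 − f(x/ρ). Its gradient is O(1/ρ) on a ball of volume O(ρ^N), so ‖∇η‖²
= O(ρ^{N−2}), which is O(ρ) for N ≥ 3 and ρ ≤ 1. -/
theorem exists_cutoff (hN : 3 ≤ N) : ∃ C : ℝ, 0 ≤ C ∧ ∀ ρ ∈ Ioc (0 : ℝ) 1,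
    ∃ η : EuclideanSpace ℝ (Fin N) → ℝ, ContDiff ℝ ∞ η ∧ (∀ x, 0 ≤ η x) ∧ (∀ x, η x ≤ 1) ∧
      (∀ x ∈ Metric.ball (0 : EuclideanSpace ℝ (Fin N)) ρ, η x = 0) ∧
      (∀ x, 2 * ρ ≤ ‖x‖ → η x = 1) ∧
      ∫⁻ x, ‖fderiv ℝ η x‖ₑ ^ 2 ≤ ENNReal.ofReal (C * √ρ) ^ 2 := by
  let f : ContDiffBump (0 : EuclideanSpace ℝ (Fin N)) := ⟨1, 2, one_pos, one_lt_two⟩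
  have hf : ContDiff ℝ ∞ f := f.contDiff
  obtain ⟨B, hB⟩ := (f.hasCompactSupport.fderiv (𝕜 := ℝ)).exists_bound_of_continuous
    (hf.continuous_fderiv (by simp))
  have hB0 : 0 ≤ B := (norm_nonneg _).trans (hB 0)
  let κ : ℝ := volume.real (Metric.ball (0 : EuclideanSpace ℝ (Fin N)) 1)
  refine ⟨√(B ^ 2 * 2 ^ N * κ), Real.sqrt_nonneg _, fun ρ hρ => ?_⟩
  obtain ⟨hρ0, hρ1⟩ := hρ
  let η : EuclideanSpace ℝ (Fin N) → ℝ := fun x => 1 - f (ρ⁻¹ • x)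
  have hnorm : ∀ x : EuclideanSpace ℝ (Fin N), ‖ρ⁻¹ • x‖ = ‖x‖ / ρ := fun x => by
    rw [norm_smul, norm_inv, Real.norm_of_nonneg hρ0.le, inv_mul_eq_div]
  have hη : ContDiff ℝ ∞ η := contDiff_const.sub (hf.comp (contDiff_const_smul _))
  have hder : ∀ x, fderiv ℝ η x = -(ρ⁻¹ • fderiv ℝ f (ρ⁻¹ • x)) := fun x => by
    simp only [η]
    rw [fderiv_const_sub, fderiv_comp_smul]
  refine ⟨η, hη, fun x => sub_nonneg.2 f.le_one, fun x => sub_le_self _ f.nonneg, fun x hx => ?_,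
    fun x hx => ?_, ?_⟩
  · have : f (ρ⁻¹ • x) = 1 := f.one_of_mem_closedBall (by
      rw [mem_closedBall_zero_iff, hnorm]
      exact (div_le_one hρ0).2 (mem_ball_zero_iff.1 hx).le)
    simp [η, this]
  · have : f (ρ⁻¹ • x) = 0 := f.zero_of_le_dist (by
      rw [dist_zero_right, hnorm]
      exact (le_div_iff₀ hρ0).2 hx)
    simp [η, this]
  · have hpt : ∀ x, ‖fderiv ℝ η x‖ₑ ^ 2 ≤
        (Metric.closedBall (0 : EuclideanSpace ℝ (Fin N)) (2 * ρ)).indicator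
          (fun _ => ENNReal.ofReal ((ρ⁻¹ * B) ^ 2)) x := fun x => by
      by_cases hx : x ∈ Metric.closedBall (0 : EuclideanSpace ℝ (Fin N)) (2 * ρ)
      · rw [indicator_of_mem hx, hder, enorm_neg, ← ofReal_norm, ← ENNReal.ofReal_pow (norm_nonneg _)]
        refine ENNReal.ofReal_le_ofReal ?_
        gcongr
        rw [norm_smul, norm_inv, Real.norm_of_nonneg hρ0.le]
        gcongr
        exact hB _
      · rw [indicator_of_notMem hx, hder]
        have h0 : fderiv ℝ f (ρ⁻¹ • x) = 0 := by
          refine image_eq_zero_of_notMem_tsupport fun h => hx ?_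
          have h' := tsupport_fderiv_subset ℝ h
          rw [f.tsupport_eq, mem_closedBall_zero_iff, hnorm, div_le_iff₀ hρ0] at h'
          exact mem_closedBall_zero_iff.2 h'
        rw [h0, smul_zero, neg_zero, ← ofReal_norm, norm_zero]
        simp
    calc _ ≤ ∫⁻ x, (Metric.closedBall (0 : EuclideanSpace ℝ (Fin N)) (2 * ρ)).indicator
          (fun _ => ENNReal.ofReal ((ρ⁻¹ * B) ^ 2)) x := lintegral_mono hpt
      _ = ENNReal.ofReal ((ρ⁻¹ * B) ^ 2) *
          volume (Metric.closedBall (0 : EuclideanSpace ℝ (Fin N)) (2 * ρ)) := by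
          rw [lintegral_indicator measurableSet_closedBall, setLIntegral_const]
      _ = ENNReal.ofReal ((ρ⁻¹ * B) ^ 2) * (ENNReal.ofReal ((2 * ρ) ^ N) * ENNReal.ofReal κ) := by
          rw [Measure.addHaar_closedBall volume _ (by positivity), finrank_euclideanSpace_fin]
          congr 2
          exact (ENNReal.ofReal_toReal measure_ball_lt_top.ne).symm
      _ = ENNReal.ofReal ((ρ⁻¹ * B) ^ 2 * ((2 * ρ) ^ N * κ)) := by
          rw [ENNReal.ofReal_mul (by positivity), ENNReal.ofReal_mul (by positivity)]
      _ ≤ ENNReal.ofReal ((√(B ^ 2 * 2 ^ N * κ) * √ρ) ^ 2) := by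
          refine ENNReal.ofReal_le_ofReal ?_
          have hκ : 0 ≤ κ := measureReal_nonneg
          rw [mul_pow (√_), Real.sq_sqrt (by positivity), Real.sq_sqrt hρ0.le]
          obtain ⟨m, rfl⟩ := Nat.exists_eq_add_of_le hN
          have h1 : ρ ^ m ≤ 1 := pow_le_one₀ hρ0.le hρ1
          calc _ = B ^ 2 * 2 ^ (3 + m) * κ * ρ * ρ ^ m := by
                field_simp
                ring
            _ ≤ B ^ 2 * 2 ^ (3 + m) * κ * ρ * 1 := by gcongr
            _ = _ := mul_one _
      _ = _ := by rw [ENNReal.ofReal_pow (by positivity)]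

end Cutoff

/-! ### Limits of functions vanishing off a shrinking ball -/

section ShrinkingRegion

variable {N : ℕ} {Ω : Set (EuclideanSpace ℝ (Fin N))}

theorem isTestFunction_indicator (hΩ : IsOpen Ω) {F : EuclideanSpace ℝ (Fin N) → ℝ}
    (hF : ContDiff ℝ ∞ F) (hFc : HasCompactSupport F) (hFΩ : ∀ x ∈ frontier Ω, x ∉ tsupport F) :
    IsTestFunction Ω (Ω.indicator F) := by
  have hsub : tsupport (Ω.indicator F) ⊆ closure Ω ∩ tsupport F := by
    refine subset_inter (closure_mono ?_) (closure_mono ?_) <;> rw [support_indicator]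
    · exact inter_subset_left
    · exact inter_subset_right
  have hsubΩ : tsupport (Ω.indicator F) ⊆ Ω := fun x hx => by
    by_contra hxΩ
    refine hFΩ x ?_ (hsub hx).2
    rw [hΩ.frontier_eq]
    exact ⟨(hsub hx).1, hxΩ⟩
  refine ⟨contDiff_iff_contDiffAt.2 fun x => ?_,
    hFc.of_isClosed_subset (isClosed_tsupport _) (hsub.trans inter_subset_right), hsubΩ⟩
  by_cases hx : x ∈ Ω
  · refine hF.contDiffAt.congr_of_eventuallyEq ?_
    filter_upwards [hΩ.mem_nhds hx] with y hy
    rw [indicator_of_mem hy]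
  · exact (contDiffAt_const (c := (0 : ℝ))).congr_of_eventuallyEq
      (notMem_tsupport_iff_eventuallyEq.1 fun h => hx (hsubΩ h))

/-- On the frontier, φ vanishes nearby outside B_ρ and η vanishes inside it, so the product can be
cut off at ∂Ω smoothly. -/
theorem isTestFunction_indicator_cutoff (hΩ : IsOpen Ω) {ρ : ℝ}
    {φ η : EuclideanSpace ℝ (Fin N) → ℝ} {θ : ℝ → ℝ}
    (hφ : IsTestFunction (frontier Ω \ Metric.ball 0 ρ)ᶜ φ) (hη : ContDiff ℝ ∞ η)
    (hη0 : ∀ x ∈ Metric.ball (0 : EuclideanSpace ℝ (Fin N)) ρ, η x = 0)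
    (hθ : ContDiff ℝ ∞ θ) (hθ0 : θ 0 = 0) :
    IsTestFunction Ω (Ω.indicator fun x => η x * θ (φ x)) := by
  refine isTestFunction_indicator hΩ (hη.mul (hθ.comp hφ.contDiff))
    ((hφ.hasCompactSupport.comp_left hθ0).mul_left) fun x hx hxF => ?_
  have hxφ : x ∈ tsupport φ :=
    closure_mono (Function.support_comp_subset hθ0 φ) (tsupport_mul_subset_right hxF)
  have hxb : x ∈ Metric.ball (0 : EuclideanSpace ℝ (Fin N)) ρ := by
    by_contra h
    exact hφ.tsupport_subset hxφ ⟨hx, h⟩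
  refine notMem_tsupport_iff_eventuallyEq.2 ?_ hxF
  filter_upwards [Metric.isOpen_ball.mem_nhds hxb] with y hy
  rw [hη0 y hy, zero_mul]
  rfl

theorem eLpNorm_two_le_of_lintegral_le {α F : Type*} [MeasurableSpace α] {μ : Measure α}
    [NormedAddCommGroup F] {f : α → F} {c : ENNReal} (h : ∫⁻ x, ‖f x‖ₑ ^ 2 ∂μ ≤ c ^ 2) :
    eLpNorm f 2 μ ≤ c := by
  have h1 := eLpNorm_nnreal_pow_eq_lintegral (f := f) (μ := μ) (p := 2) two_ne_zero
  have h2 : eLpNorm f 2 μ ^ 2 = ∫⁻ x, ‖f x‖ₑ ^ 2 ∂μ := by simpa using h1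
  rw [← h2] at h
  exact (ENNReal.pow_le_pow_left_iff two_ne_zero).1 h

/-- In ∇(η θ(φ)) = η θ'(φ) ∇φ + θ(φ) ∇η the first term is at most |∇φ|, as 0 ≤ η ≤ 1 and |θ'| ≤ 1;
in the second, |θ| ≤ 2/τ. -/
theorem norm_grad_cutoff_le (hΩ : IsOpen Ω) {U : Set (EuclideanSpace ℝ (Fin N))} {τ c : ℝ}
    (hτ : 0 < τ) (hc : 0 ≤ c)
    {φ η : EuclideanSpace ℝ (Fin N) → ℝ} (hφ : IsTestFunction U φ) (hη : ContDiff ℝ ∞ η)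
    (hη0 : ∀ x, 0 ≤ η x) (hη1 : ∀ x, η x ≤ 1)
    (hηc : ∫⁻ x, ‖fderiv ℝ η x‖ₑ ^ 2 ≤ ENNReal.ofReal c ^ 2)
    (hψ : IsTestFunction Ω (Ω.indicator fun x => η x * smoothTrunc τ (φ x))) :
    ‖grad (ofTest Ω hψ)‖ ≤ ‖grad (ofTest Ω hφ)‖ + 2 * τ⁻¹ * c := by
  let F : EuclideanSpace ℝ (Fin N) → ℝ := fun x => η x * smoothTrunc τ (φ x)
  have hpt : ∀ x ∈ Ω, ‖gradient (Ω.indicator F) x‖ ≤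
      ‖gradient φ x‖ + 2 * τ⁻¹ * ‖fderiv ℝ η x‖ := fun x hx => by
    have he : Ω.indicator F =ᶠ[𝓝 x] F := by
      filter_upwards [hΩ.mem_nhds hx] with y hy
      rw [indicator_of_mem hy]
    have h1 : HasFDerivAt (fun y => smoothTrunc τ (φ y))
        (deriv (smoothTrunc τ) (φ x) • fderiv ℝ φ x) x :=
      ((hasDerivAt_smoothTrunc hτ.ne' (φ x)).differentiableAt.hasDerivAt).comp_hasFDerivAt x
        (hφ.contDiff.differentiable (by simp) x).hasFDerivAt
    have h2 : HasFDerivAt η (fderiv ℝ η x) x := (hη.differentiable (by simp) x).hasFDerivAt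
    have h3 := (h2.mul h1).fderiv
    have h4 : fderiv ℝ F x = η x • deriv (smoothTrunc τ) (φ x) • fderiv ℝ φ x +
      smoothTrunc τ (φ x) • fderiv ℝ η x := h3
    rw [norm_gradient, norm_gradient, he.fderiv_eq, h4]
    refine (norm_add_le _ _).trans (add_le_add ?_ ?_)
    · rw [norm_smul, norm_smul, ← mul_assoc]
      refine mul_le_of_le_one_left (norm_nonneg _) (mul_le_one₀ ?_ (norm_nonneg _)
        (abs_deriv_smoothTrunc_le hτ.ne' _))
      rw [Real.norm_of_nonneg (hη0 x)]
      exact hη1 x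
    · rw [norm_smul]
      gcongr
      exact abs_smoothTrunc_le_const hτ _
  have hcD : Continuous (fderiv ℝ η) := hη.continuous_fderiv (by simp)
  have hD : eLpNorm (fderiv ℝ η) 2 (volume.restrict Ω) ≤ ENNReal.ofReal c :=
    eLpNorm_two_le_of_lintegral_le ((setLIntegral_le_lintegral _ _).trans hηc)
  have hmain : eLpNorm (gradient (Ω.indicator F)) 2 (volume.restrict Ω) ≤
      eLpNorm (gradient φ) 2 (volume.restrict Ω) + ENNReal.ofReal (2 * τ⁻¹ * c) := by
    calc _ ≤ eLpNorm (fun x => ‖gradient φ x‖ + 2 * τ⁻¹ * ‖fderiv ℝ η x‖) 2 (volume.restrict Ω) :=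
          eLpNorm_mono_ae_real ((ae_restrict_iff' hΩ.measurableSet).2 (ae_of_all _ hpt))
      _ ≤ eLpNorm (fun x => ‖gradient φ x‖) 2 (volume.restrict Ω) +
          eLpNorm (fun x => 2 * τ⁻¹ * ‖fderiv ℝ η x‖) 2 (volume.restrict Ω) :=
          eLpNorm_add_le hφ.continuous_gradient.norm.aestronglyMeasurable
            (continuous_const.mul hcD.norm).aestronglyMeasurable one_le_two
      _ ≤ _ := by
          rw [eLpNorm_norm]
          gcongr
          have h1 := eLpNorm_const_smul (2 * τ⁻¹) (fun x => ‖fderiv ℝ η x‖) 2 (volume.restrict Ω)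
          rw [eLpNorm_norm] at h1
          refine (le_of_eq h1).trans ?_
          rw [ENNReal.ofReal_mul (by positivity), ← ofReal_norm,
            Real.norm_of_nonneg (by positivity)]
          gcongr
  rw [grad_ofTest, grad_ofTest, Lp.norm_toLp, Lp.norm_toLp]
  have hfin := (hφ.memLp_gradient (volume.restrict Ω)).eLpNorm_ne_top
  refine (ENNReal.toReal_mono (ENNReal.add_ne_top.2 ⟨hfin, ENNReal.ofReal_ne_top⟩) hmain).trans ?_
  rw [ENNReal.toReal_add hfin ENNReal.ofReal_ne_top, ENNReal.toReal_ofReal (by positivity)]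

/-- Dominated convergence: |η θ(f)| ≤ |f|, so the squared difference is at most 4|f|². -/
theorem tendsto_eLpNorm_truncation {α : Type*} [MeasurableSpace α] {μ : Measure α} {f : α → ℝ}
    (hf : MemLp f 2 μ) {η : ℕ → α → ℝ} (hηm : ∀ k, Measurable (η k)) (hη0 : ∀ k x, 0 ≤ η k x)
    (hη1 : ∀ k x, η k x ≤ 1) (hη : ∀ᵐ x ∂μ, ∀ᶠ k in atTop, η k x = 1) {τ : ℕ → ℝ}
    (hτ : ∀ k, 0 < τ k) (hτ0 : Tendsto τ atTop (𝓝 0)) :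
    Tendsto (fun k => eLpNorm (fun x => η k x * smoothTrunc (τ k) (f x) - f x) 2 μ) atTop
      (𝓝 0) := by
  have hlim : Tendsto (fun k => ∫⁻ x, ‖η k x * smoothTrunc (τ k) (f x) - f x‖ₑ ^ 2 ∂μ) atTop
      (𝓝 (∫⁻ _, 0 ∂μ)) := by
    refine tendsto_lintegral_of_dominated_convergence' (fun x => 4 * ‖f x‖ₑ ^ 2) (fun k => ?_)
      (fun k => ?_) ?_ ?_
    · have h1 : AEMeasurable (fun x => smoothTrunc (τ k) (f x)) μ :=
        (contDiff_smoothTrunc (τ k)).continuous.measurable.comp_aemeasurable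
          hf.aestronglyMeasurable.aemeasurable
      exact (((hηm k).aemeasurable.mul h1).sub hf.aestronglyMeasurable.aemeasurable).enorm.pow_const 2
    · refine ae_of_all _ fun x => ?_
      have h1 : ‖η k x * smoothTrunc (τ k) (f x) - f x‖ ≤ 2 * ‖f x‖ := by
        refine (norm_sub_le _ _).trans ?_
        rw [norm_mul, Real.norm_of_nonneg (hη0 k x)]
        have h2 : ‖smoothTrunc (τ k) (f x)‖ ≤ ‖f x‖ := abs_smoothTrunc_le (hτ k).ne' _
        nlinarith [hη0 k x, hη1 k x, norm_nonneg (f x), norm_nonneg (smoothTrunc (τ k) (f x))]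
      beta_reduce
      rw [← ofReal_norm, ← ofReal_norm, ← ENNReal.ofReal_pow (norm_nonneg _),
        ← ENNReal.ofReal_pow (norm_nonneg _),
        show (4 : ENNReal) = ENNReal.ofReal 4 by norm_num, ← ENNReal.ofReal_mul (by norm_num)]
      refine ENNReal.ofReal_le_ofReal ?_
      calc _ ≤ (2 * ‖f x‖) ^ 2 := by gcongr
        _ = _ := by ring
    · rw [lintegral_const_mul' _ _ (by norm_num), ← enorm_toLp_sq hf]
      exact ENNReal.mul_ne_top (by norm_num) (ENNReal.pow_ne_top enorm_ne_top)
    · filter_upwards [hη] with x hx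
      have h1 : Tendsto τ atTop (𝓝[≠] 0) :=
        tendsto_nhdsWithin_iff.2 ⟨hτ0, Eventually.of_forall fun k => (hτ k).ne'⟩
      have h2 : Tendsto (fun k => η k x * smoothTrunc (τ k) (f x) - f x) atTop (𝓝 0) := by
        have h3 := ((tendsto_smoothTrunc (f x)).comp h1).sub_const (f x)
        rw [sub_self] at h3
        refine h3.congr' ?_
        filter_upwards [hx] with k hk
        rw [hk, one_mul]
        rfl
      have h4 := (ENNReal.continuous_pow 2).tendsto _ |>.comp (continuous_enorm.tendsto _ |>.comp h2)
      simpa [Function.comp_def] using h4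
  rw [lintegral_zero] at hlim
  have h5 : ∀ k, eLpNorm (fun x => η k x * smoothTrunc (τ k) (f x) - f x) 2 μ =
      (∫⁻ x, ‖η k x * smoothTrunc (τ k) (f x) - f x‖ₑ ^ 2 ∂μ) ^ (1 / 2 : ℝ) := fun k => by
    rw [eLpNorm_eq_lintegral_rpow_enorm_toReal two_ne_zero ENNReal.ofNat_ne_top]
    simp
  simp only [h5]
  have h6 := (ENNReal.continuous_rpow_const (y := (1 / 2 : ℝ))).tendsto 0 |>.comp hlim
  rwa [ENNReal.zero_rpow_of_pos (by norm_num)] at h6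

/-- Cutting off and truncating is 1-Lipschitz, so the error splits into the distance from φ to u and
the effect of the same operation on the fixed function u. -/
theorem norm_toL2_cutoff_sub_le (hΩ : IsOpen Ω) {U : Set (EuclideanSpace ℝ (Fin N))} {τ : ℝ}
    (hτ : 0 < τ) {φ η : EuclideanSpace ℝ (Fin N) → ℝ} (hφ : IsTestFunction U φ)
    (hη0 : ∀ x, 0 ≤ η x) (hη1 : ∀ x, η x ≤ 1)
    (hψ : IsTestFunction Ω (Ω.indicator fun x => η x * smoothTrunc τ (φ x)))
    (u : Lp ℝ 2 (volume.restrict Ω))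
    (hR : MemLp (fun x => η x * smoothTrunc τ (u x) - u x) 2 (volume.restrict Ω)) :
    ‖toL2 (ofTest Ω hψ) - u‖ ≤ ‖toL2 (ofTest Ω hφ) - u‖ + ‖hR.toLp _‖ := by
  have hle : ∀ᵐ x ∂(volume.restrict Ω), ‖(toL2 (ofTest Ω hψ) - u) x‖ ≤
      ‖(toL2 (ofTest Ω hφ) - u) x‖ + ‖hR.toLp _ x‖ := by
    filter_upwards [Lp.coeFn_sub (toL2 (ofTest Ω hψ)) u,
      Lp.coeFn_sub (toL2 (ofTest Ω hφ)) u, hR.coeFn_toLp,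
      (hψ.memLp (volume.restrict Ω)).coeFn_toLp,
      (hφ.memLp (volume.restrict Ω)).coeFn_toLp, ae_restrict_mem hΩ.measurableSet]
      with x h1 h2 h3 h4 h5 hx
    rw [h1, h2, h3, Pi.sub_apply, Pi.sub_apply, toL2_ofTest, toL2_ofTest, h4, h5,
      indicator_of_mem hx]
    have h6 : η x * smoothTrunc τ (φ x) - u x =
        η x * (smoothTrunc τ (φ x) - smoothTrunc τ (u x)) +
          (η x * smoothTrunc τ (u x) - u x) := by ring
    rw [h6]
    refine (norm_add_le _ _).trans (add_le_add ?_ le_rfl)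
    rw [norm_mul, Real.norm_of_nonneg (hη0 x)]
    exact (mul_le_of_le_one_left (norm_nonneg _) (hη1 x)).trans
      (abs_smoothTrunc_sub_le hτ.ne' _ _)
  have hnn : ‖toL2 (ofTest Ω hψ) - u‖ₑ ≤ ‖toL2 (ofTest Ω hφ) - u‖ₑ + ‖hR.toLp _‖ₑ := by
    rw [Lp.enorm_def, Lp.enorm_def, Lp.enorm_def]
    refine (eLpNorm_mono_ae_real hle).trans ?_
    refine (eLpNorm_add_le (Lp.aestronglyMeasurable _).norm (Lp.aestronglyMeasurable _).norm
      one_le_two).trans ?_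
    rw [eLpNorm_norm, eLpNorm_norm]
  rw [← ofReal_norm, ← ofReal_norm, ← ofReal_norm, ← ENNReal.ofReal_add (norm_nonneg _)
    (norm_nonneg _), ENNReal.ofReal_le_ofReal_iff (by positivity)] at hnn
  exact hnn

theorem tendsto_toL2_cutoff (hΩ : IsOpen Ω) {U : ℕ → Set (EuclideanSpace ℝ (Fin N))}
    {τ : ℕ → ℝ} (hτ : ∀ k, 0 < τ k) (hτ0 : Tendsto τ atTop (𝓝 0))
    {φ η : ℕ → EuclideanSpace ℝ (Fin N) → ℝ} (hφ : ∀ k, IsTestFunction (U k) (φ k))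
    (hηs : ∀ k, Continuous (η k)) (hη0 : ∀ k x, 0 ≤ η k x) (hη1 : ∀ k x, η k x ≤ 1)
    (hη : ∀ x ∈ Ω, ∀ᶠ k in atTop, η k x = 1)
    (hψ : ∀ k, IsTestFunction Ω (Ω.indicator fun x => η k x * smoothTrunc (τ k) (φ k x)))
    {u : Lp ℝ 2 (volume.restrict Ω)}
    (hu : Tendsto (fun k => toL2 (ofTest Ω (hφ k))) atTop (𝓝 u)) :
    Tendsto (fun k => toL2 (ofTest Ω (hψ k))) atTop (𝓝 u) := by
  rw [tendsto_iff_norm_sub_tendsto_zero] at hu ⊢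
  let R : ℕ → EuclideanSpace ℝ (Fin N) → ℝ :=
    fun k x => η k x * smoothTrunc (τ k) (u x) - u x
  have hR : Tendsto (fun k => eLpNorm (R k) 2 (volume.restrict Ω)) atTop (𝓝 0) := by
    refine tendsto_eLpNorm_truncation (Lp.memLp u) (fun k => (hηs k).measurable)
      hη0 hη1 ?_ hτ hτ0
    filter_upwards [ae_restrict_mem hΩ.measurableSet] with x hx
    exact hη x hx
  have hRm : ∀ k, AEStronglyMeasurable (R k) (volume.restrict Ω) := fun k =>
    ((hηs k).aestronglyMeasurable.mul
      ((contDiff_smoothTrunc (τ k)).continuous.comp_aestronglyMeasurable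
        (Lp.aestronglyMeasurable u))).sub (Lp.aestronglyMeasurable u)
  have hfin : ∀ᶠ k in atTop, eLpNorm (R k) 2 (volume.restrict Ω) < ⊤ :=
    hR.eventually_lt_const ENNReal.zero_lt_top
  have hRr : Tendsto (fun k => (eLpNorm (R k) 2 (volume.restrict Ω)).toReal) atTop (𝓝 0) :=
    (ENNReal.tendsto_toReal ENNReal.zero_ne_top).comp hR
  have hsum := hu.add hRr
  rw [add_zero] at hsum
  refine squeeze_zero' (Eventually.of_forall fun _ => norm_nonneg _) ?_ hsum
  filter_upwards [hfin] with k hk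
  have hRmem : MemLp (R k) 2 (volume.restrict Ω) := ⟨hRm k, hk⟩
  rw [← Lp.norm_toLp (R k) hRmem]
  exact norm_toL2_cutoff_sub_le hΩ (hτ k) (hφ k) (hη0 k) (hη1 k) (hψ k) u hRmem

/-- Replace w_k by a nearby test function, truncate it and cut it off near 0. The results lie in
H¹₀, have the same L² limit, and have gradient norms bounded by a sequence tending to a; pass to the
weak limit. -/
theorem exists_mem_H1Zero_of_tendsto (hN : 3 ≤ N) (hΩ : IsOpen Ω) (h0 : 0 ∉ Ω) {ρ : ℕ → ℝ}
    (hρ : ∀ k, ρ k ∈ Ioc (0 : ℝ) 1) (hρ0 : Tendsto ρ atTop (𝓝 0)) {w : ℕ → H1 Ω}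
    (hw : ∀ k, w k ∈ H1ZeroOn Ω (frontier Ω \ Metric.ball 0 (ρ k)))
    {u : Lp ℝ 2 (volume.restrict Ω)} (hu : Tendsto (fun k => toL2 (w k)) atTop (𝓝 u)) {a : ℝ}
    (ha : ∀ k, ‖grad (w k)‖ ≤ a) :
    ∃ z ∈ H1Zero Ω, toL2 z = u ∧ ‖grad z‖ ≤ a := by
  obtain ⟨C, hC, hcut⟩ := exists_cutoff hN
  choose η hηs hη0 hη1 hηb hηo hηd using fun k => hcut (ρ k) (hρ k)
  have happ : ∀ k : ℕ, ∃ (φ : EuclideanSpace ℝ (Fin N) → ℝ)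
      (hφ : IsTestFunction (frontier Ω \ Metric.ball 0 (ρ k))ᶜ φ),
      ‖w k - ofTest Ω hφ‖ ≤ 1 / ((k : ℝ) + 1) := fun k => by
    obtain ⟨v, hv, hd⟩ := Metric.mem_closure_iff.1 (hw k) (1 / ((k : ℝ) + 1)) (by positivity)
    obtain ⟨φ, hφ, rfl⟩ := exists_eq_ofTest hΩ hv
    exact ⟨φ, hφ, by rw [← dist_eq_norm]; exact hd.le⟩
  choose φ hφ hφw using happ
  -- With τ = ρ^{1/4} the cut-off costs (2/τ) C √ρ = 2Cτ → 0, while τ → 0 removes the truncation in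
  -- the limit.
  let τ : ℕ → ℝ := fun k => √√(ρ k)
  have hτ : ∀ k, 0 < τ k := fun k => Real.sqrt_pos.2 (Real.sqrt_pos.2 (hρ k).1)
  have hτ0 : Tendsto τ atTop (𝓝 0) := by
    have := (Real.continuous_sqrt.comp Real.continuous_sqrt).tendsto 0 |>.comp hρ0
    simpa [Function.comp_def] using this
  have hψ : ∀ k, IsTestFunction Ω (Ω.indicator fun x => η k x * smoothTrunc (τ k) (φ k x)) :=
    fun k => isTestFunction_indicator_cutoff hΩ (hφ k) (hηs k) (hηb k) (contDiff_smoothTrunc _)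
      (smoothTrunc_zero _)
  have hone : Tendsto (fun k : ℕ => 1 / ((k : ℝ) + 1)) atTop (𝓝 0) :=
    tendsto_one_div_add_atTop_nhds_zero_nat
  have hgrad : ∀ k, ‖grad (ofTest Ω (hψ k))‖ ≤ a + 1 / ((k : ℝ) + 1) + 2 * C * τ k := fun k => by
    have h1 := norm_grad_cutoff_le hΩ (hτ k) (mul_nonneg hC (Real.sqrt_nonneg _)) (hφ k) (hηs k)
      (hη0 k) (hη1 k) (hηd k) (hψ k)
    have h2 : ‖grad (ofTest Ω (hφ k))‖ ≤ a + 1 / ((k : ℝ) + 1) := by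
      have h3 : grad (ofTest Ω (hφ k)) = grad (w k) - grad (w k - ofTest Ω (hφ k)) := by
        rw [map_sub, sub_sub_cancel]
      rw [h3]
      exact (norm_sub_le _ _).trans (add_le_add (ha k) ((norm_grad_le _).trans (hφw k)))
    have h4 : 2 * (τ k)⁻¹ * (C * √(ρ k)) = 2 * C * τ k := by
      have h5 : √(ρ k) = τ k * τ k := (Real.mul_self_sqrt (Real.sqrt_nonneg _)).symm
      have := (hτ k).ne'
      rw [h5]
      field_simp
    linarith
  have hdist : Tendsto (fun k => toL2 (ofTest Ω (hφ k))) atTop (𝓝 u) := by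
    have h1 : Tendsto (fun k => ‖toL2 (w k) - u‖ + 1 / ((k : ℝ) + 1)) atTop (𝓝 0) := by
      simpa using (tendsto_iff_norm_sub_tendsto_zero.1 hu).add hone
    rw [tendsto_iff_norm_sub_tendsto_zero]
    refine squeeze_zero (fun _ => norm_nonneg _) (fun k => ?_) h1
    have h2 : toL2 (ofTest Ω (hφ k)) - u
        = (toL2 (w k) - u) - toL2 (w k - ofTest Ω (hφ k)) := by
      rw [map_sub]
      abel
    rw [h2]
    exact (norm_sub_le _ _).trans (add_le_add le_rfl ((norm_toL2_le _).trans (hφw k)))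
  have hlim : Tendsto (fun k => toL2 (ofTest Ω (hψ k))) atTop (𝓝 u) := by
    refine tendsto_toL2_cutoff hΩ hτ hτ0 hφ (fun k => (hηs k).continuous) hη0 hη1
      (fun x hx => ?_) hψ hdist
    have hx0 : 0 < ‖x‖ := norm_pos_iff.2 fun h => h0 (h ▸ hx)
    have h1 : Tendsto (fun k => 2 * ρ k) atTop (𝓝 0) := by simpa using hρ0.const_mul 2
    filter_upwards [h1.eventually_lt_const hx0] with k hk
    exact hηo k x hk.le
  have halim : Tendsto (fun k : ℕ => a + 1 / ((k : ℝ) + 1) + 2 * C * τ k) atTop (𝓝 a) := by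
    simpa using (hone.const_add a).add (hτ0.const_mul (2 * C))
  exact exists_mem_of_tendsto_of_bounded (toL2L Ω) (gradL Ω) norm_sq_H1 (H1Zero Ω)
    (Submodule.isClosed_topologicalClosure _)
    (fun k => Submodule.le_topologicalClosure _ (ofTest_mem (hψ k))) hlim halim hgrad

end ShrinkingRegion

/-! ### Limits of trial subspaces -/

section LimitSubspaces

variable {X H G : Type*} [NormedAddCommGroup X] [InnerProductSpace ℝ X]
  [NormedAddCommGroup H] [InnerProductSpace ℝ H]
  [NormedAddCommGroup G] [InnerProductSpace ℝ G]

theorem exists_orthonormal_image (ι : X →L[ℝ] H) (hι : Function.Injective ι) (F : Submodule ℝ X)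
    {m : ℕ} (hm : m < Module.finrank ℝ F) :
    ∃ f : Fin (m + 1) → X, (∀ j, f j ∈ F) ∧ Orthonormal ℝ fun j => ι (f j) := by
  have hfin : FiniteDimensional ℝ F := Module.finite_of_finrank_pos (by omega)
  have hrank : Module.finrank ℝ (F.map (ι : X →ₗ[ℝ] H)) = Module.finrank ℝ F :=
    (Submodule.equivMapOfInjective (ι : X →ₗ[ℝ] H) hι F).symm.finrank_eq
  let b := stdOrthonormalBasis ℝ (F.map (ι : X →ₗ[ℝ] H))
  have hle : m + 1 ≤ Module.finrank ℝ (F.map (ι : X →ₗ[ℝ] H)) := by omega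
  have hb : ∀ j : Fin (m + 1), ∃ x ∈ F, ι x = (b (Fin.castLE hle j) : H) := fun j =>
    (b (Fin.castLE hle j)).2
  choose f hf hfb using hb
  refine ⟨f, hf, ?_⟩
  simp only [hfb]
  have h1 : Orthonormal ℝ fun j => (b j : H) :=
    b.orthonormal.comp_linearIsometry (F.map (ι : X →ₗ[ℝ] H)).subtypeₗᵢ
  exact h1.comp _ (Fin.castLE_injective hle)

theorem exists_isCompact_of_bounded {ι : X →L[ℝ] H} {W : Submodule ℝ X}
    (hc : IsCompactOperator (ι.comp W.subtypeL)) (R : ℝ) :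
    ∃ K : Set H, IsCompact K ∧ ∀ u ∈ W, ‖u‖ ≤ R → ι u ∈ K := by
  obtain ⟨K, hK, hKs⟩ := hc.image_closedBall_subset_compact
    (f := (ι.comp W.subtypeL : W →L[ℝ] H).toLinearMap) R
  exact ⟨K, hK, fun u hu huR => hKs ⟨⟨u, hu⟩, by simpa using huR, rfl⟩⟩

/-- Limits of H-orthonormal families remain orthonormal, so no dimension is lost. The Rayleigh bound
is passed to the limit for every linear combination, since bounds on the basis vectors alone would
not give it. -/
theorem exists_submodule_of_seq {ι : X →L[ℝ] H} {γ : X →L[ℝ] G} (hι : Function.Injective ι)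
    (hX : ∀ u : X, ‖u‖ ^ 2 = ‖ι u‖ ^ 2 + ‖γ u‖ ^ 2) {W W₀ : Submodule ℝ X}
    (hc : IsCompactOperator (ι.comp W.subtypeL)) {F : ℕ → Submodule ℝ X} (hFW : ∀ k, F k ≤ W)
    {m : ℕ} (hm : ∀ k, m < Module.finrank ℝ (F k)) {x : ℝ} (hx : 0 ≤ x)
    (hF : ∀ k, ∀ u ∈ F k, ‖γ u‖ ^ 2 ≤ x * ‖ι u‖ ^ 2)
    (hlim : ∀ s : ℕ → ℕ, StrictMono s → ∀ w : ℕ → X, (∀ k, w k ∈ F (s k)) → ∀ (u : H) (a : ℝ),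
      Tendsto (fun k => ι (w k)) atTop (𝓝 u) → (∀ k, ‖γ (w k)‖ ≤ a) →
      ∃ z ∈ W₀, ι z = u ∧ ‖γ z‖ ≤ a) :
    ∃ F₀ ≤ W₀, m < Module.finrank ℝ F₀ ∧ ∀ u ∈ F₀, ‖γ u‖ ^ 2 ≤ x * ‖ι u‖ ^ 2 := by
  choose f hfF hfo using fun k => exists_orthonormal_image ι hι (F k) (hm k)
  obtain ⟨K, hK, hKs⟩ := exists_isCompact_of_bounded hc √(1 + x)
  -- Normalisation and the form bound give ‖f k j‖² ≤ 1 + x, so the images stay in one compact set.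
  have hfK : ∀ k, (fun j => ι (f k j)) ∈ Set.pi univ fun _ : Fin (m + 1) => K := fun k j _ => by
    refine hKs _ (hFW k (hfF k j)) (Real.le_sqrt_of_sq_le ?_)
    have h1 := hF k _ (hfF k j)
    have h2 : ‖ι (f k j)‖ = 1 := (hfo k).1 j
    rw [hX, h2]
    rw [h2] at h1
    linarith
  obtain ⟨e, -, s, hs, hse⟩ := (isCompact_univ_pi fun _ : Fin (m + 1) => hK).tendsto_subseq hfK
  have hsej : ∀ j, Tendsto (fun k => ι (f (s k) j)) atTop (𝓝 (e j)) := fun j =>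
    (tendsto_pi_nhds.1 hse) j
  have heo : Orthonormal ℝ e := by
    rw [orthonormal_iff_ite]
    intro j l
    refine tendsto_nhds_unique ((hsej j).inner (𝕜 := ℝ) (hsej l)) ?_
    simp only [fun k => orthonormal_iff_ite.1 (hfo (s k)) j l]
    exact tendsto_const_nhds
  have hnorm : ∀ (g : Fin (m + 1) → H), Orthonormal ℝ g → ∀ c : Fin (m + 1) → ℝ,
      ‖∑ j, c j • g j‖ ^ 2 = ∑ j, c j ^ 2 := fun g hg c => by
    rw [← real_inner_self_eq_norm_sq, hg.inner_sum]
    simp [sq]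
  -- The limits z(c) are obtained separately for each c; injectivity of ι shows below that they
  -- depend linearly on c.
  have hcomb : ∀ c : Fin (m + 1) → ℝ, ∃ z ∈ W₀, ι z = ∑ j, c j • e j ∧
      ‖γ z‖ ≤ √(x * ∑ j, c j ^ 2) := fun c => by
    refine hlim s hs (fun k => ∑ j, c j • f (s k) j)
      (fun k => Submodule.sum_mem _ fun j _ => Submodule.smul_mem _ _ (hfF _ j)) _ _ ?_ fun k => ?_
    · simp only [map_sum, map_smul]
      exact tendsto_finsetSum _ fun j _ => (hsej j).const_smul (c j)
    · refine Real.le_sqrt_of_sq_le ((hF (s k) _ (Submodule.sum_mem _ fun j _ =>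
        Submodule.smul_mem _ _ (hfF _ j))).trans (le_of_eq ?_))
      rw [map_sum]
      simp only [map_smul]
      rw [hnorm _ (hfo (s k))]
  choose z hzW hze hzγ using hcomb
  let y : Fin (m + 1) → X := fun j => z (Pi.single j 1)
  have hye : ∀ j, ι (y j) = e j := fun j => by
    simp only [y, hze]
    rw [Finset.sum_eq_single j]
    · simp
    · intro l _ hl
      simp [hl]
    · simp
  have hyl : LinearIndependent ℝ y := by
    refine LinearIndependent.of_comp (ι : X →ₗ[ℝ] H) ?_
    have : (ι : X →ₗ[ℝ] H) ∘ y = e := funext hye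
    rw [this]
    exact heo.linearIndependent
  refine ⟨Submodule.span ℝ (range y), Submodule.span_le.2 ?_, ?_, fun u hu => ?_⟩
  · rintro _ ⟨j, rfl⟩
    exact hzW _
  · rw [finrank_span_eq_card hyl, Fintype.card_fin]
    exact Nat.lt_succ_self m
  · obtain ⟨c, rfl⟩ := (Submodule.mem_span_range_iff_exists_fun ℝ).1 hu
    have h1 : ι (∑ j, c j • y j) = ∑ j, c j • e j := by
      rw [map_sum]
      simp only [map_smul, hye]
    have h2 : ∑ j, c j • y j = z c := hι (by rw [h1, hze])
    have h3 : 0 ≤ x * ∑ j, c j ^ 2 := mul_nonneg hx (Finset.sum_nonneg fun _ _ => sq_nonneg _)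
    rw [h1, hnorm e heo, h2, ← Real.sq_sqrt h3]
    gcongr
    exact hzγ c

end LimitSubspaces

/-! ### Infinite dimension of the form domains -/

section InfiniteDimensional

variable {N : ℕ} {Ω : Set (EuclideanSpace ℝ (Fin N))}

theorem ofTest_add {U : Set (EuclideanSpace ℝ (Fin N))} (hΩ : IsOpen Ω)
    {φ ψ χ : EuclideanSpace ℝ (Fin N) → ℝ} (hφ : IsTestFunction U φ) (hψ : IsTestFunction U ψ)
    (hχ : IsTestFunction U χ) (h : χ = φ + ψ) :
    ofTest Ω hχ = ofTest Ω hφ + ofTest Ω hψ := by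
  subst h
  refine toL2_injective hΩ ?_
  rw [map_add, toL2_ofTest, toL2_ofTest, toL2_ofTest, ← MemLp.toLp_add]

theorem ofTest_smul {U : Set (EuclideanSpace ℝ (Fin N))} (hΩ : IsOpen Ω)
    {φ χ : EuclideanSpace ℝ (Fin N) → ℝ} (c : ℝ) (hφ : IsTestFunction U φ)
    (hχ : IsTestFunction U χ) (h : χ = c • φ) :
    ofTest Ω hχ = c • ofTest Ω hφ := by
  subst h
  refine toL2_injective hΩ ?_
  rw [map_smul, toL2_ofTest, toL2_ofTest, ← MemLp.toLp_const_smul]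

/-- Multiplying a bump by polynomials in one coordinate embeds ℝ[X] in H¹₀: where the bump equals 1,
a vanishing product gives the polynomial infinitely many roots. -/
theorem not_finiteDimensional_of_H1Zero_le (i₀ : Fin N) (hΩ : IsOpen Ω) (hne : Ω.Nonempty)
    {W : Submodule ℝ (H1 Ω)} (hW : H1Zero Ω ≤ W) : ¬ FiniteDimensional ℝ W := by
  intro hfin
  obtain ⟨a, ha⟩ := hne
  obtain ⟨r, hr, hball⟩ := Metric.isOpen_iff.1 hΩ a ha
  let b : ContDiffBump a := ⟨r / 4, r / 2, by positivity, by linarith⟩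
  have htest : ∀ p : Polynomial ℝ, IsTestFunction Ω fun x => b x * p.eval (x i₀) := fun p => by
    have hcoord : ContDiff ℝ ∞ fun x : EuclideanSpace ℝ (Fin N) => x i₀ :=
      (EuclideanSpace.proj (𝕜 := ℝ) i₀ : EuclideanSpace ℝ (Fin N) →L[ℝ] ℝ).contDiff
    have hp : ContDiff ℝ ∞ fun t : ℝ => p.eval t := by
      have h := p.contDiff_aeval (𝕜 := ℝ) ∞
      simp only [Polynomial.coe_aeval_eq_eval] at h
      exact h
    refine ⟨b.contDiff.mul (hp.comp hcoord), b.hasCompactSupport.mul_right, ?_⟩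
    refine (tsupport_mul_subset_left).trans ?_
    rw [b.tsupport_eq]
    exact (Metric.closedBall_subset_ball (by simp only [b]; linarith)).trans hball
  let L : Polynomial ℝ →ₗ[ℝ] H1 Ω :=
    { toFun := fun p => ofTest Ω (htest p)
      map_add' := fun p q => ofTest_add hΩ _ _ _ (by
        ext x
        simp [mul_add])
      map_smul' := fun c p => ofTest_smul hΩ _ _ _ (by
        ext x
        simp [mul_left_comm]) }
  have hinj : Function.Injective L := by
    refine (injective_iff_map_eq_zero L).2 fun p hp => ?_
    have h1 : (fun x => b x * p.eval (x i₀)) =ᵐ[volume.restrict Ω] fun _ => (0 : ℝ) := by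
      have h2 : toL2 (ofTest Ω (htest p)) = 0 := by
        have : ofTest Ω (htest p) = 0 := hp
        rw [this, map_zero]
      rw [toL2_ofTest] at h2
      have h3 := ((htest p).memLp (volume.restrict Ω)).coeFn_toLp
      rw [h2] at h3
      exact h3.symm.trans (Lp.coeFn_zero ℝ 2 (volume.restrict Ω))
    have h4 := Measure.eqOn_open_of_ae_eq h1 hΩ (htest p).contDiff.continuous.continuousOn
      continuousOn_const
    refine Polynomial.eq_zero_of_infinite_isRoot p
      (Set.Infinite.mono ?_ (Set.Ioo_infinite (a := a i₀) (b := a i₀ + r / 4) (by linarith)))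
    intro s hs
    let x : EuclideanSpace ℝ (Fin N) := a + EuclideanSpace.single i₀ (s - a i₀)
    have hxd : dist x a = s - a i₀ := by
      rw [dist_eq_norm, add_sub_cancel_left, EuclideanSpace.norm_single,
        Real.norm_of_nonneg (by linarith [hs.1])]
    have hxb : b x = 1 := b.one_of_mem_closedBall (by
      rw [Metric.mem_closedBall, hxd]
      simp only [b]
      linarith [hs.2])
    have hxΩ : x ∈ Ω := hball (by
      rw [Metric.mem_ball, hxd]
      linarith [hs.2])
    have hxi : x i₀ = s := by simp [x]
    have := h4 hxΩ
    simp only [hxb, hxi, one_mul] at this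
    exact this
  have hrange : LinearMap.range L ≤ W := by
    rintro _ ⟨p, rfl⟩
    exact hW (Submodule.le_topologicalClosure _ (ofTest_mem (htest p)))
  have hfr : FiniteDimensional ℝ (LinearMap.range L) := Submodule.finiteDimensional_of_le hrange
  have hpoly : FiniteDimensional ℝ (Polynomial ℝ) :=
    Module.Finite.equiv (LinearEquiv.ofInjective L hinj).symm
  exact Module.not_finite_of_infinite_basis (Polynomial.basisMonomials ℝ) hpoly

end InfiniteDimensional

/-! ### Monotonicity, semicontinuity and the conclusion -/

section Convergence

variable {N : ℕ} {Ω : Set (EuclideanSpace ℝ (Fin N))}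

theorem neumannRegion_subset_ball {V : Set (EuclideanSpace ℝ (Fin N))}
    (hV : Bornology.IsBounded V) (hV0 : 0 ∈ V) {r ε : ℝ} (hr : Metric.diam V < r) (hε : 0 < ε) :
    neumannRegion Ω V ε ⊆ Metric.ball 0 (ε * r) := by
  rintro _ ⟨⟨v, hv, rfl⟩, -⟩
  have h1 : ‖v‖ < r := by
    rw [← dist_zero_right]
    exact (Metric.dist_le_diam_of_mem hV hv hV0).trans_lt hr
  simp only [mem_ball_zero_iff, norm_smul, Real.norm_of_nonneg hε.le]
  gcongr

theorem eq_zero_of_grad_eq_zero (hΩ : IsOpen Ω) {W : Submodule ℝ (H1 Ω)} {C : ℝ}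
    (hC : ∀ u ∈ W, ‖toL2 u‖ ≤ C * ‖grad u‖) : ∀ u ∈ W, grad u = 0 → u = 0 := fun u hu hg => by
  refine toL2_injective hΩ ?_
  have h := hC u hu
  rw [hg, norm_zero, mul_zero] at h
  rw [map_zero, norm_le_zero_iff.1 h]

/-- Eigenvalues decrease when the form domain grows. -/
theorem IsEigenvalueSequence.antitone (hΩ : IsOpen Ω) {W W' : Submodule ℝ (H1 Ω)}
    (hW : IsClosed (W : Set (H1 Ω))) (hW' : IsClosed (W' : Set (H1 Ω)))
    (hc : IsCompactOperator ((toL2L Ω).comp W.subtypeL))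
    (hc' : IsCompactOperator ((toL2L Ω).comp W'.subtypeL))
    (hP : ∀ u ∈ W, grad u = 0 → u = 0) (hP' : ∀ u ∈ W', grad u = 0 → u = 0)
    {lam lam' : ℕ → ℝ} (hlam : IsEigenvalueSequence W lam) (hlam' : IsEigenvalueSequence W' lam')
    (hle : W ≤ W') (i : ℕ) : lam' i ≤ lam i := by
  have hx := (hlam.pos i).le
  obtain ⟨F, hF, hi, hFu⟩ := (hlam.le_iff hΩ hW hc hP i hx).1 le_rfl
  exact (hlam'.le_iff hΩ hW' hc' hP' i hx).2 ⟨F, hF.trans hle, hi, hFu⟩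

/-- Lower semicontinuity of the eigenvalues as the region where the functions need not vanish
shrinks to a boundary point. -/
theorem le_of_tendsto_of_eigenvalue_le (hN : 3 ≤ N) (hΩ : IsOpen Ω) (h0 : 0 ∉ Ω)
    {Wd : Submodule ℝ (H1 Ω)} (hle : H1Zero Ω ≤ Wd)
    (hc : ∀ W ≤ Wd, IsCompactOperator ((toL2L Ω).comp W.subtypeL))
    (hP : ∀ u ∈ Wd, grad u = 0 → u = 0) {lam : ℕ → ℝ} (hlam : IsEigenvalueSequence (H1Zero Ω) lam)
    {ρ : ℕ → ℝ} (hρ : ∀ k, ρ k ∈ Ioc (0 : ℝ) 1) (hρ0 : Tendsto ρ atTop (𝓝 0))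
    {W : ℕ → Submodule ℝ (H1 Ω)} (hW : ∀ k, IsClosed (W k : Set (H1 Ω))) (hWd : ∀ k, W k ≤ Wd)
    (hWρ : ∀ k, W k ≤ H1ZeroOn Ω (frontier Ω \ Metric.ball 0 (ρ k)))
    {lamE : ℕ → ℕ → ℝ} (hlamE : ∀ k, IsEigenvalueSequence (W k) (lamE k)) {i : ℕ} {x : ℝ}
    (hx : 0 ≤ x) (hle_x : ∀ k, lamE k i ≤ x) : lam i ≤ x := by
  have hF : ∀ k, ∃ F : Submodule ℝ (H1 Ω), F ≤ W k ∧ i < Module.finrank ℝ F ∧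
      ∀ u ∈ F, ‖grad u‖ ^ 2 ≤ x * ‖toL2 u‖ ^ 2 := fun k =>
    ((hlamE k).le_iff hΩ (hW k) (hc _ (hWd k)) (fun u hu => hP u (hWd k hu)) i hx).1 (hle_x k)
  choose F hFW hi hFu using hF
  refine (hlam.le_iff hΩ (Submodule.isClosed_topologicalClosure _) (hc _ hle)
    (fun u hu => hP u (hle hu)) i hx).2 ?_
  exact exists_submodule_of_seq (ι := toL2L Ω) (γ := gradL Ω) (toL2_injective hΩ) norm_sq_H1
    (hc Wd le_rfl) (fun k => (hFW k).trans (hWd k)) hi hx hFu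
    fun s hs w hw u a hu ha => exists_mem_H1Zero_of_tendsto hN hΩ h0 (fun k => hρ (s k))
      (hρ0.comp hs.tendsto_atTop) (fun k => hWρ _ (hFW _ (hw k))) hu ha

end Convergence

end MixedEigenvalue

end

theorem proposition2p3 {n : ℕ} (hn : 2 ≤ n)
    (Ω : Set (EuclideanSpace ℝ (Fin (n + 1))))
    (hΩ_open : IsOpen Ω) (hΩ_bdd : Bornology.IsBounded Ω) (h0 : 0 ∈ frontier Ω)
    (r₀ : ℝ) (hr₀ : r₀ ∈ Ioo (0 : ℝ) 1)
    (g : EuclideanSpace ℝ (Fin n) → ℝ) (hg : MixedEigenvalue.IsC11 g)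
    (hΩg : MixedEigenvalue.IsEpigraphInBall Ω r₀ g)
    (V : Set (EuclideanSpace ℝ (Fin (n + 1))))
    (hV_open : IsOpen V) (hV_bdd : Bornology.IsBounded V) (hV0 : 0 ∈ V)
    (hV_diam : Metric.diam V < r₀) :
    (∃ lam : ℕ → ℝ,
      MixedEigenvalue.IsEigenvalueSequence (MixedEigenvalue.H1Zero Ω) lam) ∧
    (∀ ε ∈ Ioo (0 : ℝ) 1, ∃ lam : ℕ → ℝ,
      MixedEigenvalue.IsEigenvalueSequence
        (MixedEigenvalue.H1ZeroOn Ω (frontier Ω \ MixedEigenvalue.neumannRegion Ω V ε)) lam) ∧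
    ∀ (lam : ℕ → ℝ) (lamE : ℝ → ℕ → ℝ),
      MixedEigenvalue.IsEigenvalueSequence (MixedEigenvalue.H1Zero Ω) lam →
      (∀ ε ∈ Ioo (0 : ℝ) 1, MixedEigenvalue.IsEigenvalueSequence
        (MixedEigenvalue.H1ZeroOn Ω (frontier Ω \ MixedEigenvalue.neumannRegion Ω V ε))
        (lamE ε)) →
      ∀ i : ℕ, Tendsto (fun ε => lamE ε i) (𝓝[>] 0) (𝓝 (lam i)) := by
  have h0Ω : (0 : EuclideanSpace ℝ (Fin (n + 1))) ∉ Ω := fun h =>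
    (hΩ_open.inter_frontier_eq ▸ ⟨h, h0⟩ : (0 : EuclideanSpace ℝ (Fin (n + 1))) ∈ (∅ : Set _))
  have hne : Ω.Nonempty := closure_nonempty_iff.1 ⟨0, frontier_subset_closure h0⟩
  -- A radius strictly between diam V and r₀: every Neumann region lies in B_δ, and the gap r₀ − δ
  -- leaves room for the translations.
  let δ : ℝ := (Metric.diam V + r₀) / 2
  have hδr : δ < r₀ := by simp only [δ]; linarith
  have hVδ : Metric.diam V < δ := by simp only [δ]; linarith
  have hδ0 : 0 < δ := Metric.diam_nonneg.trans_lt hVδ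
  obtain ⟨v, hv0, t₀, ht₀, hv⟩ := MixedEigenvalue.exists_cone hΩ_open hg.1 hΩg hδr
  let Wd := MixedEigenvalue.H1ZeroOn Ω (frontier Ω \ Metric.ball 0 δ)
  have hc : ∀ W ≤ Wd, IsCompactOperator ((MixedEigenvalue.toL2L Ω).comp W.subtypeL) := fun W hW =>
    MixedEigenvalue.isCompactOperator_toL2L hΩ_open hΩ_bdd ht₀ hv W hW
  obtain ⟨C, hC⟩ := MixedEigenvalue.exists_norm_toL2_le hΩ_open hΩ_bdd
    (smul_ne_zero ht₀.ne' hv0) (hv t₀ ⟨ht₀, le_rfl⟩ _ (Metric.mem_ball_self (by positivity)))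
  have hP : ∀ u ∈ Wd, MixedEigenvalue.grad u = 0 → u = 0 :=
    MixedEigenvalue.eq_zero_of_grad_eq_zero hΩ_open hC
  have hDd : MixedEigenvalue.H1Zero Ω ≤ Wd :=
    MixedEigenvalue.H1Zero_le_H1ZeroOn hΩ_open sdiff_subset
  let W : ℝ → Submodule ℝ (MixedEigenvalue.H1 Ω) := fun ε =>
    MixedEigenvalue.H1ZeroOn Ω (frontier Ω \ MixedEigenvalue.neumannRegion Ω V ε)
  have hDW : ∀ ε, MixedEigenvalue.H1Zero Ω ≤ W ε := fun ε =>
    MixedEigenvalue.H1Zero_le_H1ZeroOn hΩ_open sdiff_subset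
  have hWd : ∀ ε ∈ Ioo (0 : ℝ) 1, W ε ≤ Wd := fun ε hε =>
    MixedEigenvalue.H1ZeroOn_mono (sdiff_subset_sdiff_right
      ((MixedEigenvalue.neumannRegion_subset_ball hV_bdd hV0 hVδ hε.1).trans
        (Metric.ball_subset_ball (by nlinarith [hε.2]))))
  have hD_closed : IsClosed (MixedEigenvalue.H1Zero Ω : Set (MixedEigenvalue.H1 Ω)) :=
    Submodule.isClosed_topologicalClosure _
  have hW_closed : ∀ ε, IsClosed (W ε : Set (MixedEigenvalue.H1 Ω)) := fun ε =>
    Submodule.isClosed_topologicalClosure _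
  refine ⟨?_, fun ε hε => ?_, fun lam lamE hlam hlamE i => ?_⟩
  · exact MixedEigenvalue.exists_isEigenvalueSequence hΩ_open hD_closed (hc _ hDd)
      (fun u hu => hP u (hDd hu))
      (MixedEigenvalue.not_finiteDimensional_of_H1Zero_le 0 hΩ_open hne le_rfl)
  · exact MixedEigenvalue.exists_isEigenvalueSequence hΩ_open (hW_closed ε) (hc _ (hWd ε hε))
      (fun u hu => hP u (hWd ε hε hu))
      (MixedEigenvalue.not_finiteDimensional_of_H1Zero_le 0 hΩ_open hne (hDW ε))
  · have hmem : ∀ᶠ ε in 𝓝[>] (0 : ℝ), ε ∈ Ioo (0 : ℝ) 1 := Ioo_mem_nhdsGT one_pos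
    refine tendsto_order.2 ⟨fun b hb => ?_, fun b hb => ?_⟩
    · by_contra hcon
      have hfreq : ∃ᶠ ε in 𝓝[>] (0 : ℝ), lamE ε i ≤ b ∧ ε ∈ Ioo (0 : ℝ) 1 :=
        ((not_eventually.1 hcon).mono fun ε h => not_lt.1 h).and_eventually hmem
      obtain ⟨e, he, hepos⟩ := Filter.exists_seq_forall_of_frequently hfreq
      have he0 : Tendsto e atTop (𝓝 0) := he.mono_right nhdsWithin_le_nhds
      -- Min-max is available for nonnegative levels only, so b is replaced by max b 0, still below
      -- λ_i by positivity.
      refine absurd (max_lt hb (hlam.pos i)) (not_lt.2 ?_)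
      refine MixedEigenvalue.le_of_tendsto_of_eigenvalue_le (by omega) hΩ_open h0Ω hDd hc hP hlam
        (ρ := fun k => e k * r₀) (W := fun k => W (e k)) (lamE := fun k => lamE (e k))
        (fun k => ⟨mul_pos (hepos k).2.1 hr₀.1, by nlinarith [(hepos k).2.1, (hepos k).2.2, hr₀.2]⟩)
        (by simpa using he0.mul_const r₀) (fun k => hW_closed _) (fun k => hWd _ (hepos k).2)
        (fun k => ?_) (fun k => hlamE _ (hepos k).2) (le_max_right _ _)
        (fun k => (hepos k).1.trans (le_max_left _ _))
      exact MixedEigenvalue.H1ZeroOn_mono (sdiff_subset_sdiff_right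
        (MixedEigenvalue.neumannRegion_subset_ball hV_bdd hV0 hV_diam (hepos k).2.1))
    · filter_upwards [hmem] with ε hε
      exact (hlam.antitone hΩ_open hD_closed (hW_closed ε) (hc _ hDd) (hc _ (hWd ε hε))
        (fun u hu => hP u (hDd hu)) (fun u hu => hP u (hWd ε hε hu)) (hlamE ε hε) (hDW ε)
        i).trans_lt hb
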